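/- **Verifiers and classes.** A promise problem is a pair of disjoint sets $L_{\rm yes},L_{\rm no}\subseteq\{0,1\}^*$. Fix a constant $q\in\mathbb N$. A *qubit verifier* with parameter $q$ consists of polynomials $p,R$ and a classical polynomial-time algorithm that, given $x$ and a string $r$ of $R(|x|)$ random bits, outputs a set of $q$ of the $p(|x|)$ proof qubits together with a quantum circuit over the gate set $\{\text{Hadamard},T,\mathrm{CNOT}\}$ acting on these $q$ qubits and on polynomially many ancilla qubits, initially $|0\cdots0\rangle$. For a density matrix $\rho$ on $p(|x|)$ qubits, the verifier accepts if, for uniformly random $r$, the $Z$-basis measurement of the first ancilla after the circuit gives $1$. $L\in\mathrm{QPCP}[q]$ if for some such verifier: for $x\in L_{\rm yes}$ some $\rho$ is accepted with probability at least $2/3$, and for $x\in L_{\rm no}$ every $\rho$ is accepted with probability at most $1/3$. $\mathrm{FermPCP}[q]$ is defined in the same way, except that the proof is a fermionic state on $p(|x|)$ modes (a density matrix that is an even polynomial in the $2p(|x|)$ Majorana operators $c_j$), the verifier picks $q$ modes, and the circuit, acting on the $2q$ Majorana operators of these modes and on the ancilla qubits, consists of the above qubit gates on ancillas and of gates $\exp(i\tfrac{\pi}{8}C_K\otimes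 Z_z)$, where $C_K=i^{|K|(|K|-1)/2}c_{k_1}\cdots c_{k_{|K|}}$ ($k_1<\cdots<k_{|K|}$) is a product of two or four of the chosen Majorana operators and $z$ is an ancilla qubit. Put $\mathrm{QPCP}[O(1)]=\bigcup_q\mathrm{QPCP}[q]$ and $\mathrm{FermPCP}[O(1)]=\bigcup_q\mathrm{FermPCP}[q]$. **Local Hamiltonian density (LHD).** For constants $k$, $M$ and $0<a<b$, an instance is a Hamiltonian $H=\frac1m\sum_{i=1}^mH_i$, $m\ge1$, on $n$ qubits (resp. $n$ fermionic modes), with $H_i\ge0$ and $\|H_i\|\le M$, where each $H_i$ is given by rational coefficients as a linear combination of Pauli strings supported on a set of at most $k$ qubits (resp. of monomials $C_K$ with $|K|$ even and $K$ inside a set of at most $k$ Majorana operators). With $\lambda(H)$ the smallest eigenvalue, yes-instances have $\lambda(H)\le a$ and no-instances have $\lambda(H)\ge b$. **Quantum reductions.** A polynomial-time quantum reduction from $L$ to $P$ is a polynomial-time quantum algorithm that, on every $x\in L_{\rm yes}$ (resp. $x\in L_{\rm no}$), outputs with probability at least $2/3$ a yes-instance (resp. a no-instance) of $P$. **Proposition.**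 For every constant $q$ and all constants $\frac13<a<b<\frac23$: 1. every $L\in\mathrm{QPCP}[q]$ reduces by a polynomial-time quantum reduction to the qubit LHD problem with constants $a,b$, locality $k=q$ and norm bound $M=1$; 2. every $L\in\mathrm{FermPCP}[q]$ reduces by a polynomial-time quantum reduction to the fermionic LHD problem with constants $a,b$, locality $k=2q$ Majorana operators and norm bound $M=1$. Hence the qubit LHD problem is $\mathrm{QPCP}[O(1)]$-hard, and the fermionic LHD problem is $\mathrm{FermPCP}[O(1)]$-hard, under polynomial-time quantum reductions. -/

import Mathlib

namespace QHard

open scoped ComplexOrder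

noncomputable section

/-! ## Classical polynomial time: WHILE programs over binary trees, with a step count

Values are binary trees. A program works on variables numbered by `ℕ`, all `nil` at the start except
variable `0`, which holds the input; the output is read from variable `0`.
An assignment costs one plus the size of the value that is written, a test costs one. -/

/-- Binary trees, the values of the programming language. -/
inductive Data : Type
  | nil : Data
  | cons : Data → Data → Data

/-- The number of nodes of a tree (leaves included). -/
def Data.size : Data → ℕ
  | .nil => 1
  | .cons l r => 1 + l.size + r.size

/-- Expressions of the programming language. -/
inductive Expr : Type
  | nil : Expr
  | var : ℕ → Expr
  | cons : Expr → Expr → Expr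
  | hd : Expr → Expr
  | tl : Expr → Expr

/-- The value of an expression; `hd nil = tl nil = nil`. -/
def Expr.eval (s : ℕ → Data) : Expr → Data
  | .nil => .nil
  | .var i => s i
  | .cons e f => .cons (e.eval s) (f.eval s)
  | .hd e => match e.eval s with
    | .nil => .nil
    | .cons l _ => l
  | .tl e => match e.eval s with
    | .nil => .nil
    | .cons _ r => r

/-- Programs. The tests of `ite` and `loop` ask whether the value of an expression differs
from `nil`. -/
inductive Prog : Type
  | assign : ℕ → Expr → Prog
  | seq : Prog → Prog → Prog
  | ite : Expr → Prog → Prog → Prog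
  | loop : Expr → Prog → Prog

/-- `Runs P s t s'`: started with the variables `s`, the program `P` halts after exactly `t` steps,
and then the variables are `s'`. -/
inductive Runs : Prog → (ℕ → Data) → ℕ → (ℕ → Data) → Prop
  | assign (i : ℕ) (e : Expr) (s : ℕ → Data) :
      Runs (.assign i e) s (1 + (e.eval s).size) (Function.update s i (e.eval s))
  | seq {P Q : Prog} {s s' s'' : ℕ → Data} {t t' : ℕ} :
      Runs P s t s' → Runs Q s' t' s'' → Runs (.seq P Q) s (t + t') s''
  | iteTrue {e : Expr} {P Q : Prog} {s s' : ℕ → Data} {t : ℕ} :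
      e.eval s ≠ .nil → Runs P s t s' → Runs (.ite e P Q) s (1 + t) s'
  | iteFalse {e : Expr} {P Q : Prog} {s s' : ℕ → Data} {t : ℕ} :
      e.eval s = .nil → Runs Q s t s' → Runs (.ite e P Q) s (1 + t) s'
  | loopStop {e : Expr} {P : Prog} {s : ℕ → Data} :
      e.eval s = .nil → Runs (.loop e P) s 1 s
  | loopStep {e : Expr} {P : Prog} {s s' s'' : ℕ → Data} {t t' : ℕ} :
      e.eval s ≠ .nil → Runs P s t s' → Runs (.loop e P) s' t' s'' →
      Runs (.loop e P) s (1 + t + t') s''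

/-- On the input `d` the program halts within `bound` steps, with output `d'`. -/
def Prog.ComputesWithin (P : Prog) (d d' : Data) (bound : ℕ) : Prop :=
  ∃ t ≤ bound, ∃ s : ℕ → Data,
    Runs P (Function.update (fun _ => Data.nil) 0 d) t s ∧ s 0 = d'

/-! ## Encodings of mathematical objects as trees

All natural numbers (sizes, positions, coefficients) are written in unary. -/

/-- A faithful encoding of the elements of a type by trees. -/
class Enc (α : Type) where
  enc : α → Data
  inj : Function.Injective enc

open Enc (enc)

def encBool : Bool → Data
  | false => .nil
  | true => .cons .nil .nil

instance : Enc Bool where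
  enc := encBool
  inj := by rintro (_ | _) (_ | _) h <;> first | rfl | cases h

def encNat : ℕ → Data
  | 0 => .nil
  | n + 1 => .cons .nil (encNat n)

theorem encNat_injective : Function.Injective encNat := by
  intro m
  induction m with
  | zero => rintro (_ | n) h <;> first | rfl | cases h
  | succ m ih =>
    rintro (_ | n) h
    · cases h
    · simp only [encNat, Data.cons.injEq, true_and] at h
      rw [ih h]

instance : Enc ℕ := ⟨encNat, encNat_injective⟩

instance (n : ℕ) : Enc (Fin n) :=
  ⟨fun i => enc (i : ℕ), fun _ _ h => Fin.ext (Enc.inj h)⟩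

/-- A sign followed by a natural number. -/
instance : Enc ℤ where
  enc z := match z with
    | .ofNat n => .cons (enc false) (enc n)
    | .negSucc n => .cons (enc true) (enc n)
  inj := by
    rintro (m | m) (n | n) h
    · exact congrArg _ (Enc.inj (Data.cons.inj h).2)
    · exact absurd (Enc.inj (Data.cons.inj h).1) (by simp)
    · exact absurd (Enc.inj (Data.cons.inj h).1) (by simp)
    · exact congrArg _ (Enc.inj (Data.cons.inj h).2)

instance {α β : Type} [Enc α] [Enc β] : Enc (α × β) where
  enc x := .cons (enc x.1) (enc x.2)
  inj _ _ h := Prod.ext (Enc.inj (Data.cons.inj h).1) (Enc.inj (Data.cons.inj h).2)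

instance {α β : Type} [Enc α] [Enc β] : Enc (α ⊕ β) where
  enc x := match x with
    | .inl a => .cons (enc false) (enc a)
    | .inr b => .cons (enc true) (enc b)
  inj := by
    rintro (a | a) (b | b) h
    · exact congrArg _ (Enc.inj (Data.cons.inj h).2)
    · exact absurd (Enc.inj (Data.cons.inj h).1) (by simp)
    · exact absurd (Enc.inj (Data.cons.inj h).1) (by simp)
    · exact congrArg _ (Enc.inj (Data.cons.inj h).2)

instance {β : ℕ → Type} [∀ n, Enc (β n)] : Enc (Σ n, β n) where
  enc x := .cons (enc x.1) (enc x.2)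
  inj := by
    rintro ⟨m, a⟩ ⟨n, b⟩ h
    obtain rfl : m = n := Enc.inj (Data.cons.inj h).1
    obtain rfl : a = b := Enc.inj (Data.cons.inj h).2
    rfl

def encList {α : Type} [Enc α] : List α → Data
  | [] => .nil
  | a :: l => .cons (enc a) (encList l)

theorem encList_injective {α : Type} [Enc α] : Function.Injective (encList (α := α)) := by
  intro l
  induction l with
  | nil => rintro (_ | ⟨b, l'⟩) h <;> first | rfl | cases h
  | cons a l ih =>
    rintro (_ | ⟨b, l'⟩) h
    · cases h
    · have h' := Data.cons.inj h
      rw [Enc.inj h'.1, ih h'.2]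

instance {α : Type} [Enc α] : Enc (List α) := ⟨encList, encList_injective⟩

/-- A finite sequence is written as the list of its values. -/
instance {n : ℕ} {α : Type} [Enc α] : Enc (Fin n → α) where
  enc f := enc (List.ofFn f)
  inj _ _ h := List.ofFn_injective (Enc.inj h)

/-- A set of indices is written as its membership vector. -/
instance {n : ℕ} : Enc (Finset (Fin n)) where
  enc K := enc (fun j : Fin n => decide (j ∈ K))
  inj K K' h := by
    have h' := Enc.inj h
    ext j
    simpa using congrFun h' j

/-- A selection of `q` out of `p` indices is written as its increasing list of values. -/
instance {q p : ℕ} : Enc (Fin q ↪o Fin p) where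
  enc S := enc (fun j : Fin q => S j)
  inj S S' h := by
    have h' := Enc.inj h
    ext j
    exact congrArg Fin.val (congrFun h' j)

/-! ## Operators on qubits

The Hilbert space of the qubits with labels in `ι` has the orthonormal basis `ι → Bool`. -/

/-- Operators on the qubits with labels in `ι`. -/
abbrev Op (ι : Type) := Matrix (ι → Bool) (ι → Bool) ℂ

/-- The tensor product of one single-qubit operator per qubit. -/
def tensorOp {ι : Type} [Fintype ι] (A : ι → Matrix Bool Bool ℂ) : Op ι :=
  Matrix.of fun s t => ∏ j, A j (s j) (t j)

/-- The single-qubit operator `A` on qubit `i`, the identity on all others. -/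
def onQubit {ι : Type} [Fintype ι] [DecidableEq ι] (A : Matrix Bool Bool ℂ) (i : ι) : Op ι :=
  tensorOp (Function.update (fun _ => 1) i A)

inductive Pauli : Type
  | I | X | Y | Z

/-- The Pauli matrices; `false` is the basis vector `|0⟩`, `true` is `|1⟩`. -/
def Pauli.matrix : Pauli → Matrix Bool Bool ℂ
  | .I => 1
  | .X => Matrix.of fun s t => if s = t then 0 else 1
  | .Y => Matrix.of fun s t => if s = t then 0 else if s then Complex.I else -Complex.I
  | .Z => Matrix.diagonal fun s => if s then -1 else 1

instance : Enc Pauli where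
  enc P := match P with
    | .I => enc 0
    | .X => enc 1
    | .Y => enc 2
    | .Z => enc 3
  inj := by
    intro P Q h
    cases P <;> cases Q <;> first | rfl | exact absurd (Enc.inj h) (by decide)

/-- Density matrices: positive semidefinite with trace one. -/
def IsDensity {κ : Type} [Fintype κ] (ρ : Matrix κ κ ℂ) : Prop :=
  ρ.PosSemidef ∧ ρ.trace = 1

/-- The state `|0…0⟩⟨0…0|`. -/
def zeroState (ι : Type) [Fintype ι] [DecidableEq ι] : Op ι :=
  Matrix.single (fun _ => false) (fun _ => false) 1

/-! ## Quantum circuits -/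

/-- The universal gate set Hadamard, `T`, controlled-NOT (control `c`, target `t`). -/
inductive Gate (ι : Type) : Type
  | hadamard (i : ι) : Gate ι
  | tGate (i : ι) : Gate ι
  | cnot (c t : ι) (hct : c ≠ t) : Gate ι

instance {ι : Type} [Enc ι] : Enc (Gate ι) where
  enc g := match g with
    | .hadamard i => enc ((0 : ℕ), i)
    | .tGate i => enc ((1 : ℕ), i)
    | .cnot c t _ => enc ((2 : ℕ), c, t)
  inj := by
    rintro (i | i | ⟨c, t, h⟩) (i' | i' | ⟨c', t', h'⟩) e
    all_goals first
      | (have e2 := Enc.inj (α := ι) (Data.cons.inj e).2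
         cases e2
         rfl)
      | (have e2 := Enc.inj (α := ι × ι) (Data.cons.inj e).2
         cases e2
         rfl)
      | exact absurd (Enc.inj (α := ℕ) (Data.cons.inj e).1) (by simp)

/-- Relabel the qubits on which a gate acts. -/
def Gate.relabel {ι κ : Type} (f : ι ↪ κ) : Gate ι → Gate κ
  | .hadamard i => .hadamard (f i)
  | .tGate i => .tGate (f i)
  | .cnot c t h => .cnot (f c) (f t) (fun e => h (f.injective e))

/-- The unitary of a gate. -/
def Gate.op {ι : Type} [Fintype ι] [DecidableEq ι] : Gate ι → Op ι
  | .hadamard i =>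
      onQubit (Matrix.of fun s t => (if s && t then (-1 : ℂ) else 1) / (Real.sqrt 2 : ℂ)) i
  | .tGate i =>
      onQubit (Matrix.diagonal fun s => if s then Complex.exp (Complex.I * Real.pi / 4) else 1) i
  | .cnot c t _ =>
      Matrix.of fun s u => if s = Function.update u t (xor (u t) (u c)) then 1 else 0

/-- The unitary of a circuit, a list of gates of which the head is applied first. -/
def circuitOp {ι : Type} [Fintype ι] [DecidableEq ι] : List (Gate ι) → Op ι
  | [] => 1
  | g :: gs => circuitOp gs * g.op

/-! ## Promise problems and polynomial-time quantum reductions -/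

structure PromiseProblem (α : Type) where
  yes : Set α
  no : Set α
  disj : Disjoint yes no

open Classical in
/-- Consider a family of circuits, one for each string `w` of `R` coins. A uniformly random `w` is
drawn, the circuit is applied to `|0…0⟩`, and all its qubits are measured in the computational
basis. This is the probability that the coins `w` and the outcome `y` satisfy `good`. -/
def runProb {R : ℕ} (C : (Fin R → Bool) → Σ a, List (Gate (Fin a)))
    (good : (w : Fin R → Bool) → (Fin (C w).1 → Bool) → Prop) : ℝ :=
  (1 / 2 ^ R) * ∑ w : Fin R → Bool, ∑ y : Fin (C w).1 → Bool,
    if good w y then ‖circuitOp (C w).2 y (fun _ => false)‖ ^ 2 else 0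

/-- `L` reduces to `P` by a polynomial-time quantum reduction with bounded error. A polynomial-time
quantum algorithm draws coins `w`, computes a quantum circuit from the input `x` and `w` in
polynomial time, runs the circuit on `|0…0⟩`, measures all qubits, and computes its output from `x`,
`w` and the outcome `y` in polynomial time. With probability at least `2/3` it must map a
yes-instance to a yes-instance, and a no-instance to a no-instance. -/
def QuantumPolyReduces {β : Type} [Enc β] (L : PromiseProblem (List Bool)) (P : PromiseProblem β) :
    Prop :=
  ∃ (R time : Polynomial ℕ) (prep post : Prog)
    (C : (x : List Bool) → (Fin (R.eval x.length) → Bool) → Σ a, List (Gate (Fin a)))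
    (F : (x : List Bool) → (w : Fin (R.eval x.length) → Bool) → (Fin (C x w).1 → Bool) → β),
    (∀ x w, prep.ComputesWithin (enc (x, w)) (enc (C x w)) (time.eval x.length)) ∧
    (∀ x w y, post.ComputesWithin (enc (x, w, y)) (enc (F x w y)) (time.eval x.length)) ∧
    (∀ x ∈ L.yes, 2 / 3 ≤ runProb (C x) (fun w y => F x w y ∈ P.yes)) ∧
    (∀ x ∈ L.no, 2 / 3 ≤ runProb (C x) (fun w y => F x w y ∈ P.no))

/-- Hardness of `P` for a class of promise problems under polynomial-time quantum reductions. -/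
def IsQuantumHard {β : Type} [Enc β] (P : PromiseProblem β)
    (𝒞 : Set (PromiseProblem (List Bool))) : Prop :=
  ∀ L ∈ 𝒞, QuantumPolyReduces L P

/-! ## The class QPCP -/

/-- What a qubit verifier does for one value of her random bits: she picks `q` of the `p` proof
qubits, and runs a circuit on these `q` qubits and `a + 1` ancilla qubits. -/
abbrev QubitCheck (p q : ℕ) := (Fin q ↪o Fin p) × Σ a, List (Gate (Fin q ⊕ Fin (a + 1)))

/-- The probability that the measurement of the first ancilla qubit in the `Z`-basis gives `1`
(accept), when the proof is `ρ` and the ancillas start in `|0…0⟩`. -/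
def qubitAccept {p q : ℕ} (ρ : Op (Fin p)) (V : QubitCheck p q) : ℝ :=
  let a := V.2.1
  let U : Op (Fin p ⊕ Fin (a + 1)) := circuitOp (V.2.2.map
    (Gate.relabel (V.1.toEmbedding.sumMap (Function.Embedding.refl (Fin (a + 1))))))
  let input : Op (Fin p ⊕ Fin (a + 1)) :=
    (Matrix.kronecker ρ (zeroState (Fin (a + 1)))).submatrix
      (Equiv.sumArrowEquivProdArrow _ _ _) (Equiv.sumArrowEquivProdArrow _ _ _)
  let accept : Op (Fin p ⊕ Fin (a + 1)) :=
    Matrix.diagonal fun s => if s (Sum.inr 0) then 1 else 0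
  (accept * (U * input * U.conjTranspose)).trace.re

/-- The class `QPCP[q]`. The proof has `p(|x|)` qubits; the verifier has `R(|x|)` random bits and
computes her check in polynomial time from `x` and the random bits. -/
def QPCP (q : ℕ) : Set (PromiseProblem (List Bool)) :=
  {L | ∃ (p R time : Polynomial ℕ) (verifier : Prog)
    (V : (x : List Bool) → (Fin (R.eval x.length) → Bool) → QubitCheck (p.eval x.length) q),
    (∀ x r, verifier.ComputesWithin (enc (x, r)) (enc (V x r)) (time.eval x.length)) ∧
    (∀ x ∈ L.yes, ∃ ρ : Op (Fin (p.eval x.length)), IsDensity ρ ∧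
      2 / 3 ≤ (1 / 2 ^ (R.eval x.length)) * ∑ r, qubitAccept ρ (V x r)) ∧
    (∀ x ∈ L.no, ∀ ρ : Op (Fin (p.eval x.length)), IsDensity ρ →
      (1 / 2 ^ (R.eval x.length)) * ∑ r, qubitAccept ρ (V x r) ≤ 1 / 3)}

/-! ## Fermions -/

/-- The Majorana operator of mode `j`, the first (`b = 0`) or the second (`b = 1`) of the two,
in the standard (Jordan–Wigner) representation on the `2 ^ n`-dimensional Fock space. -/
def modeMajorana {n : ℕ} (j : Fin n) (b : Fin 2) : Op (Fin n) :=
  tensorOp fun l =>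
    if l < j then Pauli.Z.matrix
    else if l = j then (if b = 0 then Pauli.X.matrix else Pauli.Y.matrix)
    else 1

/-- The Majorana operators of `n` modes; those of mode `j` have the numbers `2j` and `2j + 1`. -/
def majorana (n : ℕ) (i : Fin (n * 2)) : Op (Fin n) := modeMajorana i.divNat i.modNat

/-- The Majorana operators of the `q` modes selected by `S` among `p` modes. -/
def selectedMajorana {p q : ℕ} (S : Fin q ↪o Fin p) (i : Fin (q * 2)) : Op (Fin p) :=
  modeMajorana (S i.divNat) i.modNat

/-- The Hermitian monomial `C_K = i ^ (|K| (|K| - 1) / 2) c_{k₁} c_{k₂} ⋯`, `k₁ < k₂ < ⋯`. -/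
def majoranaMonomial {N n : ℕ} (c : Fin N → Op (Fin n)) (K : Finset (Fin N)) : Op (Fin n) :=
  Complex.I ^ (K.card * (K.card - 1) / 2) •
    ((List.finRange N).map fun j => if j ∈ K then c j else 1).prod

/-- Fermionic states: density matrices that are even polynomials in the Majorana operators. -/
def IsFermionicState {n : ℕ} (ρ : Op (Fin n)) : Prop :=
  IsDensity ρ ∧ ρ ∈ Submodule.span ℂ
    {A | ∃ K : Finset (Fin (n * 2)), Even K.card ∧ A = majoranaMonomial (majorana n) K}

/-- Gates on `q` fermionic modes and `a` ancilla qubits: the qubit gates on the ancillas, and the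
quadratic and quartic fermionic gates `exp (i (π/8) C_K ⊗ Z_z)` coupled to an ancilla qubit `z`
(on an ancilla in the state `|0⟩` this is the purely fermionic gate `exp (i (π/8) C_K)`). -/
inductive FermiGate (q a : ℕ) : Type
  | qubit (g : Gate (Fin a)) : FermiGate q a
  | rot (K : Finset (Fin (q * 2))) (hK : K.card = 2 ∨ K.card = 4) (z : Fin a) : FermiGate q a

instance {q a : ℕ} : Enc (FermiGate q a) where
  enc g := match g with
    | .qubit g => enc (false, g)
    | .rot K _ z => enc (true, K, z)
  inj := by
    rintro (g | ⟨K, h, z⟩) (g' | ⟨K', h', z'⟩) e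
    all_goals first
      | (have e2 := Enc.inj (α := Gate (Fin a)) (Data.cons.inj e).2
         cases e2
         rfl)
      | (have e2 := Enc.inj (α := Finset (Fin (q * 2)) × Fin a) (Data.cons.inj e).2
         cases e2
         rfl)
      | exact absurd (Enc.inj (α := Bool) (Data.cons.inj e).1) (by simp)

/-- The unitary of a fermionic gate applied to the modes selected by `S`. Fermions and ancilla
qubits are tensor factors. As `(C_K ⊗ Z_z)² = 1`, the exponential is a cosine plus a sine term. -/
def FermiGate.op {p q a : ℕ} (S : Fin q ↪o Fin p) :
    FermiGate q a → Matrix ((Fin p → Bool) × (Fin a → Bool)) ((Fin p → Bool) × (Fin a → Bool)) ℂ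
  | .qubit g => Matrix.kronecker 1 g.op
  | .rot K _ z => (Real.cos (Real.pi / 8) : ℂ) • 1 +
      (Complex.I * Real.sin (Real.pi / 8)) •
        Matrix.kronecker (majoranaMonomial (selectedMajorana S) K) (onQubit Pauli.Z.matrix z)

/-- The unitary of a fermionic circuit; the head of the list is applied first. -/
def fermiCircuitOp {p q a : ℕ} (S : Fin q ↪o Fin p) : List (FermiGate q a) →
    Matrix ((Fin p → Bool) × (Fin a → Bool)) ((Fin p → Bool) × (Fin a → Bool)) ℂ
  | [] => 1
  | g :: gs => fermiCircuitOp S gs * g.op S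

/-! ## The class FermPCP -/

/-- What a fermionic verifier does for one value of her random bits: she picks `q` of the `p` modes
of the proof, and runs a circuit on these `q` modes and `a + 1` ancilla qubits. -/
abbrev FermiCheck (p q : ℕ) := (Fin q ↪o Fin p) × Σ a, List (FermiGate q (a + 1))

/-- The probability that the measurement of the first ancilla qubit in the `Z`-basis gives `1`
(accept), when the proof is `ρ` and the ancillas start in `|0…0⟩`. -/
def fermiAccept {p q : ℕ} (ρ : Op (Fin p)) (V : FermiCheck p q) : ℝ :=
  let a := V.2.1
  let U := fermiCircuitOp V.1 V.2.2
  let accept : Matrix ((Fin p → Bool) × (Fin (a + 1) → Bool))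
      ((Fin p → Bool) × (Fin (a + 1) → Bool)) ℂ :=
    Matrix.diagonal fun s => if s.2 0 then 1 else 0
  (accept * (U * Matrix.kronecker ρ (zeroState (Fin (a + 1))) * U.conjTranspose)).trace.re

/-- The class `FermPCP[q]`: as `QPCP[q]`, with a fermionic state on `p(|x|)` modes as the proof. -/
def FermPCP (q : ℕ) : Set (PromiseProblem (List Bool)) :=
  {L | ∃ (p R time : Polynomial ℕ) (verifier : Prog)
    (V : (x : List Bool) → (Fin (R.eval x.length) → Bool) → FermiCheck (p.eval x.length) q),
    (∀ x r, verifier.ComputesWithin (enc (x, r)) (enc (V x r)) (time.eval x.length)) ∧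
    (∀ x ∈ L.yes, ∃ ρ : Op (Fin (p.eval x.length)), IsFermionicState ρ ∧
      2 / 3 ≤ (1 / 2 ^ (R.eval x.length)) * ∑ r, fermiAccept ρ (V x r)) ∧
    (∀ x ∈ L.no, ∀ ρ : Op (Fin (p.eval x.length)), IsFermionicState ρ →
      (1 / 2 ^ (R.eval x.length)) * ∑ r, fermiAccept ρ (V x r) ≤ 1 / 3)}

/-! ## The local Hamiltonian density problems

An instance is a number `n` and a list of `m` Hamiltonian terms `H_i`; each term is a list of
rational coefficients with basis operators (Pauli strings, respectively monomials `C_K`). -/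

/-- The rational number `z / (d + 1)`, given by `z` and `d`. -/
abbrev Coeff := ℤ × ℕ

def Coeff.value (c : Coeff) : ℝ := c.1 / (c.2 + 1)

/-- Hamiltonians with basis operators named by the elements of `W n`. -/
abbrev Hamiltonian (W : ℕ → Type) := Σ n, List (List (Coeff × W n))

/-- The operator of one Hamiltonian term. -/
def termOp {n : ℕ} {B : Type} (basis : B → Op (Fin n)) (T : List (Coeff × B)) : Op (Fin n) :=
  (T.map fun u => (Coeff.value u.1 : ℂ) • basis u.2).sum

/-- The Hamiltonian `H = (1/m) ∑ H_i`. -/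
def hamOp {n : ℕ} {B : Type} (basis : B → Op (Fin n)) (H : List (List (Coeff × B))) :
    Op (Fin n) :=
  ((H.length : ℂ)⁻¹) • (H.map (termOp basis)).sum

/-- The smallest eigenvalue of a Hermitian operator. -/
def lowestEnergy {n : ℕ} (A : Op (Fin n)) : ℝ := sInf (spectrum ℝ A)

/-- There is at least one term, and all terms satisfy `H_i ≥ 0` and `‖H_i‖ ≤ M`
(operator norm). -/
def BoundedTerms {n : ℕ} {B : Type} (basis : B → Op (Fin n)) (M : ℝ)
    (H : List (List (Coeff × B))) : Prop :=
  H ≠ [] ∧ ∀ T ∈ H, (termOp basis T).PosSemidef ∧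
    ‖Matrix.toEuclideanCLM (𝕜 := ℂ) (termOp basis T)‖ ≤ M

/-- The Pauli string named by `w`. -/
def pauliString {n : ℕ} (w : Fin n → Pauli) : Op (Fin n) := tensorOp fun j => (w j).matrix

/-- `k`-local qubit Hamiltonians: each term acts on at most `k` qubits. -/
def QubitLocal (k : ℕ) {n : ℕ} (H : List (List (Coeff × (Fin n → Pauli)))) : Prop :=
  ∀ T ∈ H, ∃ S : Finset (Fin n), S.card ≤ k ∧ ∀ u ∈ T, ∀ j, u.2 j ≠ Pauli.I → j ∈ S

/-- `k`-local fermionic Hamiltonians: each term is an even polynomial in at most `k` Majorana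
operators. -/
def FermiLocal (k : ℕ) {n : ℕ} (H : List (List (Coeff × Finset (Fin (n * 2))))) : Prop :=
  ∀ T ∈ H, ∃ S : Finset (Fin (n * 2)), S.card ≤ k ∧ ∀ u ∈ T, u.2 ⊆ S ∧ Even u.2.card

/-- The qubit local Hamiltonian density problem: decide whether `λ(H) ≤ a` or `λ(H) ≥ b` for a
`k`-local Hamiltonian with terms `0 ≤ H_i`, `‖H_i‖ ≤ M`. -/
def qubitLHD (k : ℕ) (M a b : ℝ) (hab : a < b) :
    PromiseProblem (Hamiltonian fun n => Fin n → Pauli) where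
  yes := {H | QubitLocal k H.2 ∧ BoundedTerms pauliString M H.2 ∧
    lowestEnergy (hamOp pauliString H.2) ≤ a}
  no := {H | QubitLocal k H.2 ∧ BoundedTerms pauliString M H.2 ∧
    b ≤ lowestEnergy (hamOp pauliString H.2)}
  disj := Set.disjoint_left.2 fun _ h h' => absurd (h'.2.2.trans h.2.2) (not_le.2 hab)

/-- The fermionic local Hamiltonian density problem, for Hamiltonians on `n` modes in which each
term involves at most `k` Majorana operators. -/
def fermiLHD (k : ℕ) (M a b : ℝ) (hab : a < b) :
    PromiseProblem (Hamiltonian fun n => Finset (Fin (n * 2))) where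
  yes := {H | FermiLocal k H.2 ∧ BoundedTerms (majoranaMonomial (majorana H.1)) M H.2 ∧
    lowestEnergy (hamOp (majoranaMonomial (majorana H.1)) H.2) ≤ a}
  no := {H | FermiLocal k H.2 ∧ BoundedTerms (majoranaMonomial (majorana H.1)) M H.2 ∧
    b ≤ lowestEnergy (hamOp (majoranaMonomial (majorana H.1)) H.2)}
  disj := Set.disjoint_left.2 fun _ h h' => absurd (h'.2.2.trans h.2.2) (not_le.2 hab)

end

end QHard

/-! For each random string `r` the verifier accepts a proof `ρ` with probability `tr (ρ E_r)`, where
the effect `0 ≤ E_r ≤ 1` acts only on the `q` selected sites (`qubitAccept_eq`, `fermiAccept_eq`).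
The best acceptance probability is the largest eigenvalue of the average of the `E_r`. Hence the
average of the local terms `1 - E_r` has lowest energy at most `1/3` on yes-inputs and at least
`2/3` on no-inputs. Two things separate this from an LHD instance: there are exponentially many
terms, and their coefficients can only be estimated by running the checks.

Sampling. The average over all `r` is replaced by one over `m` independent samples, with `m` linear
in the number `p` of sites. On a yes-input one good proof is fixed, and Chebyshev's inequality for
its acceptance probabilities suffices (`card_lt_sum_le`). On a no-input all states must be
controlled at once, which needs an operator inequality (`card_not_le_mul_le`): by Markov's
inequality for the trace of the `k`-th power of the sampled sum, it is enough to bound the norm of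
the mean of that power. The power is expanded into words. A sample that occurs only once in a word
can be replaced by its mean, of norm at most `1/3`, even though the factors do not commute; counting
words by such letters gives `norm_sum_sum_pow_le`. With `k` proportional to `p + 3`, the dimension
factor `2 ^ p` is absorbed.

Tomography. By `pauli_expansion` and `sum_prepSign_mul_prepExpect`, every Pauli coefficient of `E_r`
is a signed sum of acceptance probabilities on products of Pauli eigenvectors. There are `8 ^ q`
such probes. One large circuit runs each probe of each sampled check `N` times on disjoint blocks of
qubits, so the outcomes are independent, and Chebyshev's inequality with a union bound makes all
frequencies accurate (`sum_bad_registerCircuit_le`). The estimated term is shrunk and shifted by a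
multiple of the identity so that it stays between `0` and `1` (`estimateTerm_bounds`).

Fermions. Under the Jordan–Wigner transformation a fermionic gate is a Pauli rotation by the angle
of the `T` gate, hence a circuit up to a phase (`implementable_monomial`). The strings through
unselected modes are removed by conjugation with a diagonal sign (`fermiEmbed_modeMajorana`).
Effects commute with the parity, so only even monomials occur, and soundness against fermionic
proofs extends to all states by averaging over the parity (`exists_isFermionicState`).

Running time. `PolyComp` is a notion of uniform polynomial-time computability closed under
composition, pairing, case distinction and loops over lists. Both programs of the reduction are
assembled from these rules, and all data that depend only on `q` are stored in them as constants. -/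

namespace QHard

open Enc (enc)
open scoped ComplexOrder

/-! ### A calculus of polynomial-time WHILE programs. -/

noncomputable section

/-! ## Polynomial bounds -/

/-- `f` is bounded by a polynomial in `n`. -/
def PolyBdd {ι : Type} (n f : ι → ℕ) : Prop := ∃ T : Polynomial ℕ, ∀ a, f a ≤ T.eval (n a)

namespace PolyBdd

variable {ι : Type} {n f g : ι → ℕ}

theorem mono (hg : PolyBdd n g) (h : ∀ a, f a ≤ g a) : PolyBdd n f :=
  hg.imp fun _ hT a => (h a).trans (hT a)

theorem add (hf : PolyBdd n f) (hg : PolyBdd n g) : PolyBdd n fun a => f a + g a := by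
  obtain ⟨S, hS⟩ := hf
  obtain ⟨T, hT⟩ := hg
  exact ⟨S + T, fun a => by simpa using add_le_add (hS a) (hT a)⟩

theorem mul (hf : PolyBdd n f) (hg : PolyBdd n g) : PolyBdd n fun a => f a * g a := by
  obtain ⟨S, hS⟩ := hf
  obtain ⟨T, hT⟩ := hg
  exact ⟨S * T, fun a => by simpa using Nat.mul_le_mul (hS a) (hT a)⟩

theorem const (c : ℕ) : PolyBdd n fun _ => c := ⟨Polynomial.C c, fun a => by simp⟩

theorem eval (T : Polynomial ℕ) : PolyBdd n fun a => T.eval (n a) := ⟨T, fun _ => le_rfl⟩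

theorem self : PolyBdd n n := ⟨Polynomial.X, fun a => by simp⟩

theorem reindex {κ : Type} (hf : PolyBdd n f) (g : κ → ι) :
    PolyBdd (fun b => n (g b)) fun b => f (g b) :=
  hf.imp fun _ hT b => hT (g b)

end PolyBdd

/-! ## Runs of programs -/

def Data.hd : Data → Data
  | .nil => .nil
  | .cons l _ => l

def Data.tl : Data → Data
  | .nil => .nil
  | .cons _ r => r

@[simp] theorem Data.hd_nil : Data.hd .nil = .nil := rfl
@[simp] theorem Data.tl_nil : Data.tl .nil = .nil := rfl
@[simp] theorem Data.hd_cons (l r : Data) : Data.hd (.cons l r) = l := rfl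
@[simp] theorem Data.tl_cons (l r : Data) : Data.tl (.cons l r) = r := rfl
@[simp] theorem Data.size_nil : Data.size .nil = 1 := rfl
@[simp] theorem Data.size_cons (l r : Data) : Data.size (.cons l r) = 1 + l.size + r.size := rfl

theorem Data.size_hd_le (d : Data) : d.hd.size ≤ d.size := by
  cases d <;> simp; omega

theorem Data.size_tl_le (d : Data) : d.tl.size ≤ d.size := by
  cases d <;> simp

@[simp] theorem Expr.eval_nil (s : ℕ → Data) : Expr.eval s .nil = .nil := rfl
@[simp] theorem Expr.eval_var (s : ℕ → Data) (i : ℕ) : Expr.eval s (.var i) = s i := rfl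
@[simp] theorem Expr.eval_cons (s : ℕ → Data) (e f : Expr) :
    Expr.eval s (.cons e f) = .cons (e.eval s) (f.eval s) := rfl
@[simp] theorem Expr.eval_hd (s : ℕ → Data) (e : Expr) :
    Expr.eval s (.hd e) = (e.eval s).hd := by
  simp only [Expr.eval]; cases e.eval s <;> rfl
@[simp] theorem Expr.eval_tl (s : ℕ → Data) (e : Expr) :
    Expr.eval s (.tl e) = (e.eval s).tl := by
  simp only [Expr.eval]; cases e.eval s <;> rfl

theorem Runs.assign_of_eq {i : ℕ} {e : Expr} {s : ℕ → Data} {d : Data} (h : e.eval s = d) :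
    Runs (.assign i e) s (1 + d.size) (Function.update s i d) := by
  subst h; exact Runs.assign i e s

theorem Runs.congr {P : Prog} {s s' s'' : ℕ → Data} {t : ℕ} (h : Runs P s t s') (e : s' = s'') :
    Runs P s t s'' := e ▸ h

/-- Writing a tree costs at least its size, so running time bounds output size. This is why a
polynomial-time verifier has outputs of polynomial size. -/
theorem Runs.size_le {P : Prog} {s s' : ℕ → Data} {t : ℕ} (h : Runs P s t s') (i : ℕ) :
    (s' i).size ≤ (s i).size + t := by
  induction h with
  | assign j e s =>
    by_cases hij : i = j
    · subst hij; simp; omega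
    · simp [hij]
  | seq _ _ h1 h2 => omega
  | iteTrue _ _ h => omega
  | iteFalse _ _ h => omega
  | loopStop _ => omega
  | loopStep _ _ _ h1 h2 => omega

/-- All variables of an expression are below `B`. -/
def Expr.varsLT (B : ℕ) : Expr → Prop
  | .nil => True
  | .var i => i < B
  | .cons e f => e.varsLT B ∧ f.varsLT B
  | .hd e => e.varsLT B
  | .tl e => e.varsLT B

/-- All variables of a program are below `B`. -/
def Prog.varsLT (B : ℕ) : Prog → Prop
  | .assign i e => i < B ∧ e.varsLT B
  | .seq P Q => P.varsLT B ∧ Q.varsLT B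
  | .ite e P Q => e.varsLT B ∧ P.varsLT B ∧ Q.varsLT B
  | .loop e P => e.varsLT B ∧ P.varsLT B

theorem Expr.varsLT.mono {e : Expr} {B C : ℕ} (h : e.varsLT B) (hBC : B ≤ C) : e.varsLT C := by
  induction e with
  | nil => trivial
  | var i => exact lt_of_lt_of_le h hBC
  | cons e f he hf => exact ⟨he h.1, hf h.2⟩
  | hd e he => exact he h
  | tl e he => exact he h

theorem Prog.varsLT.mono {P : Prog} {B C : ℕ} (h : P.varsLT B) (hBC : B ≤ C) : P.varsLT C := by
  induction P with
  | assign i e => exact ⟨lt_of_lt_of_le h.1 hBC, h.2.mono hBC⟩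
  | seq P Q hP hQ => exact ⟨hP h.1, hQ h.2⟩
  | ite e P Q hP hQ => exact ⟨h.1.mono hBC, hP h.2.1, hQ h.2.2⟩
  | loop e P hP => exact ⟨h.1.mono hBC, hP h.2⟩

theorem Expr.exists_varsLT (e : Expr) : ∃ B, e.varsLT B := by
  induction e with
  | nil => exact ⟨0, trivial⟩
  | var i => exact ⟨i + 1, Nat.lt_succ_self i⟩
  | cons e f he hf =>
    obtain ⟨B, hB⟩ := he
    obtain ⟨C, hC⟩ := hf
    exact ⟨max B C, hB.mono (le_max_left _ _), hC.mono (le_max_right _ _)⟩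
  | hd e he => exact he
  | tl e he => exact he

theorem Prog.exists_varsLT (P : Prog) : ∃ B, P.varsLT B := by
  induction P with
  | assign i e =>
    obtain ⟨B, hB⟩ := e.exists_varsLT
    exact ⟨max (i + 1) B, lt_of_lt_of_le (Nat.lt_succ_self i) (le_max_left _ _),
      hB.mono (le_max_right _ _)⟩
  | seq P Q hP hQ =>
    obtain ⟨B, hB⟩ := hP
    obtain ⟨C, hC⟩ := hQ
    exact ⟨max B C, hB.mono (le_max_left _ _), hC.mono (le_max_right _ _)⟩
  | ite e P Q hP hQ =>
    obtain ⟨A, hA⟩ := e.exists_varsLT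
    obtain ⟨B, hB⟩ := hP
    obtain ⟨C, hC⟩ := hQ
    exact ⟨max A (max B C), hA.mono (le_max_left _ _),
      hB.mono ((le_max_left _ _).trans (le_max_right _ _)),
      hC.mono ((le_max_right _ _).trans (le_max_right _ _))⟩
  | loop e P hP =>
    obtain ⟨A, hA⟩ := e.exists_varsLT
    obtain ⟨B, hB⟩ := hP
    exact ⟨max A B, hA.mono (le_max_left _ _), hB.mono (le_max_right _ _)⟩

theorem Expr.varsLT.eval_congr {e : Expr} {B : ℕ} (h : e.varsLT B) {s s' : ℕ → Data}
    (hs : ∀ i < B, s i = s' i) : e.eval s = e.eval s' := by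
  induction e with
  | nil => rfl
  | var i => exact hs i h
  | cons e f he hf => simp [he h.1, hf h.2]
  | hd e he => simp [he h]
  | tl e he => simp [he h]

/-- A program neither reads nor changes the variables that do not occur in it. -/
theorem Runs.frame {P : Prog} {B : ℕ} {s s' : ℕ → Data} {t : ℕ} (h : Runs P s t s')
    (hP : P.varsLT B) (r : ℕ → Data) (hr : ∀ i < B, r i = s i) :
    Runs P r t fun i => if i < B then s' i else r i := by
  induction h generalizing r with
  | assign j e s =>
    have he : e.eval r = e.eval s := hP.2.eval_congr hr
    refine (he ▸ Runs.assign j e r : Runs _ _ (1 + (e.eval s).size) _).congr ?_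
    funext i
    by_cases hij : i = j
    · subst hij; simp [hP.1]
    · by_cases hi : i < B <;> simp [hij, hi, hr]
  | seq _ _ h1 h2 =>
    refine ((h1 hP.1 r hr).seq (h2 hP.2 _ fun i hi => by simp [hi])).congr ?_
    funext i; by_cases hi : i < B <;> simp [hi]
  | iteTrue he _ h =>
    exact Runs.iteTrue (by rwa [hP.1.eval_congr hr]) (h hP.2.1 r hr)
  | iteFalse he _ h =>
    exact Runs.iteFalse (by rwa [hP.1.eval_congr hr]) (h hP.2.2 r hr)
  | loopStop he =>
    refine (Runs.loopStop (by rwa [hP.1.eval_congr hr])).congr ?_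
    funext i; by_cases hi : i < B <;> simp [hi, hr]
  | loopStep he _ _ h1 h2 =>
    refine (Runs.loopStep (by rwa [hP.1.eval_congr hr]) (h1 hP.2 r hr)
      (h2 hP _ fun i hi => by simp [hi])).congr ?_
    funext i; by_cases hi : i < B <;> simp [hi]

/-- A program that sets the variables `1, …, B` to `nil`. -/
def clearProg : ℕ → Prog
  | 0 => .assign 1 .nil
  | B + 1 => .seq (clearProg B) (.assign (B + 1) .nil)

/-- The language has no empty program, so the base case already clears variable `1`; hence the
separate disjunct `i = 1`. -/
theorem runs_clearProg (B : ℕ) (s : ℕ → Data) :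
    Runs (clearProg B) s (2 * (B + 1)) fun i => if i = 1 ∨ (0 < i ∧ i ≤ B) then .nil else s i := by
  induction B with
  | zero =>
    refine (Runs.assign 1 .nil s).congr ?_
    funext i; by_cases hi : i = 1
    · simp [hi]
    · simp [hi]; omega
  | succ B ih =>
    have h := ih.seq (Runs.assign (B + 1) .nil _)
    refine h.congr ?_
    funext i
    by_cases hi : i = B + 1
    · simp [hi]
    · have : (0 < i ∧ i ≤ B + 1) ↔ (0 < i ∧ i ≤ B) := by omega
      simp [hi, this]

/-! ## Polynomial-time computations -/

/-- For every index `a`, the data `v a` are computed from the data `u a` in time polynomial in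
`n a`, by one program, which leaves all its work variables clean. -/
def PolyComp {ι : Type} (n : ι → ℕ) (u v : ι → Data) : Prop :=
  PolyBdd n (fun a => (u a).size) ∧ PolyBdd n (fun a => (v a).size) ∧
  ∃ (P : Prog) (B : ℕ) (t : ι → ℕ), PolyBdd n t ∧ ∀ a s, s 0 = u a →
    (∀ i, 0 < i → i < B → s i = .nil) → ∃ t' ≤ t a, Runs P s t' (Function.update s 0 (v a))

namespace PolyComp

variable {ι : Type} {n : ι → ℕ} {u v w c : ι → Data}

theorem computesWithin (h : PolyComp n u v) : ∃ (P : Prog) (T : Polynomial ℕ),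
    ∀ a, P.ComputesWithin (u a) (v a) (T.eval (n a)) := by
  obtain ⟨-, -, P, B, t, ⟨T, hT⟩, hP⟩ := h
  refine ⟨P, T, fun a => ?_⟩
  obtain ⟨t', ht', hr⟩ := hP a (Function.update (fun _ => Data.nil) 0 (u a)) (by simp)
    fun i hi _ => by simp [hi.ne']
  exact ⟨t', ht'.trans (hT a), _, hr, by simp⟩

/-- An arbitrary program may leave values in its work variables. All its variables lie below some
`B`, so erasing finitely many of them afterwards gives the clean form, which can be composed. The
output size is bounded by `Runs.size_le`. -/
theorem of_computesWithin (P : Prog) (T : Polynomial ℕ)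
    (hu : PolyBdd n fun a => (u a).size)
    (h : ∀ a, P.ComputesWithin (u a) (v a) (T.eval (n a))) : PolyComp n u v := by
  obtain ⟨B₀, hB₀⟩ := P.exists_varsLT
  obtain ⟨B, hB, hB1⟩ : ∃ B, P.varsLT B ∧ 0 < B := ⟨B₀ + 1, hB₀.mono (Nat.le_succ _), by omega⟩
  refine ⟨hu, (hu.add (PolyBdd.eval T)).mono fun a => ?_, .seq P (clearProg (B + 1)), B + 2,
    fun a => T.eval (n a) + 2 * (B + 2), (PolyBdd.eval T).add (PolyBdd.const _), ?_⟩
  · obtain ⟨t, ht, s, hs, hs0⟩ := h a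
    have := hs.size_le 0
    simp only [hs0, Function.update_self] at this
    omega
  · intro a s hs0 hs
    obtain ⟨t, ht, s', hr, hs0'⟩ := h a
    have hfr := hr.frame hB s fun i hi => by
      by_cases h0 : i = 0
      · simp [h0, hs0]
      · simp [h0, hs i (Nat.pos_of_ne_zero h0) (by omega)]
    refine ⟨_, ?_, (hfr.seq (runs_clearProg (B + 1) _)).congr ?_⟩
    · show _ ≤ T.eval (n a) + 2 * (B + 2)
      omega
    · funext i
      by_cases h0 : i = 0
      · subst h0; simp [hB1, hs0']
      · by_cases hi : i ≤ B + 1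
        · simp [h0, hi, Nat.pos_of_ne_zero h0, hs i (Nat.pos_of_ne_zero h0) (by omega)]
        · rw [if_neg (by omega), if_neg (by omega), Function.update_of_ne h0]

theorem bdd (h : PolyComp n u v) : PolyBdd n fun a => (v a).size := h.2.1

theorem congr (h : PolyComp n u v) (e : ∀ a, v a = w a) : PolyComp n u w := by
  obtain rfl : v = w := funext e
  exact h

theorem reindex {κ : Type} (h : PolyComp n u v) (g : κ → ι) :
    PolyComp (fun b => n (g b)) (fun b => u (g b)) fun b => v (g b) := by
  obtain ⟨hu, hv, P, B, t, ht, hP⟩ := h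
  exact ⟨hu.reindex g, hv.reindex g, P, B, fun b => t (g b), ht.reindex g, fun b => hP (g b)⟩

theorem id (hu : PolyBdd n fun a => (u a).size) : PolyComp n u u := by
  refine ⟨hu, hu, .assign 0 (.var 0), 0, fun a => 1 + (u a).size, (PolyBdd.const 1).add hu, ?_⟩
  intro a s hs _
  exact ⟨_, le_rfl, Runs.assign_of_eq (by simp [hs])⟩

theorem comp (h : PolyComp n u v) (h' : PolyComp n v w) : PolyComp n u w := by
  obtain ⟨hu, hv, P, B, t, ht, hP⟩ := h
  obtain ⟨-, hw, Q, C, t', ht', hQ⟩ := h'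
  refine ⟨hu, hw, .seq P Q, B + C, _, ht.add ht', fun a s hs0 hs => ?_⟩
  obtain ⟨k, hk, hr⟩ := hP a s hs0 fun i h0 hi => hs i h0 (by omega)
  obtain ⟨k', hk', hr'⟩ := hQ a (Function.update s 0 (v a)) (by simp) fun i h0 hi => by
    simp [h0.ne', hs i h0 (by omega)]
  exact ⟨_, add_le_add hk hk', (hr.seq hr').congr (by simp)⟩

theorem nil (hu : PolyBdd n fun a => (u a).size) : PolyComp n u fun _ => .nil :=
  ⟨hu, PolyBdd.const 1, .assign 0 .nil, 0, fun _ => 2, PolyBdd.const 2,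
    fun _ s _ _ => ⟨2, le_rfl, Runs.assign 0 .nil s⟩⟩

theorem hd (h : PolyComp n u v) : PolyComp n u fun a => (v a).hd := by
  have hv := h.bdd.mono fun a => (v a).size_hd_le
  refine h.comp ⟨h.bdd, hv, .assign 0 (.hd (.var 0)), 0, _, (PolyBdd.const 1).add hv, ?_⟩
  intro a s hs _
  exact ⟨_, le_rfl, Runs.assign_of_eq (by simp [hs])⟩

theorem tl (h : PolyComp n u v) : PolyComp n u fun a => (v a).tl := by
  have hv := h.bdd.mono fun a => (v a).size_tl_le
  refine h.comp ⟨h.bdd, hv, .assign 0 (.tl (.var 0)), 0, _, (PolyBdd.const 1).add hv, ?_⟩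
  intro a s hs _
  exact ⟨_, le_rfl, Runs.assign_of_eq (by simp [hs])⟩

/-- Both programs read and overwrite variable `0`. The input and the first result are therefore kept
in two variables beyond those covered by either program, and these are erased at the end. -/
theorem cons (h : PolyComp n u v) (h' : PolyComp n u w) :
    PolyComp n u fun a => .cons (v a) (w a) := by
  obtain ⟨hu, hv, P, B, t, ht, hP⟩ := h
  obtain ⟨-, hw, Q, C, t', ht', hQ⟩ := h'
  obtain ⟨b, hb⟩ : ∃ b, b = B + C + 1 := ⟨_, rfl⟩
  have hvw : PolyBdd n fun a => (Data.cons (v a) (w a)).size :=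
    ((PolyBdd.const 1).add hv).add hw
  have h1 := (PolyBdd.const (n := n) 1)
  refine ⟨hu, hvw, .seq (.assign b (.var 0)) (.seq P (.seq (.assign (b + 1) (.var 0))
    (.seq (.assign 0 (.var b)) (.seq Q (.seq (.assign 0 (.cons (.var (b + 1)) (.var 0)))
    (.seq (.assign b .nil) (.assign (b + 1) .nil))))))), b + 2, _,
    (h1.add hu).add (ht.add ((h1.add hv).add ((h1.add hu).add (ht'.add
      ((h1.add hvw).add (PolyBdd.const 4)))))), fun a s hs0 hs => ?_⟩
  have r1 : Runs (.assign b (.var 0)) s _ _ := Runs.assign_of_eq (d := u a) (by simp [hs0])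
  obtain ⟨k, hk, r2⟩ := hP a (Function.update s b (u a))
    (by simp [show 0 ≠ b by omega, hs0]) fun i h0 hi => by
      simp [show i ≠ b by omega, hs i h0 (by omega)]
  have r3 : Runs (.assign (b + 1) (.var 0)) _ _ _ := Runs.assign_of_eq
    (s := Function.update (Function.update s b (u a)) 0 (v a)) (d := v a) (by simp)
  have r4 : Runs (.assign 0 (.var b)) _ _ _ := Runs.assign_of_eq
    (s := Function.update (Function.update (Function.update s b (u a)) 0 (v a)) (b + 1) (v a))
    (d := u a) (by simp [show b ≠ 0 by omega])
  obtain ⟨k', hk', r5⟩ := hQ a (Function.update (Function.update (Function.update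
    (Function.update s b (u a)) 0 (v a)) (b + 1) (v a)) 0 (u a)) (by simp) fun i h0 hi => by
      simp [show i ≠ b by omega, show i ≠ b + 1 by omega, h0.ne', hs i h0 (by omega)]
  have r6 := Runs.assign_of_eq (i := 0) (e := .cons (.var (b + 1)) (.var 0))
    (s := (Function.update (Function.update (Function.update (Function.update
    (Function.update s b (u a)) 0 (v a)) (b + 1) (v a)) 0 (u a)) 0 (w a)))
    (d := .cons (v a) (w a)) (by simp)
  refine ⟨_, ?_, (r1.seq (r2.seq (r3.seq (r4.seq (r5.seq (r6.seq
    ((Runs.assign b .nil _).seq (Runs.assign (b + 1) .nil _)))))))).congr ?_⟩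
  · simp; omega
  · funext i
    by_cases h0 : i = 0
    · subst h0; simp [show b ≠ 0 by omega, show 0 ≠ b by omega]
    · by_cases hib : i = b
      · subst hib; simp [h0, hs i (by omega) (by omega)]
      · by_cases hib' : i = b + 1
        · subst hib'; simp [hs (b + 1) (by omega) (by omega)]
        · simp [h0, hib, hib']

theorem const (hu : PolyBdd n fun a => (u a).size) (d : Data) : PolyComp n u fun _ => d := by
  induction d with
  | nil => exact nil hu
  | cons l r hl hr => exact hl.cons hr

/-- Case distinction on whether `c a` is `nil`; each branch needs to be computed only where it is
taken. -/
theorem ite_subtype (hc : PolyComp n u c)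
    (hv : PolyComp (ι := {a // c a ≠ .nil}) (fun a => n a) (fun a => u a) fun a => v a)
    (hw : PolyComp (ι := {a // c a = .nil}) (fun a => n a) (fun a => u a) fun a => v a) :
    PolyComp n u v := by
  obtain ⟨hu, hcb, P, B, t, ht, hP⟩ := hc
  obtain ⟨-, ⟨S₁, hS₁⟩, P₁, B₁, t₁, ⟨T₁, hT₁⟩, hP₁⟩ := hv
  obtain ⟨-, ⟨S₂, hS₂⟩, P₂, B₂, t₂, ⟨T₂, hT₂⟩, hP₂⟩ := hw
  obtain ⟨b, hb⟩ : ∃ b, b = B + B₁ + B₂ + 1 := ⟨_, rfl⟩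
  have h1 := (PolyBdd.const (n := n) 1)
  refine ⟨hu, ?_, .seq (.assign b (.var 0)) (.seq P (.seq (.assign (b + 1) (.var 0))
    (.seq (.assign 0 (.var b)) (.seq (.assign b .nil) (.ite (.var (b + 1))
      (.seq (.assign (b + 1) .nil) P₁) (.seq (.assign (b + 1) .nil) P₂)))))), b + 2, _,
    (h1.add hu).add (ht.add ((h1.add hcb).add ((h1.add hu).add ((PolyBdd.const 5).add
      ((PolyBdd.eval T₁).add (PolyBdd.eval T₂)))))), fun a s hs0 hs => ?_⟩
  · refine ((PolyBdd.eval S₁).add (PolyBdd.eval S₂)).mono fun a => ?_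
    by_cases h : c a = .nil
    · exact (hS₂ ⟨a, h⟩).trans (Nat.le_add_left _ _)
    · exact (hS₁ ⟨a, h⟩).trans (Nat.le_add_right _ _)
  have r1 : Runs (.assign b (.var 0)) s _ _ := Runs.assign_of_eq (d := u a) (by simp [hs0])
  obtain ⟨k, hk, r2⟩ := hP a (Function.update s b (u a))
    (by simp [show 0 ≠ b by omega, hs0]) fun i h0 hi => by
      simp [show i ≠ b by omega, hs i h0 (by omega)]
  have r3 : Runs (.assign (b + 1) (.var 0)) _ _ _ := Runs.assign_of_eq
    (s := Function.update (Function.update s b (u a)) 0 (c a)) (d := c a) (by simp)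
  have r4 : Runs (.assign 0 (.var b)) _ _ _ := Runs.assign_of_eq
    (s := Function.update (Function.update (Function.update s b (u a)) 0 (c a)) (b + 1) (c a))
    (d := u a) (by simp [show b ≠ 0 by omega])
  have r5 := Runs.assign_of_eq (i := b) (e := .nil) (d := .nil)
    (s := Function.update (Function.update (Function.update (Function.update s b (u a)) 0 (c a))
      (b + 1) (c a)) 0 (u a)) (by simp)
  have e5 : Function.update (Function.update (Function.update (Function.update
      (Function.update s b (u a)) 0 (c a)) (b + 1) (c a)) 0 (u a)) b Data.nil =
      Function.update s (b + 1) (c a) := by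
    funext i
    by_cases h0 : i = 0
    · subst h0; simp [show 0 ≠ b by omega, hs0]
    · by_cases hib : i = b
      · subst hib; simp [hs i (by omega) (by omega)]
      · by_cases hib' : i = b + 1
        · subst hib'; simp
        · simp [h0, hib, hib']
  rw [e5] at r5
  -- The value of the test is erased as the first act of each branch, so that the branch program
  -- starts from the original store `s`.
  have r6 := Runs.assign_of_eq (i := b + 1) (e := .nil) (d := .nil)
    (s := Function.update s (b + 1) (c a)) (by simp)
  have e6 : Function.update (Function.update s (b + 1) (c a)) (b + 1) Data.nil = s := by
    simp [Function.update_eq_self_iff, hs (b + 1) (by omega) (by omega)]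
  rw [e6] at r6
  by_cases hca : c a = .nil
  · obtain ⟨k', hk', r7⟩ := hP₂ ⟨a, hca⟩ s hs0 fun i h0 hi => hs i h0 (by omega)
    have h7 := hT₂ ⟨a, hca⟩
    refine ⟨_, ?_, r1.seq (r2.seq (r3.seq (r4.seq (r5.seq
      (Runs.iteFalse (by simpa using hca) (r6.seq r7))))))⟩
    simp at h7 hk' ⊢; omega
  · obtain ⟨k', hk', r7⟩ := hP₁ ⟨a, hca⟩ s hs0 fun i h0 hi => hs i h0 (by omega)
    have h7 := hT₁ ⟨a, hca⟩
    refine ⟨_, ?_, r1.seq (r2.seq (r3.seq (r4.seq (r5.seq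
      (Runs.iteTrue (by simpa using hca) (r6.seq r7))))))⟩
    simp at h7 hk' ⊢; omega

open Classical in
theorem ite (hc : PolyComp n u c) (hv : PolyComp n u v) (hw : PolyComp n u w) :
    PolyComp n u fun a => if c a = .nil then v a else w a := by
  refine hc.ite_subtype ?_ ?_
  · exact (hw.reindex (Subtype.val : {a // c a ≠ .nil} → ι)).congr fun a => by simp [a.2]
  · exact (hv.reindex (Subtype.val : {a // c a = .nil} → ι)).congr fun a => by simp [a.2]

end PolyComp

end

end QHard

/-! ### Trees as lists, and loops over lists. -/

namespace QHard

open Enc (enc)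
open scoped ComplexOrder

noncomputable section

/-! ## Lists of trees -/

/-- The tree that represents a list of trees. -/
def dlist : List Data → Data
  | [] => .nil
  | d :: l => .cons d (dlist l)

@[simp] theorem dlist_nil : dlist [] = .nil := rfl
@[simp] theorem dlist_cons (d : Data) (l : List Data) : dlist (d :: l) = .cons d (dlist l) := rfl

theorem enc_list {α : Type} [Enc α] (l : List α) : enc l = dlist (l.map enc) := by
  change encList l = _
  induction l with
  | nil => rfl
  | cons a l ih => simp [encList, ih]

theorem enc_fun {α : Type} [Enc α] {k : ℕ} (f : Fin k → α) :
    enc f = dlist ((List.finRange k).map fun i => enc (f i)) := by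
  change enc (List.ofFn f) = _
  rw [enc_list, List.ofFn_eq_map, List.map_map]
  rfl

theorem enc_nat (k : ℕ) : enc k = dlist (List.replicate k .nil) := by
  change encNat k = _
  induction k with
  | zero => rfl
  | succ k ih => simp [encNat, ih, List.replicate_succ]

theorem enc_nat_zero : enc (0 : ℕ) = .nil := rfl

theorem enc_nat_succ (k : ℕ) : enc (k + 1) = .cons .nil (enc k) := rfl

theorem enc_nat_eq_nil {k : ℕ} : enc k = .nil ↔ k = 0 := by
  cases k <;> simp [enc_nat_zero, enc_nat_succ]

theorem enc_fin {k : ℕ} (i : Fin k) : enc i = enc (i : ℕ) := rfl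

theorem enc_true : enc true = .cons .nil .nil := rfl

theorem enc_false : enc false = .nil := rfl

theorem enc_inl {α β : Type} [Enc α] [Enc β] (x : α) :
    enc (Sum.inl x : α ⊕ β) = .cons .nil (enc x) := rfl

theorem enc_inr {α β : Type} [Enc α] [Enc β] (x : β) :
    enc (Sum.inr x : α ⊕ β) = .cons (.cons .nil .nil) (enc x) := rfl

theorem enc_finset {k : ℕ} (K : Finset (Fin k)) :
    enc K = enc fun j : Fin k => decide (j ∈ K) := rfl

theorem enc_orderEmbedding {q p : ℕ} (S : Fin q ↪o Fin p) : enc S = enc fun j : Fin q => S j := rfl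

theorem length_le_size_dlist (l : List Data) : l.length ≤ (dlist l).size := by
  induction l with
  | nil => simp
  | cons d l ih => simp; omega

theorem size_dlist_append (l m : List Data) :
    (dlist (l ++ m)).size + 1 = (dlist l).size + (dlist m).size := by
  induction l with
  | nil => simp; omega
  | cons d l ih => simp; omega

theorem size_dlist_reverse (l : List Data) : (dlist l.reverse).size = (dlist l).size := by
  induction l with
  | nil => rfl
  | cons d l ih =>
    have := size_dlist_append l.reverse [d]
    simp at this ⊢; omega

theorem size_dlist_drop_le (l : List Data) (k : ℕ) : (dlist (l.drop k)).size ≤ (dlist l).size := by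
  have := size_dlist_append (l.take k) (l.drop k)
  have h : 1 ≤ (dlist (l.take k)).size := by cases (dlist (l.take k)) <;> simp; omega
  rw [List.take_append_drop] at this
  omega

theorem size_dlist_take_le (l : List Data) (k : ℕ) : (dlist (l.take k)).size ≤ (dlist l).size := by
  have := size_dlist_append (l.take k) (l.drop k)
  have h : 1 ≤ (dlist (l.drop k)).size := by cases (dlist (l.drop k)) <;> simp; omega
  rw [List.take_append_drop] at this
  omega

theorem size_enc_nat (k : ℕ) : (enc k).size = 2 * k + 1 := by
  induction k with
  | zero => rfl
  | succ k ih => rw [enc_nat_succ]; simp [ih]; omega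

theorem size_dlist_le {l : List Data} {b : ℕ} (h : ∀ d ∈ l, d.size ≤ b) :
    (dlist l).size ≤ l.length * (b + 1) + 1 := by
  induction l with
  | nil => simp
  | cons d l ih =>
    have h1 := h d (by simp)
    have h2 := ih fun d hd => h d (by simp [hd])
    simp [Nat.succ_mul]; omega

namespace PolyComp

variable {ι : Type} {n : ι → ℕ} {u v w c : ι → Data}

theorem bdd_cons (hu : PolyBdd n fun a => (u a).size) (hv : PolyBdd n fun a => (v a).size) :
    PolyBdd n fun a => (Data.cons (u a) (v a)).size :=
  ((PolyBdd.const 1).add hu).add hv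

/-- A loop over a list: from the current state and the current element of the list, the body of
the loop computes the next state. -/
theorem iter_aux {l : ι → List Data} {st : ι → ℕ → Data}
    (hin : PolyBdd n fun a => (Data.cons (c a) (.cons (dlist (l a)) (st a 0))).size)
    (hs : PolyComp (ι := Σ a, Fin (l a).length) (fun t => n t.1)
      (fun t => .cons (c t.1) (.cons ((l t.1)[t.2]) (st t.1 t.2))) fun t => st t.1 (t.2 + 1)) :
    PolyComp n (fun a => .cons (c a) (.cons (dlist (l a)) (st a 0))) fun a => st a (l a).length := by
  obtain ⟨⟨S₁, hS₁⟩, ⟨S₂, hS₂⟩, P, B, t, ⟨T, hT⟩, hP⟩ := hs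
  obtain ⟨b, hb⟩ : ∃ b, b = B + 1 := ⟨_, rfl⟩
  have h1 := (PolyBdd.const (n := n) 1)
  set M : ι → ℕ := fun a => (Data.cons (c a) (.cons (dlist (l a)) (st a 0))).size with hM
  -- Cost of one pass: the test, packing the input of the body, the body itself, and shortening the
  -- list.
  set K : ι → ℕ := fun a => 1 + (1 + S₁.eval (n a)) + T.eval (n a) + (1 + M a) with hK
  have hKb : PolyBdd n K := ((h1.add (h1.add (PolyBdd.eval S₁))).add (PolyBdd.eval T)).add
    (h1.add hin)
  refine ⟨hin, (hin.add (PolyBdd.eval S₂)).mono fun a => ?_,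
    .seq (.assign b (.hd (.var 0))) (.seq (.assign (b + 1) (.hd (.tl (.var 0))))
      (.seq (.assign 0 (.tl (.tl (.var 0)))) (.seq (.loop (.var (b + 1))
        (.seq (.assign 0 (.cons (.var b) (.cons (.hd (.var (b + 1))) (.var 0))))
          (.seq P (.assign (b + 1) (.tl (.var (b + 1)))))))
        (.assign b .nil)))), b + 2, fun a => (1 + M a) + ((1 + M a) + ((1 + M a) +
          ((1 + M a * K a) + 2))), (h1.add hin).add ((h1.add hin).add ((h1.add hin).add
            ((h1.add (hin.mul hKb)).add (PolyBdd.const 2)))), ?_⟩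
  -- The final state is the initial one for an empty list, and otherwise the output of the last
  -- pass; both are bounded.
  · rcases Nat.eq_zero_or_pos (l a).length with h | h
    · simp only [Data.size_cons, hM, h]; omega
    · have := hS₂ ⟨a, ⟨(l a).length - 1, by omega⟩⟩
      simp only [show (l a).length - 1 + 1 = (l a).length by omega] at this
      exact this.trans (Nat.le_add_left _ _)
  intro a s hs0 hs
  -- Induction on the number `j` of passes that remain, after `k` passes have been made. The store
  -- is generalized because every pass changes it.
  have loop : ∀ j k, k + j = (l a).length → ∀ s : ℕ → Data,
      s 0 = st a k → s b = c a → s (b + 1) = dlist ((l a).drop k) →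
      (∀ i, 0 < i → i < b → s i = .nil) → ∃ t' ≤ 1 + j * K a,
      Runs (.loop (.var (b + 1))
        (.seq (.assign 0 (.cons (.var b) (.cons (.hd (.var (b + 1))) (.var 0))))
          (.seq P (.assign (b + 1) (.tl (.var (b + 1))))))) s t'
        (Function.update (Function.update s 0 (st a (l a).length)) (b + 1) .nil) := by
    intro j
    induction j with
    | zero =>
      intro k hk s h0 hbs hl hs
      obtain rfl : k = (l a).length := by omega
      refine ⟨1, by omega, (Runs.loopStop (by simp [hl])).congr ?_⟩
      funext i
      by_cases hi : i = b + 1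
      · subst hi; simp [hl]
      · by_cases hi0 : i = 0
        · subst hi0; simp [h0]
        · simp [hi, hi0]
    | succ j ih =>
      intro k hk s h0 hbs hl hs
      have hk' : k < (l a).length := by omega
      rw [List.drop_eq_getElem_cons hk', dlist_cons] at hl
      have hhd : (s (b + 1)).hd = (l a)[k] := by rw [hl]; rfl
      have htl : (s (b + 1)).tl = dlist ((l a).drop (k + 1)) := by rw [hl]; rfl
      have hne : s (b + 1) ≠ .nil := by rw [hl]; exact Data.noConfusion
      have r1 := Runs.assign_of_eq (i := 0)
        (e := .cons (.var b) (.cons (.hd (.var (b + 1))) (.var 0))) (s := s)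
        (d := .cons (c a) (.cons ((l a)[k]) (st a k))) (by simp [hbs, hhd, h0])
      obtain ⟨t', ht', r2⟩ := hP ⟨a, ⟨k, hk'⟩⟩ _ (Function.update_self 0 (.cons (c a) (.cons ((l a)[k]) (st a k))) s)
        fun i h0 hi => by simp [h0.ne', hs i h0 (by omega)]
      simp only [Function.update_idem] at r2
      have r3 := Runs.assign_of_eq (i := b + 1) (e := .tl (.var (b + 1)))
        (s := Function.update s 0 (st a (k + 1))) (d := dlist ((l a).drop (k + 1))) (by
          simp [htl])
      obtain ⟨t'', ht'', r4⟩ := ih (k + 1) (by omega) _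
        (show Function.update (Function.update s 0 (st a (k + 1))) (b + 1)
          (dlist ((l a).drop (k + 1))) 0 = st a (k + 1) by simp)
        (by simp [show b ≠ 0 by omega, hbs]) (by simp) fun i h0 hi => by
          simp [h0.ne', show i ≠ b + 1 by omega, hs i h0 hi]
      refine ⟨_, ?_, (Runs.loopStep (by simpa using hne) (r1.seq (r2.seq r3)) r4).congr ?_⟩
      · have e1 := hS₁ ⟨a, ⟨k, hk'⟩⟩
        have e2 := ht'.trans (hT ⟨a, ⟨k, hk'⟩⟩)
        have e3 := size_dlist_drop_le (l a) (k + 1)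
        have e4 : (dlist (l a)).size ≤ M a := by simp only [hM, Data.size_cons]; omega
        rw [Nat.succ_mul]
        simp only [Fin.getElem_fin] at e1 e2
        simp only [hK] at ht'' ⊢
        omega
      · funext i
        by_cases hi : i = b + 1
        · subst hi; simp
        · by_cases hi0 : i = 0
          · subst hi0; simp
          · simp [hi, hi0]
  have r1 := Runs.assign_of_eq (i := b) (e := .hd (.var 0)) (s := s) (d := c a) (by simp [hs0])
  have r2 := Runs.assign_of_eq (i := b + 1) (e := .hd (.tl (.var 0)))
    (s := Function.update s b (c a)) (d := dlist (l a))
    (by simp [hs0, show 0 ≠ b by omega])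
  have r3 := Runs.assign_of_eq (i := 0) (e := .tl (.tl (.var 0)))
    (s := Function.update (Function.update s b (c a)) (b + 1) (dlist (l a))) (d := st a 0)
    (by simp [hs0, show 0 ≠ b by omega])
  obtain ⟨t', ht', r4⟩ := loop (l a).length 0 (by omega) (Function.update (Function.update
    (Function.update s b (c a)) (b + 1) (dlist (l a))) 0 (st a 0)) (by simp)
    (by simp [show b ≠ 0 by omega]) (by simp) fun i h0 hi => by
      simp [h0.ne', hi.ne, show i ≠ b + 1 by omega, hs i h0 (by omega)]
  refine ⟨_, ?_, (r1.seq (r2.seq (r3.seq (r4.seq (Runs.assign b .nil _))))).congr ?_⟩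
  · have e1 : (c a).size ≤ M a := by simp only [hM, Data.size_cons]; omega
    have e2 : (dlist (l a)).size ≤ M a := by simp only [hM, Data.size_cons]; omega
    have e3 : (st a 0).size ≤ M a := by simp only [hM, Data.size_cons]; omega
    have e4 : (l a).length * K a ≤ M a * K a :=
      Nat.mul_le_mul_right _ ((length_le_size_dlist _).trans e2)
    simp; omega
  · funext i
    by_cases h0 : i = 0
    · subst h0; simp [show 0 ≠ b by omega]
    · by_cases hib : i = b
      · subst hib; simp [h0, hs i (by omega) (by omega)]
      · by_cases hib' : i = b + 1
        · subst hib'; simp [hs (b + 1) (by omega) (by omega)]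
        · simp [h0, hib, hib']

theorem iter {l : ι → List Data} (st : ι → ℕ → Data)
    (hl : PolyComp n u fun a => dlist (l a)) (h0 : PolyComp n u fun a => st a 0)
    (hs : PolyComp (ι := Σ a, Fin (l a).length) (fun t => n t.1)
      (fun t => .cons (u t.1) (.cons ((l t.1)[t.2]) (st t.1 t.2))) fun t => st t.1 (t.2 + 1)) :
    PolyComp n u fun a => st a (l a).length :=
  ((PolyComp.id hl.1).cons (hl.cons h0)).comp
    (iter_aux (bdd_cons hl.1 (bdd_cons hl.bdd h0.bdd)) hs)

/-- Data that are known are still known when a further datum is put in front of them. -/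
theorem weaken (h : PolyComp n u v) (hw : PolyBdd n fun a => (w a).size) :
    PolyComp n (fun a => .cons (u a) (w a)) v :=
  (((PolyComp.id (u := fun a => Data.cons (u a) (w a)) (bdd_cons h.1 hw)).hd).congr
    fun _ => rfl).comp h

theorem snd (hu : PolyBdd n fun a => (u a).size) (hw : PolyBdd n fun a => (w a).size) :
    PolyComp n (fun a => .cons (u a) (w a)) w :=
  ((PolyComp.id (u := fun a => Data.cons (u a) (w a)) (bdd_cons hu hw)).tl).congr fun _ => rfl

theorem bdd_getElem {l : ι → List Data} (hl : PolyBdd n fun a => (dlist (l a)).size) :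
    PolyBdd (ι := Σ a, Fin (l a).length) (fun t => n t.1) fun t => ((l t.1)[t.2]).size := by
  refine (hl.reindex Sigma.fst).mono fun t => ?_
  have h1 := size_dlist_drop_le (l t.1) t.2
  rw [List.drop_eq_getElem_cons t.2.2, dlist_cons, Data.size_cons] at h1
  simp only [Fin.getElem_fin]
  omega

/-- A loop that pushes elements onto an accumulator reverses the list. Reversal is thus the
primitive operation, and concatenation costs two of them. -/
theorem revAppend {l m : ι → List Data} (hl : PolyComp n u fun a => dlist (l a))
    (hm : PolyComp n u fun a => dlist (m a)) :
    PolyComp n u fun a => dlist ((l a).reverse ++ m a) := by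
  have hb : PolyBdd (ι := Σ a, Fin (l a).length) (fun t => n t.1) fun t =>
      (dlist (((l t.1).take t.2).reverse ++ m t.1)).size := by
    refine ((hl.bdd.add hm.bdd).reindex Sigma.fst).mono fun t => ?_
    have h1 := size_dlist_append ((l t.1).take t.2).reverse (m t.1)
    have h2 := size_dlist_take_le (l t.1) t.2
    rw [size_dlist_reverse] at h1
    omega
  have hg := bdd_getElem hl.bdd
  refine (iter (fun a k => dlist (((l a).take k).reverse ++ m a)) hl (hm.congr fun a => by simp)
    ?_).congr fun a => by simp
  have h1 := snd (hl.1.reindex Sigma.fst) (bdd_cons hg hb)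
  refine (h1.hd.cons h1.tl).congr fun t => ?_
  rw [List.take_succ_eq_append_getElem t.2.2, List.reverse_append]
  rfl

theorem reverse {l : ι → List Data} (hl : PolyComp n u fun a => dlist (l a)) :
    PolyComp n u fun a => dlist (l a).reverse :=
  (hl.revAppend (m := fun _ => []) (nil hl.1)).congr fun a => by rw [List.append_nil]

theorem append {l m : ι → List Data} (hl : PolyComp n u fun a => dlist (l a))
    (hm : PolyComp n u fun a => dlist (m a)) :
    PolyComp n u fun a => dlist (l a ++ m a) :=
  (hl.reverse.revAppend hm).congr fun a => by rw [List.reverse_reverse]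

/-- The accumulator holds the reverse of the concatenation so far, and a single reversal at the end
restores the order. The loop rule asks for a polynomial bound on all intermediate states; it follows
since each `f t` is polynomially bounded and there are at most as many of them as the size of the
list. -/
theorem flatMap_aux {l : ι → List Data} (f : (Σ a, Fin (l a).length) → List Data)
    (hl : PolyComp n u fun a => dlist (l a))
    (hf : PolyComp (fun t : Σ a, Fin (l a).length => n t.1)
      (fun t => .cons (u t.1) ((l t.1)[t.2])) fun t => dlist (f t)) :
    PolyComp n u fun a => dlist ((List.finRange (l a).length).flatMap fun k => f ⟨a, k⟩) := by
  let pre : ι → ℕ → List Data := fun a k =>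
    ((List.finRange (l a).length).take k).flatMap fun k => f ⟨a, k⟩
  have hpre : ∀ a k, (h : k < (l a).length) → pre a (k + 1) = pre a k ++ f ⟨a, ⟨k, h⟩⟩ := by
    intro a k h
    simp only [pre]
    rw [List.take_succ_eq_append_getElem (by simpa using h), List.flatMap_append]
    simp
  obtain ⟨S, hS⟩ := hf.bdd
  have hsz : ∀ a k, k ≤ (l a).length → (dlist (pre a k)).size ≤ k * S.eval (n a) + 1 := by
    intro a k
    induction k with
    | zero => intro _; simp [pre]
    | succ k ih =>
      intro h
      have h1 := size_dlist_append (pre a k) (f ⟨a, ⟨k, h⟩⟩)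
      have h2 := hS ⟨a, ⟨k, h⟩⟩
      have h3 := ih (by omega)
      rw [hpre a k h, Nat.succ_mul]
      simp only at h2
      omega
  have hg := bdd_getElem hl.bdd
  have hb : PolyBdd (ι := Σ a, Fin (l a).length) (fun t => n t.1) fun t =>
      (dlist (pre t.1 t.2).reverse).size := by
    refine (((hl.bdd.mul (PolyBdd.eval S)).add (PolyBdd.const 1)).reindex Sigma.fst).mono
      fun t => ?_
    rw [size_dlist_reverse]
    refine (hsz _ _ t.2.2.le).trans ?_
    have := length_le_size_dlist (l t.1)
    gcongr
    omega
  have key := iter (fun a k => dlist (pre a k).reverse) hl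
    ((nil hl.1).congr fun a => by simp [pre]) (by
      have h1 := snd (hl.1.reindex Sigma.fst) (bdd_cons hg hb)
      have h2 := (PolyComp.id (bdd_cons (hl.1.reindex Sigma.fst) (bdd_cons hg hb))).hd
      have h3 : PolyComp (fun t : Σ a, Fin (l a).length => n t.1) _
        fun t => dlist (pre t.1 t.2).reverse := h1.tl
      refine (((h2.cons h1.hd).comp hf).revAppend h3).congr fun t => ?_
      rw [hpre t.1 t.2 t.2.2, List.reverse_append])
  refine key.reverse.congr fun a => ?_
  simp only [List.reverse_reverse, pre]
  rw [List.take_of_length_le (by simp)]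

/-- Concatenation of lists that are computed from a number below `k a`. -/
theorem flatMap_fin {k : ι → ℕ} (f : ∀ a, Fin (k a) → List Data) {l : ι → List Data}
    (hk : ∀ a, (l a).length = k a)
    (hl : PolyComp n u fun a => dlist (l a))
    (hf : PolyComp (fun t : Σ a, Fin (k a) => n t.1)
      (fun t => .cons (u t.1) ((l t.1)[t.2]'(by rw [hk]; exact t.2.2))) fun t => dlist (f t.1 t.2)) :
    PolyComp n u fun a => dlist ((List.finRange (k a)).flatMap (f a)) := by
  obtain rfl : (fun a => (l a).length) = k := funext hk
  exact flatMap_aux (fun t => f t.1 t.2) hl hf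

/-- Concatenation of lists that are computed from the elements of a list. -/
theorem flatMap_list {β : ι → Type} (e : ∀ a, β a → Data) {l : ∀ a, List (β a)}
    (f : ∀ a, β a → List Data)
    (hl : PolyComp n u fun a => dlist ((l a).map (e a)))
    (hf : PolyComp (fun t : Σ a, {b // b ∈ l a} => n t.1)
      (fun t => .cons (u t.1) (e t.1 t.2)) fun t => dlist (f t.1 t.2)) :
    PolyComp n u fun a => dlist ((l a).flatMap (f a)) := by
  have h := flatMap_fin (k := fun a => (l a).length) (fun a i => f a (l a)[i]) (fun a => by simp) hl
    ((hf.reindex fun t : Σ a, Fin (l a).length =>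
      (⟨t.1, (l t.1)[t.2], List.getElem_mem _⟩ : Σ a, {b // b ∈ l a})).comp
      (PolyComp.id (hf.bdd.reindex _)) |> fun h => by simpa using h)
  refine h.congr fun a => ?_
  congr 1
  conv_rhs => rw [← List.map_getElem_finRange (l a), List.flatMap_map]
  rfl

end PolyComp

end

end QHard

/-! ### Unary arithmetic, counting loops and finite tables. -/

namespace QHard

open Enc (enc)
open scoped ComplexOrder

noncomputable section

namespace PolyComp

variable {ι : Type} {n : ι → ℕ} {u v w c : ι → Data}

/-! ### Natural numbers -/

theorem natConst (hu : PolyBdd n fun a => (u a).size) (k : ℕ) : PolyComp n u fun _ => enc k :=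
  const hu _

theorem natAdd {f g : ι → ℕ} (hf : PolyComp n u fun a => enc (f a))
    (hg : PolyComp n u fun a => enc (g a)) : PolyComp n u fun a => enc (f a + g a) := by
  simp only [enc_nat] at hf hg
  exact (hf.append hg).congr fun a => by rw [enc_nat, List.replicate_add]

theorem natMul {f g : ι → ℕ} (hf : PolyComp n u fun a => enc (f a))
    (hg : PolyComp n u fun a => enc (g a)) : PolyComp n u fun a => enc (f a * g a) := by
  simp only [enc_nat] at hf hg
  refine (flatMap_aux (fun t => List.replicate (g t.1) .nil) hf
    ((hg.reindex Sigma.fst).weaken ?_)).congr fun a => ?_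
  · exact bdd_getElem hf.bdd
  · rw [enc_nat]
    congr 1
    rw [List.eq_replicate_iff]
    constructor
    · simp
    · intro b hb
      simp at hb
      exact hb.2.2

theorem natPoly (T : Polynomial ℕ) {f : ι → ℕ} (hf : PolyComp n u fun a => enc (f a)) :
    PolyComp n u fun a => enc (T.eval (f a)) := by
  induction T using Polynomial.induction_on' with
  | add p q hp hq => exact (hp.natAdd hq).congr fun a => by simp
  | monomial k c =>
    have : ∀ j, PolyComp n u fun a => enc (f a ^ j) := by
      intro j
      induction j with
      | zero => exact (natConst hf.1 1).congr fun a => by simp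
      | succ j ih => exact (ih.natMul hf).congr fun a => by rw [pow_succ]
    exact ((natConst hf.1 c).natMul (this k)).congr fun a => by simp

/-- Iterated `tl`; the convention `tl nil = nil` agrees with dropping past the end of a list. In
unary notation the same program is truncated subtraction. -/
theorem drop {l : ι → List Data} {k : ι → ℕ} (hl : PolyComp n u fun a => dlist (l a))
    (hk : PolyComp n u fun a => enc (k a)) : PolyComp n u fun a => dlist ((l a).drop (k a)) := by
  simp only [enc_nat] at hk
  refine (iter (l := fun a => List.replicate (k a) .nil) (fun a j => dlist ((l a).drop j)) hk
    (hl.congr fun a => by simp) ?_).congr fun a => by simp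
  have hb : PolyBdd (fun t : Σ a, Fin (List.replicate (k a) Data.nil).length => n t.1) fun t =>
      (dlist ((l t.1).drop t.2)).size :=
    (hl.bdd.reindex Sigma.fst).mono fun t => size_dlist_drop_le _ _
  refine ((snd (hk.1.reindex Sigma.fst) (bdd_cons (bdd_getElem hk.bdd) hb)).tl.tl).congr
    fun t => ?_
  rw [Data.tl_cons, ← List.drop_drop]
  cases (l t.1).drop t.2 <;> rfl

theorem natSub {f g : ι → ℕ} (hf : PolyComp n u fun a => enc (f a))
    (hg : PolyComp n u fun a => enc (g a)) : PolyComp n u fun a => enc (f a - g a) := by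
  simp only [enc_nat] at hf
  exact (hf.drop hg).congr fun a => by rw [enc_nat, List.drop_replicate]

theorem bool_ite {b : ι → Bool} (hb : PolyComp n u fun a => enc (b a)) (hv : PolyComp n u v)
    (hw : PolyComp n u w) : PolyComp n u fun a => if b a then v a else w a :=
  (hb.ite hw hv).congr fun a => by cases b a <;> simp [enc_true, enc_false]

/-- Two numbers are equal exactly when both truncated differences vanish, and `0` is encoded by
`nil`, which is what a test detects. -/
theorem natEq {f g : ι → ℕ} (hf : PolyComp n u fun a => enc (f a))
    (hg : PolyComp n u fun a => enc (g a)) :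
    PolyComp n u fun a => enc (decide (f a = g a)) := by
  refine (((hf.natSub hg).natAdd (hg.natSub hf)).ite (const hf.1 (enc true))
    (const hf.1 (enc false))).congr fun a => ?_
  by_cases h : f a = g a
  · simp [h, enc_nat_zero]
  · rw [if_neg (by rw [enc_nat_eq_nil]; omega)]
    simp [h]

/-! ### Loops over initial segments of the natural numbers -/

/-- The loop state is a counter together with the reversed list of its past values. -/
theorem range {k : ι → ℕ} (hk : PolyComp n u fun a => enc (k a)) :
    PolyComp n u fun a => dlist ((List.finRange (k a)).map enc) := by
  have hk' := hk
  simp only [enc_nat] at hk'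
  have hsz : ∀ j, (dlist ((List.range j).map (enc (α := ℕ))).reverse).size ≤
      j * (2 * j + 1 + 1) + 1 := by
    intro j
    rw [size_dlist_reverse]
    refine (size_dlist_le (b := 2 * j + 1) ?_).trans (by simp)
    intro d hd
    simp only [List.mem_map, List.mem_range] at hd
    obtain ⟨i, hi, rfl⟩ := hd
    rw [size_enc_nat]; omega
  have hkb : PolyBdd n k := hk.bdd.mono fun a => by simp only [size_enc_nat]; omega
  have h := iter (l := fun a => List.replicate (k a) .nil)
    (fun a j => .cons (enc j) (dlist ((List.range j).map (enc (α := ℕ))).reverse)) hk'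
    ((const hk.1 _).congr fun a => rfl) (by
      have hb : PolyBdd (fun t : Σ a, Fin (List.replicate (k a) Data.nil).length => n t.1) fun t =>
          (Data.cons (enc (t.2 : ℕ))
            (dlist ((List.range t.2).map (enc (α := ℕ))).reverse)).size := by
        refine ((((hkb.mul (((PolyBdd.const 2).mul hkb).add (PolyBdd.const 2))).add
          (PolyBdd.const 1)).add (((PolyBdd.const 2).mul hkb).add
            (PolyBdd.const 2))).reindex Sigma.fst).mono fun t => ?_
        have h1 := hsz t.2
        have h2 : (t.2 : ℕ) ≤ k t.1 := by simpa using t.2.2.le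
        have h3 : (t.2 : ℕ) * (2 * t.2 + 1 + 1) ≤ k t.1 * (2 * k t.1 + 2) :=
          Nat.mul_le_mul h2 (by omega)
        rw [Data.size_cons, size_enc_nat]
        omega
      have h1 := (snd (hk'.1.reindex Sigma.fst) (bdd_cons (bdd_getElem hk'.bdd) hb)).tl
      refine (((nil h1.1).cons h1.hd).cons (h1.hd.cons h1.tl)).congr fun t => ?_
      simp [List.range_succ, enc_nat_succ])
  have h' : PolyComp n u fun a => dlist ((List.range (k a)).map (enc (α := ℕ))).reverse :=
    h.tl.congr fun a => by rw [Data.tl_cons, List.length_replicate]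
  refine h'.reverse.congr fun a => ?_
  rw [List.reverse_reverse, ← List.map_coe_finRange_eq_range, List.map_map]
  rfl

theorem flatMapFin {k : ι → ℕ} {f : ∀ a, Fin (k a) → List Data}
    (hk : PolyComp n u fun a => enc (k a))
    (hf : PolyComp (fun t : Σ a, Fin (k a) => n t.1)
      (fun t => .cons (u t.1) (enc t.2)) fun t => dlist (f t.1 t.2)) :
    PolyComp n u fun a => dlist ((List.finRange (k a)).flatMap (f a)) :=
  flatMap_fin f (fun a => by simp) hk.range
    (by simpa using hf)

theorem mapFin {k : ι → ℕ} {f : ∀ a, Fin (k a) → Data}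
    (hk : PolyComp n u fun a => enc (k a))
    (hf : PolyComp (fun t : Σ a, Fin (k a) => n t.1)
      (fun t => .cons (u t.1) (enc t.2)) fun t => f t.1 t.2) :
    PolyComp n u fun a => dlist ((List.finRange (k a)).map (f a)) :=
  (flatMapFin (f := fun a i => [f a i]) hk (hf.cons (nil hf.1))).congr fun a => by
    rw [← List.map_eq_flatMap]

theorem bdd_fin {k : ι → ℕ} (hk : PolyBdd n fun a => (enc (k a)).size) :
    PolyBdd (fun t : Σ a, Fin (k a) => n t.1) fun t => (enc t.2).size :=
  (hk.reindex Sigma.fst).mono fun t => by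
    rw [enc_fin, size_enc_nat, size_enc_nat]
    have := t.2.2
    omega

/-! ### Tuples and tables -/

theorem nth {α : Type} [Enc α] {k : ι → ℕ} {f : ∀ a, Fin (k a) → α} {j : ∀ a, Fin (k a)}
    (hf : PolyComp n u fun a => enc (f a)) (hj : PolyComp n u fun a => enc (j a)) :
    PolyComp n u fun a => enc (f a (j a)) := by
  simp only [enc_fun, enc_fin] at hf hj
  refine ((hf.drop hj).hd).congr fun a => ?_
  rw [List.drop_eq_getElem_cons (by simp)]
  simp

/-- As `k` does not depend on the index, the whole table is a constant of the program. Its entries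
need not be computable in any uniform way, so objects obtained by choice may be stored. -/
theorem table {k : ℕ} (T : Fin k → Data) {j : ι → Fin k} (hj : PolyComp n u fun a => enc (j a)) :
    PolyComp n u fun a => T (j a) := by
  simp only [enc_fin] at hj
  refine (((const hj.1 (dlist ((List.finRange k).map T))).drop hj).hd).congr fun a => ?_
  rw [List.drop_eq_getElem_cons (by simp)]
  simp

/-- A decision tree of fixed depth `k`, with the `2 ^ k` values at its leaves. -/
theorem bool_table {k : ℕ} (T : (Fin k → Bool) → Data) {f : ι → Fin k → Bool}
    (hf : PolyComp n u fun a => enc (f a)) : PolyComp n u fun a => T (f a) := by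
  induction k with
  | zero => exact (const hf.1 (T Fin.elim0)).congr fun a => congrArg T (Subsingleton.elim _ _)
  | succ k ih =>
    simp only [enc_fun, List.finRange_succ, List.map_cons, List.map_map, dlist_cons] at hf
    have h1 : PolyComp n u fun a => enc (Fin.tail (f a)) := by
      simp only [enc_fun]
      exact hf.tl
    have h0 : PolyComp n u fun a => enc (f a 0) := hf.hd
    refine (h0.bool_ite (ih (fun g => T (Fin.cons true g)) h1)
      (ih (fun g => T (Fin.cons false g)) h1)).congr fun a => ?_
    have := Fin.cons_self_tail (f a)
    cases h : f a 0 <;> rw [h] at this <;> simp [this]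

end PolyComp

end

end QHard

/-! ### Tensor products, and circuits on subsets and blocks of qubits. -/

namespace QHard

open Enc (enc)
open scoped ComplexOrder

noncomputable section

set_option linter.unusedSectionVars false

/-! ## Products of matrices over independent systems -/

section PiOp

variable {B X : Type} [Fintype B]

/-- The tensor product of a family of matrices. -/
def piOp (M : B → Matrix X X ℂ) : Matrix (B → X) (B → X) ℂ :=
  Matrix.of fun s t => ∏ b, M b (s b) (t b)

theorem piOp_apply (M : B → Matrix X X ℂ) (s t : B → X) :
    piOp M s t = ∏ b, M b (s b) (t b) := rfl

theorem tensorOp_eq_piOp (A : B → Matrix Bool Bool ℂ) : tensorOp A = piOp A := rfl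

theorem piOp_mul [DecidableEq B] [Fintype X] (M N : B → Matrix X X ℂ) :
    piOp M * piOp N = piOp fun b => M b * N b := by
  ext s t
  simp only [Matrix.mul_apply, piOp_apply, ← Finset.prod_mul_distrib]
  rw [Finset.prod_univ_sum, Fintype.piFinset_univ]

theorem piOp_one [DecidableEq X] [DecidableEq B] : piOp (fun _ : B => (1 : Matrix X X ℂ)) = 1 := by
  ext s t
  simp only [piOp_apply, Matrix.one_apply, Finset.prod_ite_zero, Finset.prod_const_one,
    Finset.mem_univ, forall_true_left, funext_iff]

theorem piOp_conjTranspose (M : B → Matrix X X ℂ) :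
    (piOp M).conjTranspose = piOp fun b => (M b).conjTranspose := by
  ext s t
  simp [piOp_apply, Matrix.conjTranspose_apply]

end PiOp

/-! ## Operators on a part of the qubits -/

section Embed

variable {ι κ : Type} [Fintype ι] [DecidableEq ι] [Fintype κ] [DecidableEq κ]

/-- A configuration of all qubits is one of the qubits in the range of `f` together with one of the
remaining qubits. -/
def splitEquiv (f : ι ↪ κ) : (κ → Bool) ≃ (ι → Bool) × ({k // k ∉ Set.range f} → Bool) :=
  (Equiv.piEquivPiSubtypeProd (· ∈ Set.range f) _).trans
    ((Equiv.arrowCongr (Equiv.ofInjective f f.injective).symm (Equiv.refl _)).prodCongr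
      (Equiv.refl _))

theorem splitEquiv_apply (f : ι ↪ κ) (s : κ → Bool) : splitEquiv f s = (s ∘ f, fun k => s k.1) := rfl

/-- The operator `A` on the qubits in the range of `f`, the identity on all others. -/
def embedOp (f : ι ↪ κ) : Op ι →⋆ₐ[ℂ] Op κ where
  toFun A := (Matrix.kronecker A 1).submatrix (splitEquiv f) (splitEquiv f)
  map_one' := by simp [Matrix.kronecker]
  map_mul' A B := by
    rw [Matrix.submatrix_mul_equiv]
    simp [Matrix.kronecker, ← Matrix.mul_kronecker_mul]
  map_zero' := by simp [Matrix.kronecker]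
  map_add' A B := by
    ext s t
    simp [Matrix.kronecker, add_mul]
  commutes' c := by
    ext s t
    simp [Matrix.kronecker, Algebra.algebraMap_eq_smul_one, Matrix.smul_kronecker,
      Matrix.one_apply, (splitEquiv f).injective.eq_iff]
  map_star' A := by
    simp [Matrix.star_eq_conjTranspose, Matrix.kronecker, Matrix.conjTranspose_kronecker]

theorem embedOp_apply (f : ι ↪ κ) (A : Op ι) (s t : κ → Bool) :
    embedOp f A s t = A (s ∘ f) (t ∘ f) * if ∀ k ∉ Set.range f, s k = t k then 1 else 0 := by
  change (Matrix.kronecker A 1) (splitEquiv f s) (splitEquiv f t) = _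
  rw [splitEquiv_apply, splitEquiv_apply, Matrix.kronecker, Matrix.kroneckerMap_apply,
    Matrix.one_apply]
  congr 1
  simp [funext_iff]

theorem embedOp_conjTranspose (f : ι ↪ κ) (A : Op ι) :
    embedOp f A.conjTranspose = (embedOp f A).conjTranspose := map_star (embedOp f) A

theorem embedOp_tensorOp (f : ι ↪ κ) (A : κ → Matrix Bool Bool ℂ)
    (hA : ∀ k ∉ Set.range f, A k = 1) : embedOp f (tensorOp fun i => A (f i)) = tensorOp A := by
  ext s t
  rw [embedOp_apply, tensorOp_eq_piOp, tensorOp_eq_piOp, piOp_apply, piOp_apply]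
  rw [← Fintype.prod_subtype_mul_prod_subtype (· ∈ Set.range f) fun k => A k (s k) (t k)]
  refine congrArg₂ (· * ·) ?_ ?_
  · exact (Fintype.prod_equiv (M := ℂ) (Equiv.ofInjective f f.injective)
      (fun i => A (f i) ((s ∘ f) i) ((t ∘ f) i)) (fun k => A k.1 (s k) (t k)) fun i => rfl).trans
      (Finset.prod_congr (by ext; simp) fun _ _ => rfl)
  · rw [Fintype.prod_congr _ (fun k : {k // k ∉ Set.range f} => if s k = t k then (1 : ℂ) else 0)
      fun k => by rw [hA k k.2, Matrix.one_apply], Finset.prod_ite_zero]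
    simp

theorem embedOp_onQubit (f : ι ↪ κ) (A : Matrix Bool Bool ℂ) (i : ι) :
    embedOp f (onQubit A i) = onQubit A (f i) := by
  rw [onQubit, onQubit, ← embedOp_tensorOp f (Function.update (fun _ => 1) (f i) A)]
  · congr 2
    ext j : 1
    by_cases h : j = i <;> simp [h]
  · intro k hk
    rw [Function.update_of_ne]
    rintro rfl
    exact hk ⟨i, rfl⟩

/-- The one-qubit gates are tensor products. A CNOT is not, and its matrix entries are compared on
and off the range of `f`. -/
theorem Gate.op_relabel (f : ι ↪ κ) (g : Gate ι) : (g.relabel f).op = embedOp f g.op := by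
  cases g with
  | hadamard i => exact (embedOp_onQubit f _ i).symm
  | tGate i => exact (embedOp_onQubit f _ i).symm
  | cnot c t hct =>
    ext s u
    rw [embedOp_apply]
    simp only [Gate.relabel, Gate.op, Matrix.of_apply]
    rw [ite_zero_mul_ite_zero, one_mul]
    congr 1
    apply propext
    constructor
    · rintro rfl
      constructor
      · ext j
        by_cases h : j = t <;> simp [h]
      · intro k hk
        rw [Function.update_of_ne]
        rintro rfl
        exact hk ⟨t, rfl⟩
    · rintro ⟨h1, h2⟩
      ext k
      by_cases hk : k ∈ Set.range f
      · obtain ⟨j, rfl⟩ := hk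
        have := congrFun h1 j
        by_cases h : j = t
        · subst h; simpa using this
        · simpa [h] using this
      · rw [h2 k hk, Function.update_of_ne]
        rintro rfl
        exact hk ⟨t, rfl⟩

theorem circuitOp_append (l l' : List (Gate ι)) :
    circuitOp (l ++ l') = circuitOp l' * circuitOp l := by
  induction l with
  | nil => simp [circuitOp]
  | cons g l ih => simp [circuitOp, ih, mul_assoc]

theorem circuitOp_relabel (f : ι ↪ κ) (l : List (Gate ι)) :
    circuitOp (l.map (Gate.relabel f)) = embedOp f (circuitOp l) := by
  induction l with
  | nil => simp [circuitOp]
  | cons g l ih => simp [circuitOp, ih, Gate.op_relabel]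

theorem onQubit_mul (A B : Matrix Bool Bool ℂ) (i : ι) :
    onQubit A i * onQubit B i = onQubit (A * B) i := by
  rw [onQubit, onQubit, onQubit, tensorOp_eq_piOp, tensorOp_eq_piOp, piOp_mul, tensorOp_eq_piOp]
  congr 1
  ext j : 1
  by_cases h : j = i
  · subst h; simp
  · simp [h]

theorem onQubit_one (i : ι) : onQubit (1 : Matrix Bool Bool ℂ) i = 1 := by
  rw [onQubit, tensorOp_eq_piOp, ← piOp_one]
  congr 1
  ext j : 1
  by_cases h : j = i <;> simp [h]

theorem onQubit_conjTranspose (A : Matrix Bool Bool ℂ) (i : ι) :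
    (onQubit A i).conjTranspose = onQubit A.conjTranspose i := by
  rw [onQubit, tensorOp_eq_piOp, piOp_conjTranspose, onQubit, tensorOp_eq_piOp]
  congr 1
  ext j : 1
  by_cases h : j = i
  · subst h; simp
  · simp [h]

/-- The matrix of the Hadamard gate. -/
def hadamardMatrix : Matrix Bool Bool ℂ :=
  Matrix.of fun s t => (if s && t then (-1 : ℂ) else 1) / (Real.sqrt 2 : ℂ)

/-- The matrix of the gate `T`. -/
def tMatrix : Matrix Bool Bool ℂ :=
  Matrix.diagonal fun s => if s then Complex.exp (Complex.I * Real.pi / 4) else 1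

theorem ofReal_sqrt_two_mul_self : ((Real.sqrt 2 : ℝ) : ℂ) * (Real.sqrt 2 : ℝ) = 2 := by
  rw [← Complex.ofReal_mul, Real.mul_self_sqrt (by norm_num)]; norm_num

theorem hadamardMatrix_conjTranspose : hadamardMatrix.conjTranspose = hadamardMatrix := by
  ext s t
  cases s <;> cases t <;> simp [hadamardMatrix, Matrix.conjTranspose_apply]

theorem hadamardMatrix_mul_self : hadamardMatrix * hadamardMatrix = 1 := by
  have h := ofReal_sqrt_two_mul_self
  have h0 : ((Real.sqrt 2 : ℝ) : ℂ) ≠ 0 := by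
    intro h0; rw [h0] at h; norm_num at h
  ext s t
  cases s <;> cases t <;>
    simp [hadamardMatrix, Matrix.mul_apply] <;> field_simp <;> rw [pow_two, h] <;> norm_num

theorem tMatrix_conjTranspose_mul_self : tMatrix.conjTranspose * tMatrix = 1 := by
  have h : starRingEnd ℂ (Complex.exp (Complex.I * Real.pi / 4)) *
      Complex.exp (Complex.I * Real.pi / 4) = 1 := by
    rw [← Complex.exp_conj, ← Complex.exp_add]
    simp only [map_div₀, map_mul, Complex.conj_I, Complex.conj_ofReal]
    rw [show -Complex.I * (Real.pi : ℂ) / (starRingEnd ℂ) 4 + Complex.I * Real.pi / 4 = 0 by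
      rw [Complex.conj_ofNat]; ring]
    exact Complex.exp_zero
  rw [tMatrix, Matrix.diagonal_conjTranspose, Matrix.diagonal_mul_diagonal, ← Matrix.diagonal_one]
  congr 1
  ext s
  cases s <;> simp [h]

theorem Gate.op_conjTranspose_mul_self (g : Gate ι) : g.op.conjTranspose * g.op = 1 := by
  cases g with
  | hadamard i =>
    change (onQubit hadamardMatrix i).conjTranspose * onQubit hadamardMatrix i = 1
    rw [onQubit_conjTranspose, onQubit_mul, hadamardMatrix_conjTranspose, hadamardMatrix_mul_self,
      onQubit_one]
  | tGate i =>
    change (onQubit tMatrix i).conjTranspose * onQubit tMatrix i = 1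
    rw [onQubit_conjTranspose, onQubit_mul, tMatrix_conjTranspose_mul_self, onQubit_one]
  | cnot c t hct =>
    ext s u
    simp only [Gate.op, Matrix.mul_apply, Matrix.conjTranspose_apply, Matrix.of_apply,
      Matrix.one_apply, apply_ite star, star_one, star_zero, ite_mul, one_mul, zero_mul]
    rw [Finset.sum_ite_eq' Finset.univ, if_pos (Finset.mem_univ _)]
    congr 1
    apply propext
    constructor
    · intro h
      have hc : s c = u c := by simpa [hct] using congrFun h c
      ext j
      by_cases hj : j = t
      · subst hj
        have := congrFun h j
        simpa [hc] using this
      · simpa [hj] using congrFun h j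
    · rintro rfl; rfl

theorem circuitOp_conjTranspose_mul_self (l : List (Gate ι)) :
    (circuitOp l).conjTranspose * circuitOp l = 1 := by
  induction l with
  | nil => simp [circuitOp]
  | cons g l ih =>
    rw [circuitOp, Matrix.conjTranspose_mul, mul_assoc, ← mul_assoc _ (circuitOp l), ih, one_mul,
      g.op_conjTranspose_mul_self]

end Embed

/-! ## Circuits that act separately on blocks of qubits -/

section Blocks

variable {B ι κ : Type} [Fintype B] [DecidableEq B] [Fintype ι] [DecidableEq ι] [Fintype κ]
  [DecidableEq κ]

/-- The qubits of block `b`. -/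
def blockEmb (e : B × κ ≃ ι) (b : B) : κ ↪ ι :=
  ⟨fun k => e (b, k), fun _ _ h => (Prod.ext_iff.1 (e.injective h)).2⟩

/-- Configurations of all qubits as families of configurations of the blocks. -/
def blockEquiv (e : B × κ ≃ ι) : (ι → Bool) ≃ (B → κ → Bool) :=
  (Equiv.arrowCongr e.symm (Equiv.refl Bool)).trans (Equiv.curry B κ Bool)

theorem embedOp_blockEmb (e : B × κ ≃ ι) (b : B) (A : Op κ) :
    embedOp (blockEmb e b) A =
      (piOp (Function.update (fun _ => 1) b A)).submatrix (blockEquiv e) (blockEquiv e) := by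
  ext s t
  rw [embedOp_apply, Matrix.submatrix_apply, piOp_apply, Fintype.prod_eq_mul_prod_compl b]
  rw [Function.update_self]
  congr 1
  rw [Finset.prod_congr rfl (g := fun b' => if blockEquiv e s b' = blockEquiv e t b'
    then (1 : ℂ) else 0) fun b' hb' => by
      rw [Function.update_of_ne (by simpa using hb'), Matrix.one_apply], Finset.prod_ite_zero,
    Finset.prod_const_one]
  congr 1
  apply propext
  constructor
  · intro h b' hb'
    ext k
    refine h _ ?_
    rintro ⟨k', hk'⟩
    have := (Prod.ext_iff.1 (e.injective hk')).1
    simp_all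
  · intro h k hk
    obtain ⟨⟨b', k'⟩, rfl⟩ := e.surjective k
    refine congrFun (h b' ?_) k'
    simp only [Finset.mem_compl, Finset.mem_singleton]
    rintro rfl
    exact hk ⟨k', rfl⟩

theorem circuitOp_blocks (e : B × κ ≃ ι) (gs : B → List (Gate κ)) (l : List B) (hl : l.Nodup) :
    circuitOp (l.flatMap fun b => (gs b).map (Gate.relabel (blockEmb e b))) =
      (piOp fun b => if b ∈ l then circuitOp (gs b) else 1).submatrix
        (blockEquiv e) (blockEquiv e) := by
  induction l with
  | nil => simp [circuitOp, piOp_one]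
  | cons b l ih =>
    rw [List.nodup_cons] at hl
    rw [List.flatMap_cons, circuitOp_append, ih hl.2, circuitOp_relabel, embedOp_blockEmb,
      Matrix.submatrix_mul_equiv, piOp_mul]
    congr 2
    ext b' : 1
    by_cases h : b' = b
    · subst h; simp [hl.1]
    · by_cases h' : b' ∈ l <;> simp [h, h']

/-- Amplitudes factor over the blocks, so the measurement outcomes of different blocks are
independent. All statistics of the reduction rest on this. -/
theorem circuitOp_blocks_apply (e : B × κ ≃ ι) (gs : B → List (Gate κ)) (l : List B)
    (hl : l.Nodup) (hl' : ∀ b, b ∈ l) (s t : ι → Bool) :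
    circuitOp (l.flatMap fun b => (gs b).map (Gate.relabel (blockEmb e b))) s t =
      ∏ b, circuitOp (gs b) (blockEquiv e s b) (blockEquiv e t b) := by
  rw [circuitOp_blocks e gs l hl, Matrix.submatrix_apply, piOp_apply]
  exact Finset.prod_congr rfl fun b _ => by rw [if_pos (hl' b)]

end Blocks

end

end QHard

/-! ### Acceptance effects and Pauli tomography. -/

namespace QHard

open Enc (enc)
open scoped ComplexOrder MatrixOrder

noncomputable section

set_option linter.unusedSectionVars false

/-! ## Acceptance of a circuit as an effect on its input -/

section Effect

variable {α β ι κ : Type} [Fintype α] [DecidableEq α] [Fintype β] [DecidableEq β] [Fintype ι]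
  [DecidableEq ι] [Fintype κ] [DecidableEq κ]

/-- A positive matrix is of the form `star B * B`, and a star homomorphism preserves this form. -/
theorem posSemidef_map_starAlgHom {m n : Type} [Fintype m] [DecidableEq m] [Fintype n]
    [DecidableEq n] (φ : Matrix m m ℂ →⋆ₐ[ℂ] Matrix n n ℂ) {A : Matrix m m ℂ}
    (hA : A.PosSemidef) : (φ A).PosSemidef := by
  obtain ⟨B, rfl⟩ := CStarAlgebra.nonneg_iff_eq_star_mul_self.1 hA.nonneg
  rw [map_mul, map_star]
  exact Matrix.posSemidef_conjTranspose_mul_self _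

/-- The projection to the configurations in which qubit `k` is in the state `1`. -/
def projOne (k : κ) : Op κ := Matrix.diagonal fun s => if s k then 1 else 0

theorem projOne_conjTranspose (k : κ) : (projOne k).conjTranspose = projOne k := by
  rw [projOne, Matrix.diagonal_conjTranspose]
  congr 1
  ext s
  simp [apply_ite]

theorem projOne_mul_self (k : κ) : projOne k * projOne k = projOne k := by
  rw [projOne, Matrix.diagonal_mul_diagonal]
  congr 1
  ext s
  simp

theorem embedOp_projOne (f : ι ↪ κ) (i : ι) : embedOp f (projOne i) = projOne (f i) := by
  ext s t
  rw [embedOp_apply, projOne, projOne, Matrix.diagonal_apply, Matrix.diagonal_apply]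
  by_cases h : s = t
  · subst h; simp
  · rw [if_neg h]
    by_cases h1 : s ∘ f = t ∘ f
    · rw [if_neg (c := ∀ k ∉ Set.range f, s k = t k), mul_zero]
      intro h2
      apply h
      ext k
      by_cases hk : k ∈ Set.range f
      · obtain ⟨j, rfl⟩ := hk
        exact congrFun h1 j
      · exact h2 k hk
    · rw [if_neg h1, zero_mul]

/-- The projection to acceptance, before the unitary `U` is applied. -/
def pullOne (U : Op κ) (k : κ) : Op κ := U.conjTranspose * projOne k * U

theorem pullOne_posSemidef (U : Op κ) (k : κ) : (pullOne U k).PosSemidef := by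
  have h : pullOne U k = (projOne k * U).conjTranspose * (projOne k * U) := by
    rw [Matrix.conjTranspose_mul, projOne_conjTranspose, mul_assoc, ← mul_assoc (projOne k),
      projOne_mul_self, ← mul_assoc, pullOne]
  rw [h]
  exact Matrix.posSemidef_conjTranspose_mul_self _

/-- By unitarity the complement is the pullback of the projection `1 - projOne k`, again of the form
`A* A`. -/
theorem one_sub_pullOne_posSemidef {U : Op κ} (hU : U.conjTranspose * U = 1) (k : κ) :
    (1 - pullOne U k).PosSemidef := by
  have h : 1 - pullOne U k = ((1 - projOne k) * U).conjTranspose * ((1 - projOne k) * U) := by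
    rw [Matrix.conjTranspose_mul, Matrix.conjTranspose_sub, projOne_conjTranspose,
      Matrix.conjTranspose_one, mul_assoc, ← mul_assoc (1 - projOne k)]
    rw [show (1 - projOne k) * (1 - projOne k) = 1 - projOne k by
      rw [mul_sub, sub_mul, sub_mul, projOne_mul_self]; simp]
    rw [sub_mul, mul_sub, one_mul, hU, ← mul_assoc, pullOne]
  rw [h]
  exact Matrix.posSemidef_conjTranspose_mul_self _

theorem embedOp_pullOne (f : ι ↪ κ) (U : Op ι) (i : ι) :
    embedOp f (pullOne U i) = pullOne (embedOp f U) (f i) := by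
  rw [pullOne, map_mul, map_mul, embedOp_conjTranspose, embedOp_projOne, pullOne]

theorem pullOne_apply (U : Op κ) (k : κ) (s t : κ → Bool) :
    pullOne U k s t = ∑ y, if y k then star (U y s) * U y t else 0 := by
  rw [pullOne, projOne, Matrix.mul_apply]
  simp only [Matrix.mul_diagonal, Matrix.conjTranspose_apply]
  exact Finset.sum_congr rfl fun y _ => by cases y k <;> simp

theorem sum_accept_eq (U : Op κ) (k : κ) (z : κ → Bool) :
    ((∑ y, if y k then ‖U y z‖ ^ 2 else 0 : ℝ) : ℂ) = pullOne U k z z := by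
  rw [pullOne_apply, Complex.ofReal_sum]
  refine Finset.sum_congr rfl fun y _ => ?_
  cases y k
  · simp
  · simp [Complex.conj_mul']

theorem sum_norm_sq_eq_one {U : Op κ} (hU : U.conjTranspose * U = 1) (z : κ → Bool) :
    ∑ y, ‖U y z‖ ^ 2 = 1 := by
  have h := congrFun (congrFun hU z) z
  rw [Matrix.mul_apply, Matrix.one_apply_eq] at h
  have : ((∑ y, ‖U y z‖ ^ 2 : ℝ) : ℂ) = 1 := by
    rw [← h, Complex.ofReal_sum]
    exact Finset.sum_congr rfl fun y _ => by simp [Matrix.conjTranspose_apply, Complex.conj_mul']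
  exact_mod_cast this

/-- The configuration `s`, with zeros on the ancillas. -/
def withZeros (s : α → Bool) : α ⊕ β → Bool := Sum.elim s fun _ => false

/-- The effect of which the expectation value in the state of the qubits `Fin q` is the probability
that the circuit accepts. -/
def acceptEffect {q a : ℕ} (gs : List (Gate (Fin q ⊕ Fin (a + 1)))) : Op (Fin q) :=
  (pullOne (circuitOp gs) (Sum.inr 0)).submatrix withZeros withZeros

theorem acceptEffect_posSemidef {q a : ℕ} (gs : List (Gate (Fin q ⊕ Fin (a + 1)))) :
    (acceptEffect gs).PosSemidef := (pullOne_posSemidef _ _).submatrix _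

theorem one_sub_acceptEffect_posSemidef {q a : ℕ} (gs : List (Gate (Fin q ⊕ Fin (a + 1)))) :
    (1 - acceptEffect gs).PosSemidef := by
  have h := (one_sub_pullOne_posSemidef (circuitOp_conjTranspose_mul_self gs)
    (Sum.inr 0)).submatrix (withZeros (α := Fin q) (β := Fin (a + 1)))
  -- Fixing the ancillas to zero is an isometry: `withZeros` is injective, so the identity
  -- compresses to the identity.
  rw [Matrix.submatrix_sub, Pi.sub_apply, Pi.sub_apply, Matrix.submatrix_one] at h
  · exact h
  · intro s t hst
    ext i
    exact congrFun hst (Sum.inl i)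

theorem trace_kronecker_zeroState_mul (ρ : Op α)
    (Y : Matrix ((α → Bool) × (β → Bool)) ((α → Bool) × (β → Bool)) ℂ) :
    (Matrix.kronecker ρ (zeroState β) * Y).trace =
      (ρ * Y.submatrix (fun s => (s, fun _ => false)) fun s => (s, fun _ => false)).trace := by
  simp only [Matrix.trace, Matrix.diag, Matrix.mul_apply, Matrix.kronecker,
    Matrix.kroneckerMap_apply, zeroState, Fintype.sum_prod_type, Matrix.single_apply,
    Matrix.submatrix_apply]
  refine Finset.sum_congr rfl fun s _ => ?_
  rw [Finset.sum_eq_single (fun _ => false)]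
  · refine Finset.sum_congr rfl fun t _ => ?_
    rw [Finset.sum_eq_single (fun _ => false)]
    · simp
    · intro b _ hb
      simp [Ne.symm hb]
    · simp
  · intro b _ hb
    refine Finset.sum_eq_zero fun t _ => Finset.sum_eq_zero fun c _ => ?_
    simp [Ne.symm hb]
  · simp

theorem trace_submatrix_equiv {m n : Type} [Fintype m] [Fintype n] (e : m ≃ n)
    (A : Matrix n n ℂ) : (A.submatrix e e).trace = A.trace :=
  e.sum_comp fun i => A i i

theorem trace_submatrix_kronecker_zeroState_mul (ρ : Op α) (X : Op (α ⊕ β)) :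
    ((Matrix.kronecker ρ (zeroState β)).submatrix (Equiv.sumArrowEquivProdArrow _ _ _)
      (Equiv.sumArrowEquivProdArrow _ _ _) * X).trace =
      (ρ * X.submatrix withZeros withZeros).trace := by
  set e := Equiv.sumArrowEquivProdArrow α β Bool
  have h : (Matrix.kronecker ρ (zeroState β)).submatrix e e * X =
      (Matrix.kronecker ρ (zeroState β) * X.submatrix e.symm e.symm).submatrix e e := by
    rw [← Matrix.submatrix_mul_equiv _ _ e e e, Matrix.submatrix_submatrix]
    simp
  rw [h, trace_submatrix_equiv, trace_kronecker_zeroState_mul]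
  rfl

theorem submatrix_withZeros_embedOp (f : ι ↪ α) (Y : Op (ι ⊕ β)) :
    (embedOp (f.sumMap (Function.Embedding.refl β)) Y).submatrix withZeros withZeros =
      embedOp f (Y.submatrix withZeros withZeros) := by
  ext s t
  have h : ∀ s : α → Bool, (withZeros s : α ⊕ β → Bool) ∘ f.sumMap (Function.Embedding.refl β) =
      withZeros (s ∘ f) := by
    intro s
    ext (i | i) <;> rfl
  rw [Matrix.submatrix_apply, embedOp_apply, embedOp_apply, h, h, Matrix.submatrix_apply]
  congr 2
  apply propext
  constructor
  · intro h k hk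
    refine h (Sum.inl k) ?_
    rintro ⟨i | i, hi⟩
    · exact hk ⟨i, Sum.inl.inj hi⟩
    · exact Sum.inr_ne_inl hi
  · rintro h (k | k) hk
    · exact h k fun ⟨i, hi⟩ => hk ⟨Sum.inl i, congrArg Sum.inl hi⟩
    · exact absurd ⟨Sum.inr k, rfl⟩ hk

/-- The Heisenberg picture. Cyclicity of the trace moves the circuit onto the final projection,
pulling back commutes with embedding into more qubits, and the zero state of the ancillas turns the
result into a compression. What remains is a single effect on `q` qubits. -/
theorem qubitAccept_eq {p q : ℕ} (ρ : Op (Fin p)) (V : QubitCheck p q) :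
    qubitAccept ρ V = (ρ * embedOp V.1.toEmbedding (acceptEffect V.2.2)).trace.re := by
  obtain ⟨S, a, gs⟩ := V
  simp only [qubitAccept]
  rw [circuitOp_relabel]
  set f := S.toEmbedding.sumMap (Function.Embedding.refl (Fin (a + 1))) with hf
  set U := embedOp f (circuitOp gs) with hU
  change (projOne (Sum.inr (0 : Fin (a + 1))) * (U * _ * U.conjTranspose)).trace.re = _
  rw [Matrix.trace_mul_comm, mul_assoc, mul_assoc, Matrix.trace_mul_comm, mul_assoc, mul_assoc,
    ← mul_assoc U.conjTranspose]
  change (_ * pullOne U (f (Sum.inr 0))).trace.re = _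
  rw [hU, ← embedOp_pullOne, trace_submatrix_kronecker_zeroState_mul, hf,
    submatrix_withZeros_embedOp, acceptEffect]

end Effect

/-! ## Tomography -/

instance : DecidableEq Pauli := fun P Q => by
  cases P <;> cases Q <;> first | exact isTrue rfl | exact isFalse Pauli.noConfusion

instance : Fintype Pauli := ⟨{.I, .X, .Y, .Z}, fun P => by cases P <;> decide⟩

theorem sum_pauli {M : Type} [AddCommMonoid M] (f : Pauli → M) :
    ∑ P, f P = f .I + (f .X + (f .Y + f .Z)) := by
  change ∑ P ∈ {Pauli.I, .X, .Y, .Z}, f P = _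
  rw [Finset.sum_insert (by decide), Finset.sum_insert (by decide), Finset.sum_insert (by decide),
    Finset.sum_singleton]

/-- A circuit that prepares an eigenvector of a Pauli matrix. -/
def localPrep (P : Pauli) (e : Bool) : List (Gate Unit) :=
  (if e then [.hadamard (), .tGate (), .tGate (), .tGate (), .tGate (), .hadamard ()] else []) ++
    match P with
    | .I => []
    | .Z => []
    | .X => [.hadamard ()]
    | .Y => [.hadamard (), .tGate (), .tGate ()]

/-- The eigenvector prepared by `localPrep`. -/
def localVec (P : Pauli) (e s : Bool) : ℂ :=
  match P with
  | .I => if s = e then 1 else 0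
  | .Z => if s = e then 1 else 0
  | .X => hadamardMatrix s e
  | .Y => (if s then Complex.I else 1) * hadamardMatrix s e

/-- The eigenvalue that belongs to the eigenvector prepared by `localPrep`. -/
def localSign (P : Pauli) (e : Bool) : ℤ :=
  match P with
  | .I => 1
  | _ => if e then -1 else 1

theorem circuitOp_unit_cons_hadamard (l : List (Gate Unit)) {A : Matrix Bool Bool ℂ}
    (h : circuitOp l = piOp fun _ => A) :
    circuitOp (Gate.hadamard () :: l) = piOp fun _ => A * hadamardMatrix := by
  rw [circuitOp, h, ← piOp_mul]
  congr 1

theorem circuitOp_unit_cons_tGate (l : List (Gate Unit)) {A : Matrix Bool Bool ℂ}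
    (h : circuitOp l = piOp fun _ => A) :
    circuitOp (Gate.tGate () :: l) = piOp fun _ => A * tMatrix := by
  rw [circuitOp, h, ← piOp_mul]
  congr 1

theorem tMatrix_sq : tMatrix * tMatrix = Matrix.diagonal fun s => if s then Complex.I else 1 := by
  rw [tMatrix, Matrix.diagonal_mul_diagonal]
  congr 1
  ext s
  cases s
  · simp
  · simp only [if_true]
    rw [← Complex.exp_add, show Complex.I * (Real.pi : ℂ) / 4 + Complex.I * Real.pi / 4 =
      Real.pi / 2 * Complex.I by ring, Complex.exp_pi_div_two_mul_I]

theorem tMatrix_pow_four : tMatrix * tMatrix * (tMatrix * tMatrix) = Pauli.Z.matrix := by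
  rw [tMatrix_sq, Matrix.diagonal_mul_diagonal, Pauli.matrix]
  congr 1
  ext s
  cases s <;> simp

theorem hadamard_conj_Z : hadamardMatrix * Pauli.Z.matrix * hadamardMatrix = Pauli.X.matrix := by
  have h := ofReal_sqrt_two_mul_self
  have h0 : ((Real.sqrt 2 : ℝ) : ℂ) ≠ 0 := by
    intro h0; rw [h0] at h; norm_num at h
  ext s t
  cases s <;> cases t <;>
    simp [hadamardMatrix, Matrix.mul_apply, Pauli.matrix] <;> field_simp <;>
    simp [pow_two, h] <;> norm_num

/-- The sequence `H T⁴ H` is `X` and creates the basis state of `e`. A Hadamard gate then rotates it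
to an eigenvector of `X`, and two further `T` gates rotate that one to an eigenvector of `Y`. -/
theorem circuitOp_localPrep (P : Pauli) (e s : Bool) :
    circuitOp (localPrep P e) (fun _ => s) (fun _ => false) = localVec P e s := by
  have h0 : circuitOp ([] : List (Gate Unit)) = piOp fun _ => 1 := piOp_one.symm
  have key : ∀ (l : List (Gate Unit)) (A : Matrix Bool Bool ℂ), circuitOp l = piOp (fun _ => A) →
      circuitOp ((if e then [.hadamard (), .tGate (), .tGate (), .tGate (), .tGate (),
        .hadamard ()] else []) ++ l) (fun _ => s) (fun _ => false) = A s e := by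
    intro l A h
    cases e
    · simp [h, piOp_apply]
    · have := circuitOp_unit_cons_hadamard _ (circuitOp_unit_cons_tGate _
        (circuitOp_unit_cons_tGate _ (circuitOp_unit_cons_tGate _ (circuitOp_unit_cons_tGate _
        (circuitOp_unit_cons_hadamard _ h)))))
      simp only [if_true, List.cons_append, List.nil_append]
      rw [this]
      have e1 : A * hadamardMatrix * tMatrix * tMatrix * tMatrix * tMatrix * hadamardMatrix =
          A * Pauli.X.matrix := by
        rw [← hadamard_conj_Z, ← tMatrix_pow_four]
        simp only [mul_assoc]
      rw [e1]
      simp [piOp_apply, Matrix.mul_apply, Pauli.matrix]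
  cases P
  · refine (key _ _ h0).trans ?_
    simp [localVec, Matrix.one_apply]
  · refine (key _ _ (circuitOp_unit_cons_hadamard _ h0)).trans ?_
    simp [localVec]
  · refine (key _ _ (circuitOp_unit_cons_hadamard _ (circuitOp_unit_cons_tGate _
      (circuitOp_unit_cons_tGate _ h0)))).trans ?_
    rw [one_mul, tMatrix_sq]
    simp [localVec, Matrix.diagonal_mul]
  · refine (key _ _ h0).trans ?_
    simp [localVec, Matrix.one_apply]

/-- The spectral decomposition of a Pauli matrix; for the identity both eigenvalues are `1`. -/
theorem sum_localSign_mul (P : Pauli) (s t : Bool) :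
    ∑ e, (localSign P e : ℂ) * (star (localVec P e s) * localVec P e t) = P.matrix t s := by
  have h := ofReal_sqrt_two_mul_self
  have h0 : ((Real.sqrt 2 : ℝ) : ℂ) ≠ 0 := by
    intro h0; rw [h0] at h; norm_num at h
  rw [Fintype.sum_bool]
  cases P <;> cases s <;> cases t <;>
    simp [localSign, localVec, Pauli.matrix, hadamardMatrix] <;> field_simp <;>
    simp [pow_two, h] <;> ring_nf

/-- The completeness relation: the sum of `P ⊗ P` over the four Pauli matrices is twice the swap. -/
theorem sum_pauli_mul (s t x y : Bool) :
    ∑ P : Pauli, P.matrix t s * P.matrix x y = 2 * ((if x = s then 1 else 0) *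
      if y = t then 1 else 0) := by
  rw [sum_pauli]
  cases s <;> cases t <;> cases x <;> cases y <;> simp [Pauli.matrix] <;> norm_num

variable {q : ℕ}

/-- The qubits of a register, as blocks of one qubit. -/
def unitBlocks (q : ℕ) : Fin q × Unit ≃ Fin q := Equiv.prodPUnit _

/-- A circuit that prepares a product of eigenvectors of Pauli matrices. -/
def prepCircuit (w : Fin q → Pauli) (e : Fin q → Bool) : List (Gate (Fin q)) :=
  (List.finRange q).flatMap fun j => (localPrep (w j) (e j)).map
    (Gate.relabel (blockEmb (unitBlocks q) j))

def prepVec (w : Fin q → Pauli) (e s : Fin q → Bool) : ℂ := ∏ j, localVec (w j) (e j) (s j)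

def prepSign (w : Fin q → Pauli) (e : Fin q → Bool) : ℤ := ∏ j, localSign (w j) (e j)

theorem circuitOp_prepCircuit (w : Fin q → Pauli) (e s : Fin q → Bool) :
    circuitOp (prepCircuit w e) s (fun _ => false) = prepVec w e s := by
  rw [prepCircuit, circuitOp_blocks_apply _ _ _ (List.nodup_finRange q) (List.mem_finRange)]
  exact Finset.prod_congr rfl fun j _ => circuitOp_localPrep (w j) (e j) (s j)

/-- The expectation value of `M` in the state `prepVec w e`. -/
def prepExpect (M : Op (Fin q)) (w : Fin q → Pauli) (e : Fin q → Bool) : ℂ :=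
  ∑ s, ∑ t, star (prepVec w e s) * M s t * prepVec w e t

/-- The tensor product of the one-qubit spectral decompositions. It expresses a Pauli coefficient
through expectation values in product states that simple circuits prepare. -/
theorem sum_prepSign_mul_prepExpect (M : Op (Fin q)) (w : Fin q → Pauli) :
    ∑ e, (prepSign w e : ℂ) * prepExpect M w e = (M * pauliString w).trace := by
  simp only [prepExpect, Finset.mul_sum, Matrix.trace, Matrix.diag, Matrix.mul_apply]
  rw [Finset.sum_comm]
  refine Finset.sum_congr rfl fun s _ => ?_
  rw [Finset.sum_comm]
  refine Finset.sum_congr rfl fun t _ => ?_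
  have h : pauliString w t s = ∑ e : Fin q → Bool, (prepSign w e : ℂ) *
      (star (prepVec w e s) * prepVec w e t) := by
    rw [pauliString, tensorOp_eq_piOp, piOp_apply, Finset.prod_congr rfl fun j _ =>
      (sum_localSign_mul (w j) (s j) (t j)).symm, Finset.prod_univ_sum, Fintype.piFinset_univ]
    refine Finset.sum_congr rfl fun e _ => ?_
    simp [prepSign, prepVec, Finset.prod_mul_distrib]
  rw [h, Finset.mul_sum]
  exact Finset.sum_congr rfl fun e _ => by ring

/-- The `q`-fold tensor power of the completeness relation `sum_pauli_mul`, contracted with the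
entries of `M`. -/
theorem pauli_expansion (M : Op (Fin q)) :
    M = ∑ w, ((1 / 2 ^ q : ℂ) * (M * pauliString w).trace) • pauliString w := by
  have key : ∀ s t x y : Fin q → Bool, ∑ w, pauliString w t s * pauliString w x y =
      2 ^ q * ((if x = s then 1 else 0) * if y = t then 1 else 0) := by
    intro s t x y
    simp only [pauliString, tensorOp_eq_piOp, piOp_apply, ← Finset.prod_mul_distrib]
    have := Finset.prod_univ_sum (fun _ : Fin q => (Finset.univ : Finset Pauli))
      (fun j P => P.matrix (t j) (s j) * P.matrix (x j) (y j))
    rw [Fintype.piFinset_univ] at this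
    rw [← this, Finset.prod_congr rfl fun j _ => sum_pauli_mul (s j) (t j) (x j) (y j),
      Finset.prod_mul_distrib, Finset.prod_mul_distrib, Finset.prod_ite_zero, Finset.prod_ite_zero]
    simp [funext_iff]
  ext x y
  rw [Matrix.sum_apply]
  have h : ∀ w : Fin q → Pauli, (((1 / 2 ^ q : ℂ) * (M * pauliString w).trace) •
      pauliString w) x y = ∑ s, ∑ t, (1 / 2 ^ q : ℂ) * M s t *
        (pauliString w t s * pauliString w x y) := by
    intro w
    simp only [Matrix.smul_apply, Matrix.trace, Matrix.diag, Matrix.mul_apply, smul_eq_mul,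
      Finset.mul_sum, Finset.sum_mul]
    exact Finset.sum_congr rfl fun s _ => Finset.sum_congr rfl fun t _ => by ring
  rw [Finset.sum_congr rfl fun w _ => h w, Finset.sum_comm]
  rw [Finset.sum_congr rfl fun s _ => Finset.sum_comm]
  simp only [← Finset.mul_sum, key]
  simp
  field_simp

end

end QHard

/-! ### Second moments of scalars and high moments of matrices. -/

namespace QHard

open Enc (enc)
open scoped ComplexOrder MatrixOrder

noncomputable section

set_option linter.unusedSectionVars false

/-! ## Independent random variables on finite sets -/

section Independent

variable {B Y : Type} [Fintype B] [DecidableEq B] [Fintype Y]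

theorem sum_prod_mul_prod (μ f : B → Y → ℝ) :
    ∑ y : B → Y, (∏ b, μ b (y b)) * ∏ b, f b (y b) = ∏ b, ∑ z, μ b z * f b z := by
  simp only [← Finset.prod_mul_distrib]
  rw [Finset.prod_univ_sum, Fintype.piFinset_univ]

theorem sum_prod_eq_one {μ : B → Y → ℝ} (hμ : ∀ b, ∑ z, μ b z = 1) :
    ∑ y : B → Y, ∏ b, μ b (y b) = 1 := by
  have := sum_prod_mul_prod μ fun _ _ => 1
  simpa [hμ] using this

/-- The second moment of a sum of independent variables of mean zero, bounded by one. -/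
theorem sum_prod_mul_sq_le {μ : B → Y → ℝ} (hμ0 : ∀ b z, 0 ≤ μ b z) (hμ : ∀ b, ∑ z, μ b z = 1)
    (X : B → Y → ℝ) (A : Finset B) (hX0 : ∀ b ∈ A, ∑ z, μ b z * X b z = 0)
    (hX1 : ∀ b ∈ A, ∀ z, |X b z| ≤ 1) :
    ∑ y : B → Y, (∏ b, μ b (y b)) * (∑ b ∈ A, X b (y b)) ^ 2 ≤ A.card := by
  have cross : ∀ b ∈ A, ∀ b' ∈ A, b ≠ b' →
      ∑ y : B → Y, (∏ b, μ b (y b)) * (X b (y b) * X b' (y b')) = 0 := by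
    intro b hb b' _ hbb'
    -- Written as a product over all coordinates, the cross term has an expectation that factorizes,
    -- and its factor at `b` is a mean, hence zero.
    have h : ∀ y : B → Y, X b (y b) * X b' (y b') =
        ∏ c, (if c = b then X b else if c = b' then X b' else fun _ => 1) (y c) := by
      intro y
      rw [← Finset.mul_prod_erase _ _ (Finset.mem_univ b), if_pos rfl,
        ← Finset.mul_prod_erase _ _ (Finset.mem_erase.2 ⟨hbb'.symm, Finset.mem_univ b'⟩),
        if_neg hbb'.symm, if_pos rfl, Finset.prod_eq_one, mul_one]
      intro c hc
      simp only [Finset.mem_erase] at hc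
      simp [hc.1, hc.2.1]
    simp only [h]
    rw [sum_prod_mul_prod]
    refine Finset.prod_eq_zero (Finset.mem_univ b) ?_
    simpa using hX0 b hb
  have diag : ∀ b ∈ A, ∑ y : B → Y, (∏ b, μ b (y b)) * (X b (y b) * X b (y b)) ≤ 1 := by
    intro b hb
    rw [← sum_prod_eq_one hμ]
    refine Finset.sum_le_sum fun y _ => ?_
    refine mul_le_of_le_one_right (Finset.prod_nonneg fun c _ => hμ0 _ _) ?_
    rw [← pow_two, sq_le_one_iff_abs_le_one]
    exact hX1 b hb _
  calc ∑ y : B → Y, (∏ b, μ b (y b)) * (∑ b ∈ A, X b (y b)) ^ 2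
      = ∑ b ∈ A, ∑ b' ∈ A, ∑ y : B → Y, (∏ b, μ b (y b)) * (X b (y b) * X b' (y b')) := by
        simp only [pow_two, Finset.sum_mul, Finset.mul_sum]
        rw [Finset.sum_comm]
        exact Finset.sum_congr rfl fun b _ => by
          rw [Finset.sum_comm]
          exact Finset.sum_congr rfl fun b' _ => Finset.sum_congr rfl fun y _ => by ring
    _ = ∑ b ∈ A, ∑ y : B → Y, (∏ b, μ b (y b)) * (X b (y b) * X b (y b)) := by
        refine Finset.sum_congr rfl fun b hb => ?_
        exact Finset.sum_eq_single b (fun b' hb' h => cross b hb b' hb' h.symm)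
          fun h => absurd hb h
    _ ≤ ∑ b ∈ A, 1 := Finset.sum_le_sum diag
    _ = A.card := by simp

open Classical in
/-- Chebyshev's inequality for a sum of independent variables of mean zero, bounded by one. -/
theorem chebyshev {μ : B → Y → ℝ} (hμ0 : ∀ b z, 0 ≤ μ b z) (hμ : ∀ b, ∑ z, μ b z = 1)
    (X : B → Y → ℝ) (A : Finset B) (hX0 : ∀ b ∈ A, ∑ z, μ b z * X b z = 0)
    (hX1 : ∀ b ∈ A, ∀ z, |X b z| ≤ 1) {c : ℝ} (hc : 0 < c) :
    (∑ y : B → Y, if c < |∑ b ∈ A, X b (y b)| then ∏ b, μ b (y b) else 0) ≤ A.card / c ^ 2 := by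
  rw [le_div_iff₀ (by positivity), Finset.sum_mul]
  refine le_trans (Finset.sum_le_sum fun y _ => ?_) (sum_prod_mul_sq_le hμ0 hμ X A hX0 hX1)
  have h0 : 0 ≤ ∏ b, μ b (y b) := Finset.prod_nonneg fun c _ => hμ0 _ _
  split_ifs with h
  · refine mul_le_mul_of_nonneg_left ?_ h0
    rw [← sq_abs (∑ b ∈ A, X b (y b))]
    gcongr
  · rw [zero_mul]
    positivity

end Independent

/-! ## Moments of sums of independent matrices -/

section Moments

variable {m : ℕ}

/-- The sum of `F l` over all lists `l` of length `k`. -/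
def wordSum {M : Type} [AddCommMonoid M] (F : List (Fin m) → M) : ℕ → M
  | 0 => F []
  | k + 1 => ∑ i, wordSum (fun l => F (i :: l)) k

theorem wordSum_sum {M β : Type} [AddCommMonoid M] (s : Finset β) (F : β → List (Fin m) → M)
    (k : ℕ) : wordSum (fun l => ∑ b ∈ s, F b l) k = ∑ b ∈ s, wordSum (F b) k := by
  induction k generalizing F with
  | zero => rfl
  | succ k ih =>
    simp only [wordSum]
    rw [Finset.sum_comm]
    exact Finset.sum_congr rfl fun i _ => ih fun b l => F b (i :: l)

theorem wordSum_mul_left {M : Type} [NonUnitalNonAssocSemiring M] (c : M) (F : List (Fin m) → M)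
    (k : ℕ) : wordSum (fun l => c * F l) k = c * wordSum F k := by
  induction k generalizing F with
  | zero => rfl
  | succ k ih => simp only [wordSum, ih, Finset.mul_sum]

theorem sum_pow_eq_wordSum {M : Type} [Semiring M] (x : Fin m → M) (k : ℕ) :
    (∑ i, x i) ^ k = wordSum (fun l => (l.map x).prod) k := by
  induction k with
  | zero => simp [wordSum]
  | succ k ih =>
    rw [pow_succ', ih, Finset.sum_mul, wordSum]
    exact Finset.sum_congr rfl fun i _ => by simp [wordSum_mul_left]

theorem norm_wordSum_le {M : Type} [SeminormedAddCommGroup M] {F : List (Fin m) → M}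
    {G : List (Fin m) → ℝ} (k : ℕ) (h : ∀ l, l.length = k → ‖F l‖ ≤ G l) :
    ‖wordSum F k‖ ≤ wordSum G k := by
  induction k generalizing F G with
  | zero => exact h [] rfl
  | succ k ih =>
    refine (norm_sum_le _ _).trans (Finset.sum_le_sum fun i _ => ih fun l hl => h _ (by simp [hl]))

theorem wordSum_mono {F G : List (Fin m) → ℝ} (k : ℕ) (h : ∀ l, l.length = k → F l ≤ G l) :
    wordSum F k ≤ wordSum G k := by
  induction k generalizing F G with
  | zero => exact h [] rfl
  | succ k ih => exact Finset.sum_le_sum fun i _ => ih fun l hl => h _ (by simp [hl])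

/-- The entries that occur exactly once in a list. -/
def uniques (l : List (Fin m)) : Finset (Fin m) := Finset.univ.filter fun i => l.count i = 1

theorem uniques_cons_of_notMem {i : Fin m} {l : List (Fin m)} (h : i ∉ l) :
    (uniques (i :: l)).card = (uniques l).card + 1 := by
  have h0 := List.count_eq_zero.2 h
  have : uniques (i :: l) = insert i (uniques l) := by
    ext j
    by_cases hj : j = i
    · subst hj; simp [uniques, h0]
    · simp [uniques, hj, Ne.symm hj]
  rw [this, Finset.card_insert_of_notMem (by simp [uniques, h0])]

theorem uniques_le_cons (i : Fin m) (l : List (Fin m)) :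
    (uniques l).card ≤ (uniques (i :: l)).card + 1 := by
  refine le_trans (Finset.card_le_card (t := insert i (uniques (i :: l))) ?_)
    (Finset.card_insert_le _ _)
  intro j hj
  by_cases hji : j = i
  · simp [hji]
  · simp only [uniques, Finset.mem_filter, Finset.mem_univ, true_and, Finset.mem_insert] at hj ⊢
    right
    rwa [List.count_cons_of_ne (Ne.symm hji)]

/-- A word is built letter by letter. A fresh letter, with at most `m` choices, adds one unique
letter and contributes a factor `θ`. A letter already present, with at most `K` choices, destroys at
most one unique letter and contributes at most `1 / θ`. Each position therefore costs at most `m θ +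
K / θ`. -/
theorem wordSum_uniques_le {θ : ℝ} (h0 : 0 < θ) (h1 : θ ≤ 1) (k K : ℕ) (hk : k ≤ K) :
    wordSum (fun l : List (Fin m) => θ ^ (uniques l).card) k ≤ (m * θ + K / θ) ^ k := by
  induction k with
  | zero => simp [wordSum, uniques]
  | succ k ih =>
    have e : wordSum (fun l : List (Fin m) => θ ^ (uniques l).card) (k + 1) =
        wordSum (fun l : List (Fin m) => ∑ i, θ ^ (uniques (i :: l)).card) k := by
      rw [wordSum_sum]; rfl
    rw [e, pow_succ']
    refine le_trans (wordSum_mono (G := fun l => (m * θ + K / θ) * θ ^ (uniques l).card) k ?_) ?_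
    · intro l hl
      rw [← Finset.sum_filter_add_sum_filter_not Finset.univ (· ∉ l), add_mul]
      refine add_le_add ?_ ?_
      · calc ∑ i ∈ Finset.univ.filter (· ∉ l), θ ^ (uniques (i :: l)).card
            = ∑ i ∈ Finset.univ.filter (· ∉ l), θ ^ (uniques l).card * θ :=
              Finset.sum_congr rfl fun i hi => by
                rw [uniques_cons_of_notMem (by simpa using hi), pow_succ]
          _ ≤ ∑ i : Fin m, θ ^ (uniques l).card * θ :=
              Finset.sum_le_sum_of_subset_of_nonneg (Finset.filter_subset _ _)
                fun _ _ _ => by positivity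
          _ = m * θ * θ ^ (uniques l).card := by simp; ring
      · calc ∑ i ∈ Finset.univ.filter (fun i => ¬ i ∉ l), θ ^ (uniques (i :: l)).card
            ≤ ∑ i ∈ Finset.univ.filter (fun i => ¬ i ∉ l), θ ^ (uniques l).card / θ := by
              refine Finset.sum_le_sum fun i _ => ?_
              rw [le_div_iff₀ h0, ← pow_succ]
              exact pow_le_pow_of_le_one h0.le h1 (uniques_le_cons i l)
          _ = (Finset.univ.filter fun i => ¬ i ∉ l).card * (θ ^ (uniques l).card / θ) := by simp
          _ ≤ K * (θ ^ (uniques l).card / θ) := by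
              refine mul_le_mul_of_nonneg_right ?_ (by positivity)
              have : (Finset.univ.filter fun i => ¬ i ∉ l) ⊆ l.toFinset := by
                intro i hi; simpa using hi
              exact_mod_cast ((Finset.card_le_card this).trans l.toFinset_card_le).trans
                (by omega)
          _ = K / θ * θ ^ (uniques l).card := by ring
    · rw [wordSum_mul_left]
      exact mul_le_mul_of_nonneg_left (ih (by omega)) (by positivity)

variable {Ω : Type} [Fintype Ω]

/-- Resampling one coordinate of a uniform tuple gives a uniform tuple. -/
theorem sum_sum_update {M : Type} [AddCommMonoid M] (j : Fin m) (F : (Fin m → Ω) → M) :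
    ∑ r, ∑ ω, F (Function.update r j ω) = Fintype.card Ω • ∑ r, F r := by
  let e := Equiv.funSplitAt j Ω
  have h : ∀ (p : Ω × ({i // i ≠ j} → Ω)) (ω : Ω),
      Function.update (e.symm p) j ω = e.symm (ω, p.2) := by
    intro p ω
    ext i
    by_cases hi : i = j
    · subst hi; simp [e]
    · simp [e, hi]
  rw [← e.symm.sum_comp, ← e.symm.sum_comp F, Fintype.sum_prod_type, Fintype.sum_prod_type]
  simp only [h, Finset.sum_const, Finset.card_univ]
  rw [Finset.sum_comm]

variable {A : Type} [NormedRing A] [NormedAlgebra ℝ A] [NormOneClass A]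

/-- A coordinate that occurs once in the word influences a single factor. It can be averaged in
place, without commuting anything, and yields a factor of norm at most `θ`. All other factors have
norm at most `1`. -/
theorem norm_sum_prod_le [Nonempty Ω] (x : Ω → A) (hx : ∀ ω, ‖x ω‖ ≤ 1) {θ : ℝ}
    (hμ : ‖∑ ω, x ω‖ ≤ Fintype.card Ω * θ) (l : List (Fin m)) :
    ‖∑ r : Fin m → Ω, (l.map fun i => x (r i)).prod‖ ≤
      Fintype.card Ω ^ m * θ ^ (uniques l).card := by
  have hΩ : (0 : ℝ) < Fintype.card Ω := by exact_mod_cast Fintype.card_pos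
  set μ : A := (Fintype.card Ω : ℝ)⁻¹ • ∑ ω, x ω with hμdef
  have hμ' : ‖μ‖ ≤ θ := by
    rw [hμdef, norm_smul, norm_inv, Real.norm_of_nonneg hΩ.le, inv_mul_le_iff₀ hΩ]
    exact hμ
  -- Induction on the set `U` of unique coordinates that are already replaced by the mean.
  have key : ∀ U : Finset (Fin m), U ⊆ uniques l →
      ∑ r : Fin m → Ω, (l.map fun i => x (r i)).prod =
        ∑ r : Fin m → Ω, (l.map fun i => if i ∈ U then μ else x (r i)).prod := by
    intro U
    induction U using Finset.induction_on with
    | empty => intro _; simp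
    | insert j U hj ih =>
      intro hU
      rw [ih fun i hi => hU (Finset.mem_insert_of_mem hi)]
      have hjl : l.count j = 1 := by
        have := hU (Finset.mem_insert_self j U)
        simpa [uniques] using this
      obtain ⟨l₁, l₂, hl⟩ := List.append_of_mem
        (List.count_pos_iff.1 (by omega : 0 < l.count j))
      rw [hl, List.count_append, List.count_cons_self] at hjl
      have hl₁ : j ∉ l₁ := List.count_eq_zero.1 (by omega)
      have hl₂ : j ∉ l₂ := List.count_eq_zero.1 (by omega)
      let P : List (Fin m) → (Fin m → Ω) → A :=
        fun l' r => (l'.map fun i => if i ∈ U then μ else x (r i)).prod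
      have hP : ∀ l' r ω, j ∉ l' → P l' (Function.update r j ω) = P l' r := by
        intro l' r ω hl'
        simp only [P]
        congr 1
        refine List.map_congr_left fun i hi => ?_
        rw [Function.update_of_ne (ne_of_mem_of_not_mem hi hl')]
      have hP' : ∀ l' r, j ∉ l' →
          (l'.map fun i => if i ∈ insert j U then μ else x (r i)).prod = P l' r := by
        intro l' r hl'
        simp only [P]
        congr 1
        refine List.map_congr_left fun i hi => ?_
        simp [ne_of_mem_of_not_mem hi hl']
      have e1 : ∀ r : Fin m → Ω, (l.map fun i => if i ∈ U then μ else x (r i)).prod =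
          P l₁ r * (x (r j) * P l₂ r) := by
        intro r; rw [hl]; simp [P, hj]
      have e2 : ∀ r : Fin m → Ω, (l.map fun i => if i ∈ insert j U then μ else x (r i)).prod =
          P l₁ r * (μ * P l₂ r) := by
        intro r
        rw [hl, List.map_append, List.prod_append, List.map_cons, List.prod_cons, hP' _ _ hl₁,
          hP' _ _ hl₂, if_pos (Finset.mem_insert_self j U)]
      simp only [e1, e2]
      -- Neither `P l₁` nor `P l₂` sees coordinate `j`, so resampling it averages exactly the middle
      -- factor.
      have e3 := sum_sum_update j fun r : Fin m → Ω => P l₁ r * (x (r j) * P l₂ r)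
      simp only [hP _ _ _ hl₁, hP _ _ _ hl₂, Function.update_self] at e3
      have e4 : ∀ r : Fin m → Ω, ∑ ω, P l₁ r * (x ω * P l₂ r) =
          (Fintype.card Ω : ℝ) • (P l₁ r * (μ * P l₂ r)) := by
        intro r
        rw [← Finset.mul_sum, ← Finset.sum_mul, hμdef, smul_mul_assoc, mul_smul_comm, smul_smul,
          mul_inv_cancel₀ hΩ.ne', one_smul]
      simp only [e4] at e3
      rw [← Finset.smul_sum, ← Nat.cast_smul_eq_nsmul ℝ] at e3
      exact (smul_right_injective A hΩ.ne' e3).symm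
  rw [key _ subset_rfl]
  refine (norm_sum_le _ _).trans ?_
  have hle : ∀ r : Fin m → Ω, ‖(l.map fun i => if i ∈ uniques l then μ else x (r i)).prod‖ ≤
      θ ^ (uniques l).card := by
    intro r
    refine (List.norm_prod_le _).trans ?_
    rw [List.map_map, Finset.prod_list_map_count]
    calc ∏ i ∈ l.toFinset, (norm ∘ fun i => if i ∈ uniques l then μ else x (r i)) i ^ l.count i
        ≤ ∏ i ∈ l.toFinset, if i ∈ uniques l then θ else 1 := by
          refine Finset.prod_le_prod (fun i _ => pow_nonneg (norm_nonneg _) _) fun i _ => ?_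
          by_cases h : i ∈ uniques l
          · have h' : l.count i = 1 := by simpa [uniques] using h
            simp only [Function.comp, h, if_true, h', pow_one]
            exact hμ'
          · simp only [Function.comp, h, if_false]
            exact pow_le_one₀ (norm_nonneg _) (hx _)
      _ = θ ^ (uniques l).card := by
          rw [Finset.prod_ite, Finset.prod_const_one, mul_one, Finset.prod_const]
          congr 2
          ext i
          simp only [Finset.mem_filter, List.mem_toFinset, and_iff_right_iff_imp]
          intro hi
          simp only [uniques, Finset.mem_filter] at hi
          exact List.count_pos_iff.1 (by omega)
  refine (Finset.sum_le_sum fun r _ => hle r).trans ?_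
  simp

theorem norm_sum_sum_pow_le [Nonempty Ω] (x : Ω → A) (hx : ∀ ω, ‖x ω‖ ≤ 1) {θ : ℝ} (h0 : 0 < θ)
    (h1 : θ ≤ 1) (hμ : ‖∑ ω, x ω‖ ≤ Fintype.card Ω * θ) (k : ℕ) :
    ‖∑ r : Fin m → Ω, (∑ i, x (r i)) ^ k‖ ≤ Fintype.card Ω ^ m * (m * θ + k / θ) ^ k := by
  simp only [sum_pow_eq_wordSum]
  rw [← wordSum_sum]
  refine (norm_wordSum_le k fun l _ => norm_sum_prod_le x hx hμ l).trans ?_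
  rw [wordSum_mul_left]
  exact mul_le_mul_of_nonneg_left (wordSum_uniques_le h0 h1 k k le_rfl) (by positivity)

end Moments

end

end QHard

/-! ### Energies, expectation values and tail bounds for random sums. -/

namespace QHard

open Enc (enc)
open scoped ComplexOrder MatrixOrder Matrix.Norms.L2Operator

noncomputable section

set_option linter.unusedSectionVars false

/-! ## Expectation values and the lowest energy -/

section Energy

variable {κ : Type} [Fintype κ] [DecidableEq κ]

theorem trace_mul_nonneg {A B : Matrix κ κ ℂ} (hA : 0 ≤ A) (hB : 0 ≤ B) : 0 ≤ (A * B).trace := by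
  obtain ⟨R, rfl⟩ := CStarAlgebra.nonneg_iff_eq_star_mul_self.1 hA
  rw [mul_assoc, Matrix.trace_mul_comm]
  have := (Matrix.nonneg_iff_posSemidef.1 hB).mul_mul_conjTranspose_same R
  exact this.trace_nonneg

/-- The expectation value of `A` in the state `ρ`. -/
def expect (ρ A : Matrix κ κ ℂ) : ℝ := (ρ * A).trace.re

theorem expect_mono {ρ : Matrix κ κ ℂ} (hρ : IsDensity ρ) {A B : Matrix κ κ ℂ} (h : A ≤ B) :
    expect ρ A ≤ expect ρ B := by
  have := trace_mul_nonneg hρ.1.nonneg (sub_nonneg.2 h)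
  rw [mul_sub, Matrix.trace_sub] at this
  have := (Complex.le_def.1 this).1
  simp only [Complex.zero_re, Complex.sub_re] at this
  simp only [expect]
  linarith

theorem expect_algebraMap {ρ : Matrix κ κ ℂ} (hρ : IsDensity ρ) (c : ℝ) :
    expect ρ (algebraMap ℝ _ c) = c := by
  simp [expect, Algebra.algebraMap_eq_smul_one, Matrix.trace_smul, hρ.2]

theorem expect_one {ρ : Matrix κ κ ℂ} (hρ : IsDensity ρ) : expect ρ 1 = 1 := by
  simp [expect, hρ.2]

theorem expect_add (ρ A B : Matrix κ κ ℂ) : expect ρ (A + B) = expect ρ A + expect ρ B := by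
  simp [expect, mul_add]

theorem expect_sub (ρ A B : Matrix κ κ ℂ) : expect ρ (A - B) = expect ρ A - expect ρ B := by
  simp [expect, mul_sub]

theorem expect_smul (ρ A : Matrix κ κ ℂ) (c : ℝ) : expect ρ (c • A) = c * expect ρ A := by
  simp [expect, Matrix.trace_smul]

theorem expect_sum {β : Type} (s : Finset β) (ρ : Matrix κ κ ℂ) (A : β → Matrix κ κ ℂ) :
    expect ρ (∑ b ∈ s, A b) = ∑ b ∈ s, expect ρ (A b) := by
  simp [expect, Finset.mul_sum, Matrix.trace_sum]

/-- Tested on normalized rank-one states. It turns soundness, a statement about all proofs, into an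
operator inequality for the mean effect. -/
theorem le_algebraMap_of_expect_le {A : Matrix κ κ ℂ} (hA : A.IsHermitian) {c : ℝ}
    (h : ∀ ρ : Matrix κ κ ℂ, IsDensity ρ → expect ρ A ≤ c) : A ≤ algebraMap ℝ _ c := by
  rw [Matrix.le_iff, Matrix.posSemidef_iff_dotProduct_mulVec]
  have hH : (algebraMap ℝ (Matrix κ κ ℂ) c - A).IsHermitian :=
    (show IsSelfAdjoint (algebraMap ℝ (Matrix κ κ ℂ) c) from
      (IsSelfAdjoint.all c).algebraMap _).sub hA
  refine ⟨hH, fun x => ?_⟩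
  by_cases hx : x = 0
  · simp [hx]
  set ν : ℝ := ∑ i, ‖x i‖ ^ 2 with hν
  have hdot : star x ⬝ᵥ x = (ν : ℂ) := by
    simp [dotProduct, hν, Complex.conj_mul']
  have hν0 : 0 < ν := by
    obtain ⟨i, hi⟩ : ∃ i, x i ≠ 0 := by
      by_contra hc
      push Not at hc
      exact hx (funext hc)
    exact Finset.sum_pos' (fun i _ => by positivity) ⟨i, Finset.mem_univ i, by positivity⟩
  have htr : ∀ M : Matrix κ κ ℂ, (Matrix.vecMulVec x (star x) * M).trace =
      star x ⬝ᵥ (M.mulVec x) := by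
    intro M
    rw [Matrix.trace_mul_comm, Matrix.mul_vecMulVec, Matrix.trace_vecMulVec, dotProduct_comm]
  have hρ : IsDensity ((ν⁻¹ : ℝ) • Matrix.vecMulVec x (star x)) := by
    refine ⟨(Matrix.posSemidef_vecMulVec_self_star x).smul (inv_nonneg.2 hν0.le), ?_⟩
    rw [Matrix.trace_smul, Matrix.trace_vecMulVec, dotProduct_comm, hdot]
    rw [Complex.real_smul, ← Complex.ofReal_mul, inv_mul_cancel₀ hν0.ne', Complex.ofReal_one]
  have h1 := h _ hρ
  rw [expect, smul_mul_assoc, Matrix.trace_smul, htr, Complex.smul_re, smul_eq_mul,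
    inv_mul_le_iff₀ hν0] at h1
  have him : (star x ⬝ᵥ ((algebraMap ℝ (Matrix κ κ ℂ) c - A).mulVec x)).im = 0 :=
    hH.im_star_dotProduct_mulVec_self x
  rw [Complex.le_def]
  refine ⟨?_, him.symm⟩
  rw [Matrix.sub_mulVec, dotProduct_sub, Algebra.algebraMap_eq_smul_one, Matrix.smul_mulVec,
    Matrix.one_mulVec, dotProduct_smul, hdot]
  simp only [Complex.zero_re, Complex.sub_re, Complex.smul_re, Complex.ofReal_re, smul_eq_mul]
  linarith [mul_comm ν c]

theorem nonneg_le_trace {A : Matrix κ κ ℂ} (hA : 0 ≤ A) : A ≤ algebraMap ℝ _ A.trace.re := by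
  have hp := Matrix.nonneg_iff_posSemidef.1 hA
  rw [le_algebraMap_iff_spectrum_le hA.isSelfAdjoint]
  intro x hx
  rw [hp.isHermitian.spectrum_real_eq_range_eigenvalues] at hx
  obtain ⟨i, rfl⟩ := hx
  rw [hp.isHermitian.trace_eq_sum_eigenvalues]
  simp only [← Complex.ofReal_sum, Complex.coe_algebraMap, Complex.ofReal_re]
  exact Finset.single_le_sum (f := hp.isHermitian.eigenvalues)
    (fun j _ => hp.eigenvalues_nonneg j) (Finset.mem_univ i)

theorem pow_nonneg_matrix {A : Matrix κ κ ℂ} (hA : 0 ≤ A) (k : ℕ) : 0 ≤ A ^ k :=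
  Matrix.nonneg_iff_posSemidef.2 ((Matrix.nonneg_iff_posSemidef.1 hA).pow k)

/-- A nonnegative matrix that is not bounded by `t` has powers of large trace. -/
theorem pow_le_trace_pow {A : Matrix κ κ ℂ} (hA : 0 ≤ A) {t : ℝ} (ht : 0 ≤ t)
    (h : ¬ A ≤ algebraMap ℝ _ t) (k : ℕ) : t ^ k ≤ (A ^ k).trace.re := by
  rw [le_algebraMap_iff_spectrum_le hA.isSelfAdjoint] at h
  push Not at h
  obtain ⟨x, hx, htx⟩ := h
  have h1 := nonneg_le_trace (pow_nonneg_matrix hA k)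
  rw [le_algebraMap_iff_spectrum_le (pow_nonneg_matrix hA k).isSelfAdjoint] at h1
  exact (pow_le_pow_left₀ ht htx.le k).trans (h1 _ (spectrum.pow_mem_pow A k hx))

theorem trace_re_le_card_mul_norm {A : Matrix κ κ ℂ} (hA : 0 ≤ A) :
    A.trace.re ≤ Fintype.card κ * ‖A‖ := by
  have h := IsSelfAdjoint.le_algebraMap_norm_self hA.isSelfAdjoint
  have h1 := (Matrix.nonneg_iff_posSemidef.1 (sub_nonneg.2 h)).trace_nonneg
  rw [Matrix.trace_sub, Algebra.algebraMap_eq_smul_one, Matrix.trace_smul, Matrix.trace_one] at h1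
  have := (Complex.le_def.1 h1).1
  simp at this
  linarith [mul_comm ‖A‖ (Fintype.card κ : ℝ)]

theorem lowestEnergy_le_expect {n : ℕ} {A ρ : Op (Fin n)} (hA : A.IsHermitian)
    (hρ : IsDensity ρ) : lowestEnergy A ≤ expect ρ A := by
  have hfin : (spectrum ℝ A).Finite := Matrix.finite_real_spectrum
  have h : algebraMap ℝ _ (lowestEnergy A) ≤ A := by
    rw [algebraMap_le_iff_le_spectrum hA]
    exact fun x hx => csInf_le hfin.bddBelow hx
  have := expect_mono hρ h
  rwa [expect_algebraMap hρ] at this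

theorem le_lowestEnergy {n : ℕ} {A : Op (Fin n)} (hA : A.IsHermitian) {c : ℝ}
    (h : algebraMap ℝ _ c ≤ A) : c ≤ lowestEnergy A := by
  rw [algebraMap_le_iff_le_spectrum hA] at h
  refine le_csInf ?_ h
  -- The infimum of the empty set would be a default value; the spectrum is nonempty because the
  -- configuration space is.
  rw [hA.spectrum_real_eq_range_eigenvalues]
  exact Set.range_nonempty _

end Energy

/-! ## Sampling -/

section Sampling

variable {κ Ω : Type} [Fintype κ] [DecidableEq κ] [Nonempty κ] [Fintype Ω] [Nonempty Ω] {m : ℕ}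

open Classical in
/-- A tail bound for sums of independent random matrices between `0` and `1`. -/
theorem card_not_le_mul_le (x : Ω → Matrix κ κ ℂ) (hx0 : ∀ ω, 0 ≤ x ω) (hx1 : ∀ ω, x ω ≤ 1)
    {θ : ℝ} (h0 : 0 < θ) (h1 : θ ≤ 1)
    (hμ : ∑ ω, x ω ≤ algebraMap ℝ _ (Fintype.card Ω * θ)) {t : ℝ} (ht : 0 ≤ t) (k : ℕ) :
    (Finset.univ.filter fun r : Fin m → Ω => ¬ ∑ i, x (r i) ≤ algebraMap ℝ _ t).card * t ^ k ≤
      Fintype.card κ * (Fintype.card Ω ^ m * (m * θ + k / θ) ^ k) := by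
  have hn : ∀ ω, ‖x ω‖ ≤ 1 := fun ω =>
    (CStarAlgebra.norm_le_one_iff_of_nonneg (x ω) (hx0 ω)).2 (hx1 ω)
  have hs0 : ∀ r : Fin m → Ω, 0 ≤ ∑ i, x (r i) := fun r => Finset.sum_nonneg fun i _ => hx0 _
  have hμ' : ‖∑ ω, x ω‖ ≤ Fintype.card Ω * θ :=
    (CStarAlgebra.norm_le_iff_le_algebraMap _ (by positivity)
      (Finset.sum_nonneg fun ω _ => hx0 ω)).2 hμ
  -- Markov's inequality for the trace of the `k`-th power: each bad tuple contributes at least `t ^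
  -- k`, and the total is at most the dimension times the norm of the summed powers.
  calc ((Finset.univ.filter fun r : Fin m → Ω => ¬ ∑ i, x (r i) ≤ algebraMap ℝ _ t).card : ℝ) *
        t ^ k
      = ∑ r ∈ Finset.univ.filter fun r : Fin m → Ω => ¬ ∑ i, x (r i) ≤ algebraMap ℝ _ t,
          t ^ k := by simp
    _ ≤ ∑ r ∈ Finset.univ.filter fun r : Fin m → Ω => ¬ ∑ i, x (r i) ≤ algebraMap ℝ _ t,
          ((∑ i, x (r i)) ^ k).trace.re :=
        Finset.sum_le_sum fun r hr => pow_le_trace_pow (hs0 r) ht (by simpa using hr) k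
    _ ≤ ∑ r : Fin m → Ω, ((∑ i, x (r i)) ^ k).trace.re :=
        Finset.sum_le_sum_of_subset_of_nonneg (Finset.filter_subset _ _) fun r _ _ =>
          (Complex.le_def.1 (Matrix.nonneg_iff_posSemidef.1
            (pow_nonneg_matrix (hs0 r) k)).trace_nonneg).1
    _ = (∑ r : Fin m → Ω, (∑ i, x (r i)) ^ k).trace.re := by
        rw [Matrix.trace_sum, Complex.re_sum]
    _ ≤ Fintype.card κ * ‖∑ r : Fin m → Ω, (∑ i, x (r i)) ^ k‖ :=
        trace_re_le_card_mul_norm (Finset.sum_nonneg fun r _ => pow_nonneg_matrix (hs0 r) k)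
    _ ≤ _ := mul_le_mul_of_nonneg_left (norm_sum_sum_pow_le x hn h0 h1 hμ' k) (by positivity)

-- The scalar estimate for a single fixed proof. Chebyshev's inequality gives a failure probability
-- of at most `1 / (m ε²)`, which `hm` makes at most `1/6`.
open Classical in
theorem card_lt_sum_le (X : Ω → ℝ) (hX0 : ∀ ω, 0 ≤ X ω) (hX1 : ∀ ω, X ω ≤ 1) {θ ε : ℝ}
    (hε : 0 < ε) (hμ : Fintype.card Ω * θ ≤ ∑ ω, X ω) (hm : 6 ≤ m * ε ^ 2) :
    ((Finset.univ.filter fun r : Fin m → Ω => ∑ i, X (r i) < m * (θ - ε)).card : ℝ) ≤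
      Fintype.card Ω ^ m / 6 := by
  have hΩ : (0 : ℝ) < Fintype.card Ω := by exact_mod_cast Fintype.card_pos
  have hm0 : (0 : ℝ) < m := by
    rcases Nat.eq_zero_or_pos m with h | h
    · rw [h] at hm; norm_num at hm
    · exact_mod_cast h
  set avg : ℝ := (Fintype.card Ω : ℝ)⁻¹ * ∑ ω, X ω with havg
  have havg1 : θ ≤ avg := by
    rw [havg, le_inv_mul_iff₀ hΩ]; exact hμ
  have hs1 : ∑ ω, X ω ≤ Fintype.card Ω := by
    simpa using Finset.sum_le_sum fun ω (_ : ω ∈ Finset.univ) => hX1 ω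
  have ha1 : avg ≤ 1 := by
    rw [havg, inv_mul_le_iff₀ hΩ, mul_one]; exact hs1
  have ha0 : 0 ≤ avg := mul_nonneg (by positivity) (Finset.sum_nonneg fun ω _ => hX0 ω)
  have key := chebyshev (B := Fin m) (Y := Ω) (μ := fun _ _ => (Fintype.card Ω : ℝ)⁻¹)
    (fun _ _ => by positivity) (fun _ => by simp [hΩ.ne']) (fun _ ω => X ω - avg) Finset.univ
    (fun _ _ => by
      rw [← Finset.mul_sum, Finset.sum_sub_distrib, havg]
      simp [hΩ.ne'])
    (fun _ _ ω => by
      rw [abs_le]; constructor <;> linarith [hX0 ω, hX1 ω]) (c := m * ε) (by positivity)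
  simp only [Finset.prod_const, Finset.card_univ, Fintype.card_fin] at key
  rw [← Finset.sum_filter, Finset.sum_const, nsmul_eq_mul] at key
  have hsub : (Finset.univ.filter fun r : Fin m → Ω => ∑ i, X (r i) < m * (θ - ε)) ⊆
      Finset.univ.filter fun r : Fin m → Ω => m * ε < |∑ i, (X (r i) - avg)| := by
    intro r hr
    simp only [Finset.mem_filter, Finset.mem_univ, true_and] at hr ⊢
    rw [lt_abs]
    right
    rw [Finset.sum_sub_distrib, Finset.sum_const, Finset.card_univ, Fintype.card_fin, nsmul_eq_mul]
    have := mul_le_mul_of_nonneg_left havg1 hm0.le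
    linarith
  have hcard := Finset.card_le_card hsub
  have h1 : (m : ℝ) / (m * ε) ^ 2 ≤ 1 / 6 := by
    rw [div_le_div_iff₀ (by positivity) (by norm_num)]
    nlinarith
  have hpow : (0 : ℝ) < (Fintype.card Ω : ℝ) ^ m := by positivity
  rw [inv_pow, ← div_eq_mul_inv, div_le_iff₀ hpow] at key
  calc _ ≤ _ := (Nat.cast_le (α := ℝ)).2 hcard
    _ ≤ _ := key
    _ ≤ 1 / 6 * Fintype.card Ω ^ m := by gcongr
    _ = _ := by ring

/-- The moment order is `k = K (p + 3)` and the sample size is `C k`. For `C ε ≥ 6` the correction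
`3 k` is at most half of the slack `C k ε`, so the base of the power is at most `ρ` times the
threshold, with `ρ = (1/3 + ε/2) / (1/3 + ε) < 1`. With `K` such that `ρ ^ K ≤ 1/2`, the dimension
`2 ^ p` is beaten and a factor `1/8 ≤ 1/6` is left over. -/
theorem exists_sampling_constants {ε : ℝ} (hε : 0 < ε) : ∃ K C : ℕ, 0 < K ∧ 0 < C ∧
    ∀ p : ℕ, 6 ≤ (C * (K * (p + 3)) : ℕ) * ε ^ 2 ∧
      2 ^ p * ((C * (K * (p + 3)) : ℕ) * (1 / 3 : ℝ) + (K * (p + 3) : ℕ) / (1 / 3 : ℝ)) ^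
        (K * (p + 3)) ≤ ((C * (K * (p + 3)) : ℕ) * (1 / 3 + ε)) ^ (K * (p + 3)) / 6 := by
  obtain ⟨C, hC⟩ := exists_nat_gt (6 / ε + 6 / ε ^ 2)
  have h6 : 0 < 6 / ε := by positivity
  have h62 : 0 < 6 / ε ^ 2 := by positivity
  have hC0 : (0 : ℝ) < C := by linarith
  have hCpos : 0 < C := by exact_mod_cast hC0
  have hC1 : 6 ≤ C * ε := by
    rw [← div_le_iff₀ hε]; linarith
  have hC2 : 6 ≤ C * ε ^ 2 := by
    rw [← div_le_iff₀ (by positivity)]; linarith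
  set ρ : ℝ := (1 / 3 + ε / 2) / (1 / 3 + ε) with hρ
  have hρ0 : 0 ≤ ρ := by positivity
  have hρ1 : ρ < 1 := by
    rw [hρ, div_lt_one (by positivity)]; linarith
  obtain ⟨K₀, hK₀⟩ := exists_pow_lt_of_lt_one (show (0 : ℝ) < 1 / 2 by norm_num) hρ1
  have hK : ρ ^ (K₀ + 1) ≤ 1 / 2 := by
    refine le_trans ?_ hK₀.le
    exact pow_le_pow_of_le_one hρ0 hρ1.le (Nat.le_succ _)
  refine ⟨K₀ + 1, C, Nat.succ_pos _, hCpos, fun p => ⟨?_, ?_⟩⟩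
  · refine hC2.trans ?_
    have h1 : 1 ≤ (K₀ + 1) * (p + 3) := Nat.mul_pos (Nat.succ_pos _) (by omega)
    have h2 : C ≤ C * ((K₀ + 1) * (p + 3)) := Nat.le_mul_of_pos_right _ h1
    have h3 : (C : ℝ) ≤ (C * ((K₀ + 1) * (p + 3)) : ℕ) := by exact_mod_cast h2
    gcongr
  · set k := (K₀ + 1) * (p + 3) with hk
    push_cast
    have e1 : (C * k * (1 / 3) + k / (1 / 3) : ℝ) ≤ ρ * (C * k * (1 / 3 + ε)) := by
      have : ρ * (C * k * (1 / 3 + ε)) = C * k * (1 / 3 + ε / 2) := by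
        rw [hρ]; field_simp
      rw [this]
      have hk0 : (0 : ℝ) ≤ k := by positivity
      nlinarith [mul_le_mul_of_nonneg_right hC1 hk0]
    have e2 : ρ ^ k ≤ (1 / 2) ^ (p + 3) := by
      rw [hk, pow_mul]
      exact pow_le_pow_left₀ (by positivity) hK _
    calc (2 : ℝ) ^ p * (C * k * (1 / 3) + k / (1 / 3)) ^ k
        ≤ 2 ^ p * (ρ * (C * k * (1 / 3 + ε))) ^ k := by gcongr
      _ = 2 ^ p * ρ ^ k * (C * k * (1 / 3 + ε)) ^ k := by rw [mul_pow]; ring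
      _ ≤ 2 ^ p * (1 / 2) ^ (p + 3) * (C * k * (1 / 3 + ε)) ^ k := by gcongr
      _ = (C * k * (1 / 3 + ε)) ^ k / 8 := by
          rw [pow_add, ← mul_assoc, ← mul_pow]; norm_num; ring
      _ ≤ (C * k * (1 / 3 + ε)) ^ k / 6 := by
          have : (0 : ℝ) ≤ (C * k * (1 / 3 + ε)) ^ k := by positivity
          linarith

end Sampling

end

end QHard

/-! ### The measurement circuit and its statistics. -/

namespace QHard

open Enc (enc)
open scoped ComplexOrder MatrixOrder

noncomputable section

set_option linter.unusedSectionVars false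

/-! ## The circuit of the reduction -/

section Blocks

variable {q : ℕ}

/-- The tomographic probes: a Pauli string and a choice of one of its eigenvectors. -/
abbrev Probe (q : ℕ) := (Fin q → Pauli) × (Fin q → Bool)

/-- The number of probes. -/
def numProbes (q : ℕ) : ℕ := Fintype.card (Probe q)

theorem numProbes_eq (q : ℕ) : numProbes q = 8 ^ q := by
  have h : Fintype.card Pauli = 4 := rfl
  rw [numProbes, Fintype.card_prod, Fintype.card_fun, Fintype.card_fun, h, Fintype.card_bool,
    Fintype.card_fin, ← mul_pow]
  norm_num

/-- The probe with number `c`. -/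
def probe (c : Fin (numProbes q)) : Probe q := (Fintype.equivFin (Probe q)).symm c

/-- The number of qubits of a block: `q` qubits for the proof and `A + 1` ancillas. -/
abbrev blockSize (q A : ℕ) : ℕ := q + (A + 1)

/-- The position in a block of the qubits of a check. -/
def checkEmb {a A : ℕ} (h : a ≤ A) : Fin q ⊕ Fin (a + 1) ↪ Fin (blockSize q A) :=
  ((Function.Embedding.refl (Fin q)).sumMap
    (Fin.castLEEmb (Nat.succ_le_succ h))).trans finSumFinEquiv.toEmbedding

theorem checkEmb_inl {a A : ℕ} (h : a ≤ A) (j : Fin q) : (checkEmb h (Sum.inl j) : ℕ) = j := rfl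

theorem checkEmb_inr {a A : ℕ} (h : a ≤ A) (z : Fin (a + 1)) :
    (checkEmb h (Sum.inr z : Fin q ⊕ Fin (a + 1)) : ℕ) = q + z := rfl

/-- The position in a block of the qubit that is measured by the check. -/
def acceptPos (q A : ℕ) : Fin (blockSize q A) := Fin.natAdd q 0

theorem checkEmb_accept {a A : ℕ} (h : a ≤ A) :
    checkEmb h (Sum.inr 0 : Fin q ⊕ Fin (a + 1)) = acceptPos q A := rfl

/-- First the state of the probe is prepared, then the check is run. -/
def probeCircuit {a : ℕ} (gs : List (Gate (Fin q ⊕ Fin (a + 1)))) (c : Probe q) :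
    List (Gate (Fin q ⊕ Fin (a + 1))) :=
  (prepCircuit c.1 c.2).map (Gate.relabel Function.Embedding.inl) ++ gs

theorem sum_sum_elim {α β M : Type} [Fintype α] [DecidableEq α] [Fintype β] [DecidableEq β]
    [AddCommMonoid M] (f : (α ⊕ β → Bool) → M) : ∑ x, f x = ∑ s, ∑ t, f (Sum.elim s t) := by
  rw [← (Equiv.sumArrowEquivProdArrow α β Bool).symm.sum_comp, Fintype.sum_prod_type]
  rfl

theorem embedOp_inl_apply_zero {ι β : Type} [Fintype ι] [DecidableEq ι] [Fintype β]
    [DecidableEq β] (G : Op ι) (s : ι → Bool) (t : β → Bool) :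
    embedOp (Function.Embedding.inl : ι ↪ ι ⊕ β) G (Sum.elim s t) (fun _ => false) =
      if t = fun _ => false then G s (fun _ => false) else 0 := by
  rw [embedOp_apply]
  have h : (∀ k ∉ Set.range (Function.Embedding.inl : ι ↪ ι ⊕ β),
      (Sum.elim s t : ι ⊕ β → Bool) k = false) ↔ t = fun _ => false := by
    constructor
    · intro h
      ext i
      exact h (Sum.inr i) (by rintro ⟨j, hj⟩; cases hj)
    · rintro rfl (k | k) hk
      · exact absurd ⟨k, rfl⟩ hk
      · rfl
  by_cases ht : t = fun _ => false
  · rw [if_pos (h.2 ht), if_pos ht, mul_one]; rfl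
  · rw [if_neg (fun h' => ht (h.1 h')), if_neg ht, mul_zero]

/-- The preparation `G` touches only the left qubits, so the ancillas are still zero when `V`
starts. Acceptance is therefore an expectation value of the compressed effect in the prepared state.
-/
theorem pullOne_mul_embedOp_inl {ι β : Type} [Fintype ι] [DecidableEq ι] [Fintype β]
    [DecidableEq β] (V : Op (ι ⊕ β)) (G : Op ι) (k : ι ⊕ β) :
    pullOne (V * embedOp Function.Embedding.inl G) k (fun _ => false) (fun _ => false) =
      ∑ s, ∑ t, star (G s fun _ => false) * pullOne V k (withZeros s) (withZeros t) *
        G t fun _ => false := by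
  set E := embedOp (Function.Embedding.inl : ι ↪ ι ⊕ β) G with hE
  have h : pullOne (V * E) k = E.conjTranspose * (pullOne V k * E) := by
    simp only [pullOne, Matrix.conjTranspose_mul, mul_assoc]
  rw [h, Matrix.mul_apply, sum_sum_elim]
  refine Finset.sum_congr rfl fun s _ => ?_
  simp only [Matrix.mul_apply, sum_sum_elim, Matrix.conjTranspose_apply]
  simp only [hE, embedOp_inl_apply_zero, apply_ite star, star_zero, ite_mul, zero_mul, mul_ite,
    mul_zero, Finset.sum_ite_eq', Finset.mem_univ, if_true, Finset.mul_sum]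
  rw [Finset.sum_comm]
  simp only [Finset.sum_ite_eq', Finset.mem_univ, if_true, mul_assoc]
  rfl

theorem pullOne_probeCircuit {a : ℕ} (gs : List (Gate (Fin q ⊕ Fin (a + 1)))) (c : Probe q) :
    pullOne (circuitOp (probeCircuit gs c)) (Sum.inr 0) (fun _ => false) (fun _ => false) =
      prepExpect (acceptEffect gs) c.1 c.2 := by
  rw [probeCircuit, circuitOp_append, circuitOp_relabel, pullOne_mul_embedOp_inl, prepExpect]
  simp only [circuitOp_prepCircuit]
  rfl

/-- The circuit of one block. -/
def blockCircuit {a A : ℕ} (h : a ≤ A) (gs : List (Gate (Fin q ⊕ Fin (a + 1)))) (c : Probe q) :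
    List (Gate (Fin (blockSize q A))) := (probeCircuit gs c).map (Gate.relabel (checkEmb h))

/-- Blocks are padded to a common number of ancillas so that positions in the register are
computable. The extra qubits remain zero and do not affect the probability. -/
theorem sum_accept_blockCircuit {a A : ℕ} (h : a ≤ A) (gs : List (Gate (Fin q ⊕ Fin (a + 1))))
    (c : Probe q) :
    ((∑ y, if y (acceptPos q A) then
      ‖circuitOp (blockCircuit h gs c) y (fun _ => false)‖ ^ 2 else 0 : ℝ) : ℂ) =
      prepExpect (acceptEffect gs) c.1 c.2 := by
  rw [sum_accept_eq, blockCircuit, circuitOp_relabel, ← checkEmb_accept h, ← embedOp_pullOne,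
    embedOp_apply, if_pos (fun _ _ => rfl), mul_one]
  exact pullOne_probeCircuit gs c

variable {m N Q L : ℕ}

/-- The positions of the qubits of the blocks in the whole register. -/
def registerEquiv (m N Q L : ℕ) : ((Fin m × Fin N) × Fin Q) × Fin L ≃ Fin (m * N * Q * L) :=
  ((((finProdFinEquiv.prodCongr (Equiv.refl _)).trans finProdFinEquiv).prodCongr
    (Equiv.refl _))).trans finProdFinEquiv

theorem registerEquiv_val (i : Fin m) (n : Fin N) (c : Fin Q) (l : Fin L) :
    (registerEquiv m N Q L (((i, n), c), l) : ℕ) = ((i * N + n) * Q + c) * L + l := by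
  simp [registerEquiv, finProdFinEquiv]
  ring

/-- The list of all blocks. -/
def blockList (m N Q : ℕ) : List ((Fin m × Fin N) × Fin Q) :=
  (List.finRange m).flatMap fun i => (List.finRange N).flatMap fun n =>
    (List.finRange Q).map fun c => ((i, n), c)

theorem mem_blockList (b : (Fin m × Fin N) × Fin Q) : b ∈ blockList m N Q := by
  obtain ⟨⟨i, n⟩, c⟩ := b
  simp [blockList, List.mem_finRange]

theorem nodup_blockList (m N Q : ℕ) : (blockList m N Q).Nodup := by
  rw [blockList, List.nodup_flatMap]
  constructor
  · intro i _
    rw [List.nodup_flatMap]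
    constructor
    · intro n _
      exact (List.nodup_finRange Q).map fun c c' h => by simpa using h
    · refine (List.nodup_finRange N).imp fun {n n'} h => ?_
      simp only [Function.onFun, List.Disjoint, List.mem_map]
      rintro b ⟨c, _, rfl⟩ ⟨c', _, h'⟩
      simp at h'
      exact h h'.1.symm
  · refine (List.nodup_finRange m).imp fun {n n'} h => ?_
    simp only [Function.onFun, List.Disjoint, List.mem_map, List.mem_flatMap]
    rintro b ⟨_, _, c, _, rfl⟩ ⟨_, _, c', _, h'⟩
    simp at h'
    exact h h'.1.1.symm

/-- The circuit of all blocks together. -/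
def registerCircuit (gs : (Fin m × Fin N) × Fin Q → List (Gate (Fin L))) :
    List (Gate (Fin (m * N * Q * L))) :=
  (blockList m N Q).flatMap fun b => (gs b).map
    (Gate.relabel (blockEmb (registerEquiv m N Q L) b))

/-- The Born distribution of the register is the product of those of its blocks, as Chebyshev's
inequality requires. -/
theorem norm_sq_registerCircuit (gs : (Fin m × Fin N) × Fin Q → List (Gate (Fin L)))
    (y : Fin (m * N * Q * L) → Bool) :
    ‖circuitOp (registerCircuit gs) y (fun _ => false)‖ ^ 2 =
      ∏ b, ‖circuitOp (gs b) (blockEquiv (registerEquiv m N Q L) y b) (fun _ => false)‖ ^ 2 := by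
  rw [registerCircuit, circuitOp_blocks_apply _ _ _ (nodup_blockList m N Q) mem_blockList,
    norm_prod, Finset.prod_pow]
  rfl

open Classical in
/-- With high probability, all acceptance frequencies are close to their expectation values. -/
theorem sum_bad_registerCircuit_le (gs : (Fin m × Fin N) × Fin Q → List (Gate (Fin L)))
    (k : Fin L) (f : Fin m → Fin Q → ℝ)
    (hf : ∀ i n c, (∑ y, if y k then ‖circuitOp (gs ((i, n), c)) y (fun _ => false)‖ ^ 2 else 0) =
      f i c) {η : ℝ} (hη : 0 < η) (hN : 6 * (m * Q) ≤ N * η ^ 2) (hN0 : 0 < N) :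
    (∑ y, if ∃ i c, N * η < |∑ n, ((if y (registerEquiv m N Q L (((i, n), c), k)) then (1 : ℝ)
      else 0) - f i c)| then ‖circuitOp (registerCircuit gs) y (fun _ => false)‖ ^ 2 else 0) ≤
      1 / 6 := by
  have hN' : (0 : ℝ) < N := by exact_mod_cast hN0
  set μ : (Fin m × Fin N) × Fin Q → (Fin L → Bool) → ℝ :=
    fun b z => ‖circuitOp (gs b) z (fun _ => false)‖ ^ 2 with hμdef
  have hμ0 : ∀ b z, 0 ≤ μ b z := fun b z => by positivity
  have hμ : ∀ b, ∑ z, μ b z = 1 := fun b =>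
    sum_norm_sq_eq_one (circuitOp_conjTranspose_mul_self (gs b)) _
  set X : (Fin m × Fin N) × Fin Q → (Fin L → Bool) → ℝ :=
    fun b z => (if z k then (1 : ℝ) else 0) - f b.1.1 b.2 with hX
  have hf' : ∀ b, ∑ z, μ b z * (if z k then (1 : ℝ) else 0) = f b.1.1 b.2 := by
    rintro ⟨⟨i, n⟩, c⟩
    rw [← hf i n c]
    exact Finset.sum_congr rfl fun z _ => by by_cases h : z k <;> simp [h, hμdef]
  have hX0 : ∀ b, ∑ z, μ b z * X b z = 0 := by
    intro b
    simp only [hX, mul_sub, Finset.sum_sub_distrib, hf', ← Finset.sum_mul, hμ, one_mul, sub_self]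
  have hf01 : ∀ b : (Fin m × Fin N) × Fin Q, 0 ≤ f b.1.1 b.2 ∧ f b.1.1 b.2 ≤ 1 := by
    intro b
    rw [← hf' b]
    constructor
    · exact Finset.sum_nonneg fun z _ => mul_nonneg (hμ0 _ _) (by split_ifs <;> norm_num)
    · refine le_trans (Finset.sum_le_sum fun z _ => mul_le_of_le_one_right (hμ0 _ _) ?_) (hμ b).le
      split_ifs <;> norm_num
  have hX1 : ∀ b z, |X b z| ≤ 1 := by
    intro b z
    obtain ⟨h0, h1⟩ := hf01 b
    rw [abs_le]
    simp only [hX]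
    split_ifs <;> constructor <;> linarith
  -- The `N` repetitions of probe `c` in round `i`.
  let S : Fin m → Fin Q → Finset ((Fin m × Fin N) × Fin Q) := fun i c =>
    Finset.univ.map ⟨fun n : Fin N => ((i, n), c), fun n n' h => by simpa using h⟩
  have hS : ∀ i c (z : (Fin m × Fin N) × Fin Q → Fin L → Bool),
      ∑ b ∈ S i c, X b (z b) = ∑ n, X ((i, n), c) (z ((i, n), c)) := by
    intro i c z
    simp only [S, Finset.sum_map]
    rfl
  have hcheb : ∀ i c, (∑ z : (Fin m × Fin N) × Fin Q → Fin L → Bool,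
      if N * η < |∑ n, X ((i, n), c) (z ((i, n), c))| then ∏ b, μ b (z b) else 0) ≤
      1 / (N * η ^ 2) := by
    intro i c
    have := chebyshev hμ0 hμ X (S i c) (fun b _ => hX0 b) (fun b _ z => hX1 b z)
      (c := N * η) (by positivity)
    simp only [hS] at this
    refine this.trans (le_of_eq ?_)
    simp only [S, Finset.card_map, Finset.card_univ, Fintype.card_fin]
    field_simp
  rw [← (blockEquiv (registerEquiv m N Q L)).symm.sum_comp]
  simp only [norm_sq_registerCircuit, Equiv.apply_symm_apply]
  -- Union bound over the `m Q` frequencies, each of which fails with probability at most `1 / (N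
  -- η²)`.
  calc _ ≤ ∑ z : (Fin m × Fin N) × Fin Q → Fin L → Bool, ∑ i : Fin m, ∑ c : Fin Q,
        (if N * η < |∑ n, X ((i, n), c) (z ((i, n), c))| then ∏ b, μ b (z b) else 0) := by
        refine Finset.sum_le_sum fun z _ => ?_
        have hz : ∀ i n c, (blockEquiv (registerEquiv m N Q L)).symm z
            (registerEquiv m N Q L (((i, n), c), k)) = z ((i, n), c) k := by
          intro i n c
          have := congrFun (congrFun ((blockEquiv (registerEquiv m N Q L)).apply_symm_apply z)
            ((i, n), c)) k
          exact this
        simp only [hz]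
        have h0 : ∀ i c, 0 ≤ (if N * η < |∑ n, X ((i, n), c) (z ((i, n), c))| then
            ∏ b, μ b (z b) else 0) := by
          intro i c
          split_ifs
          · exact Finset.prod_nonneg fun b _ => hμ0 _ _
          · exact le_rfl
        split_ifs with h
        · obtain ⟨i, c, h⟩ := h
          refine le_trans ?_ (Finset.single_le_sum (f := fun i => ∑ c : Fin Q,
            (if N * η < |∑ n, X ((i, n), c) (z ((i, n), c))| then ∏ b, μ b (z b) else 0))
            (fun i _ => Finset.sum_nonneg fun c _ => h0 i c) (Finset.mem_univ i))
          refine le_trans ?_ (Finset.single_le_sum (f := fun c : Fin Q =>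
            (if N * η < |∑ n, X ((i, n), c) (z ((i, n), c))| then ∏ b, μ b (z b) else 0))
            (fun c _ => h0 i c) (Finset.mem_univ c))
          rw [if_pos h]
        · exact Finset.sum_nonneg fun i _ => Finset.sum_nonneg fun c _ => h0 i c
    _ = ∑ i : Fin m, ∑ c : Fin Q, ∑ z : (Fin m × Fin N) × Fin Q → Fin L → Bool,
        (if N * η < |∑ n, X ((i, n), c) (z ((i, n), c))| then ∏ b, μ b (z b) else 0) := by
        rw [Finset.sum_comm]
        exact Finset.sum_congr rfl fun i _ => Finset.sum_comm
    _ ≤ ∑ i : Fin m, ∑ c : Fin Q, 1 / (N * η ^ 2) :=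
        Finset.sum_le_sum fun i _ => Finset.sum_le_sum fun c _ => hcheb i c
    _ = (m * Q) / (N * η ^ 2) := by
        simp; ring
    _ ≤ 1 / 6 := by
        rw [div_le_div_iff₀ (by positivity) (by norm_num)]
        linarith

end Blocks

end

end QHard

/-! ### The estimated terms, their bounds and the resulting energies. -/

namespace QHard

open Enc (enc)
open scoped ComplexOrder MatrixOrder
open scoped Matrix.Norms.L2Operator

noncomputable section

set_option linter.unusedSectionVars false

/-! ## The Hamiltonian of the reduction -/

section Term

variable {q n N : ℕ} {B : Type}

/-- The Hamiltonian term that is estimated from the outcomes `acc` of the probes. -/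
def estimateTerm (one : B) (el : (Fin q → Pauli) → B) (σ : (Fin q → Pauli) → ℤ) (K : ℕ)
    (acc : Fin N → Fin (numProbes q) → Bool) : List (Coeff × B) :=
  -- A pair `(z, d)` stands for `z / (d + 1)`. The identity thus has coefficient `(K + 1) / (K +
  -- 2)`, and the `- 1` in the other denominators compensates the successor, giving `(K + 2) N 2 ^
  -- q`.
  (((K + 1 : ℕ), K + 1), one) :: (List.finRange N).flatMap fun i =>
    (List.finRange (numProbes q)).map fun c =>
      ((if acc i c then -(K * (prepSign (probe c).1 (probe c).2 * σ (probe c).1)) else 0,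
        (K + 2) * N * 2 ^ q - 1), el (probe c).1)

theorem sum_map_finRange {M : Type} [AddCommMonoid M] {k : ℕ} (f : Fin k → M) :
    ((List.finRange k).map f).sum = ∑ i, f i := by
  rw [← List.ofFn_eq_map, List.sum_ofFn]

theorem termOp_cons (basis : B → Op (Fin n)) (u : Coeff × B) (T : List (Coeff × B)) :
    termOp basis (u :: T) = (Coeff.value u.1 : ℂ) • basis u.2 + termOp basis T := by
  simp [termOp]

theorem termOp_flatMap_finRange (basis : B → Op (Fin n)) {k : ℕ} (f : Fin k → List (Coeff × B)) :
    termOp basis ((List.finRange k).flatMap f) = ∑ i, termOp basis (f i) := by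
  rw [← sum_map_finRange]
  induction List.finRange k with
  | nil => simp [termOp]
  | cons i l ih =>
    rw [List.flatMap_cons, List.map_cons, List.sum_cons, ← ih]
    simp [termOp]

theorem termOp_map_finRange (basis : B → Op (Fin n)) {k : ℕ} (f : Fin k → Coeff × B) :
    termOp basis ((List.finRange k).map f) =
      ∑ i, (Coeff.value (f i).1 : ℂ) • basis (f i).2 := by
  rw [termOp, List.map_map, ← sum_map_finRange]
  rfl

variable {κ : Type} [Fintype κ] [DecidableEq κ]

theorem smul_nonneg_matrix {A : Matrix κ κ ℂ} (hA : 0 ≤ A) {c : ℝ} (hc : 0 ≤ c) : 0 ≤ c • A :=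
  Matrix.nonneg_iff_posSemidef.2 ((Matrix.nonneg_iff_posSemidef.1 hA).smul hc)

theorem smul_le_smul_matrix {A A' : Matrix κ κ ℂ} (h : A ≤ A') {c : ℝ} (hc : 0 ≤ c) :
    c • A ≤ c • A' := by
  have := smul_nonneg_matrix (sub_nonneg.2 h) hc
  rwa [smul_sub, sub_nonneg] at this

theorem smul_one_le_smul_one {c d : ℝ} (h : c ≤ d) :
    c • (1 : Matrix κ κ ℂ) ≤ d • 1 := by
  have := smul_nonneg_matrix (κ := κ) (zero_le_one' _) (sub_nonneg.2 h)
  rwa [sub_smul, sub_nonneg] at this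

theorem smul_le_of_abs_le {G : Matrix κ κ ℂ} (h1 : -1 ≤ G) (h2 : G ≤ 1) {x η : ℝ}
    (hx : |x| ≤ η) : x • G ≤ η • 1 := by
  refine le_trans ?_ (smul_one_le_smul_one hx)
  rcases le_total 0 x with h | h
  · rw [abs_of_nonneg h]; exact smul_le_smul_matrix h2 h
  · rw [abs_of_nonpos h]
    have := smul_le_smul_matrix (neg_le.1 h1) (neg_nonneg.2 h)
    simpa using this

theorem sum_smul_le_of_abs_le {β : Type} [Fintype β] (G : β → Matrix κ κ ℂ) (h1 : ∀ b, -1 ≤ G b)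
    (h2 : ∀ b, G b ≤ 1) (x : β → ℝ) {η : ℝ} (hx : ∀ b, |x b| ≤ η) :
    ∑ b, x b • G b ≤ (Fintype.card β * η) • 1 := by
  refine (Finset.sum_le_sum fun b _ => smul_le_of_abs_le (h1 b) (h2 b) (hx b)).trans (le_of_eq ?_)
  rw [Finset.sum_const, Finset.card_univ, mul_smul, Nat.cast_smul_eq_nsmul]

variable (basis : B → Op (Fin n)) (one : B) (el : (Fin q → Pauli) → B)
  (σ : (Fin q → Pauli) → ℤ) (K : ℕ)

theorem termOp_estimateTerm (hone : basis one = 1) (hN : 0 < N)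
    (acc : Fin N → Fin (numProbes q) → Bool) :
    termOp basis (estimateTerm one el σ K acc) = ((K + 1 : ℝ) / (K + 2)) • 1 -
      (K / ((K + 2) * 2 ^ q) : ℝ) • ∑ c, ((prepSign (probe c).1 (probe c).2 : ℝ) *
        ((∑ i, if acc i c then (1 : ℝ) else 0) / N)) •
          ((σ (probe c).1 : ℝ) • basis (el (probe c).1)) := by
  have hN' : (N : ℝ) ≠ 0 := by positivity
  rw [estimateTerm, termOp_cons, termOp_flatMap_finRange]
  simp only [termOp_map_finRange]
  rw [Finset.sum_comm, sub_eq_add_neg, Finset.smul_sum, ← Finset.sum_neg_distrib]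
  congr 1
  · rw [hone, Complex.coe_smul]
    congr 1
    simp only [Coeff.value]
    push_cast
    ring
  · refine Finset.sum_congr rfl fun c _ => ?_
    rw [smul_smul, smul_smul, ← neg_smul, ← Finset.sum_smul, ← Complex.ofReal_sum,
      Complex.coe_smul]
    congr 1
    have hD : (((K + 2) * N * 2 ^ q - 1 : ℕ) : ℝ) + 1 = (K + 2) * N * 2 ^ q := by
      have : 1 ≤ (K + 2) * N * 2 ^ q := Nat.one_le_iff_ne_zero.2 (by positivity)
      rw [Nat.cast_sub this]
      push_cast
      ring
    have : ∀ i, Coeff.value (if acc i c then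
        -(K * (prepSign (probe c).1 (probe c).2 * σ (probe c).1)) else 0,
        (K + 2) * N * 2 ^ q - 1) = (if acc i c then (1 : ℝ) else 0) *
        (-(K * (prepSign (probe c).1 (probe c).2 * σ (probe c).1)) / ((K + 2) * N * 2 ^ q)) := by
      intro i
      rw [Coeff.value, hD]
      split_ifs <;> simp
    simp only [this]
    rw [← Finset.sum_mul]
    field_simp

/-- If the frequencies are good estimates, the estimated term is close to `1 - B`, up to a
factor `K / (K + 2)`. -/
theorem estimateTerm_bounds (hone : basis one = 1) (hN : 0 < N) (hK : 0 < K)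
    (hG1 : ∀ w, -1 ≤ (σ w : ℝ) • basis (el w)) (hG2 : ∀ w, (σ w : ℝ) • basis (el w) ≤ 1)
    (M : Op (Fin q)) (A : Op (Fin n))
    (hA : A = ∑ w, ((1 / 2 ^ q : ℂ) * (M * pauliString w).trace) • ((σ w : ℝ) • basis (el w)))
    (acc : Fin N → Fin (numProbes q) → Bool) (f : Fin (numProbes q) → ℝ)
    (hf : ∀ c, (f c : ℂ) = prepExpect M (probe c).1 (probe c).2)
    (hacc : ∀ c, |∑ i, ((if acc i c then (1 : ℝ) else 0) - f c)| ≤ N * (1 / (K * 4 ^ q))) :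
    (K / (K + 2) : ℝ) • (1 - A) ≤ termOp basis (estimateTerm one el σ K acc) ∧
      termOp basis (estimateTerm one el σ K acc) ≤
        (K / (K + 2) : ℝ) • (1 - A) + (2 / (K + 2) : ℝ) • 1 := by
  have hN' : (0 : ℝ) < N := by positivity
  have hK' : (0 : ℝ) < K := by positivity
  set G : (Fin q → Pauli) → Op (Fin n) := fun w => (σ w : ℝ) • basis (el w) with hG
  set s : Fin (numProbes q) → ℝ := fun c => prepSign (probe c).1 (probe c).2 with hs
  have hA' : A = (1 / 2 ^ q : ℝ) • ∑ c, (s c * f c) • G (probe c).1 := by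
    rw [hA, Finset.smul_sum]
    rw [show (∑ c, (1 / 2 ^ q : ℝ) • (s c * f c) • G (probe c).1) = ∑ c : Probe q,
      (((1 / 2 ^ q : ℂ) * ((prepSign c.1 c.2 : ℂ) * prepExpect M c.1 c.2)) • G c.1) from ?_]
    · rw [Fintype.sum_prod_type]
      refine Finset.sum_congr rfl fun w _ => ?_
      dsimp only
      rw [← Finset.sum_smul, ← Finset.mul_sum, sum_prepSign_mul_prepExpect]
    · rw [← (Fintype.equivFin (Probe q)).symm.sum_comp]
      refine Finset.sum_congr rfl fun c _ => ?_
      have := hf c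
      rw [probe] at this
      rw [← this, smul_smul, ← Complex.coe_smul]
      congr 1
      simp only [hs, probe]
      push_cast
      ring
  set x : Fin (numProbes q) → ℝ := fun c =>
    s c * ((∑ i, if acc i c then (1 : ℝ) else 0) / N - f c) with hx
  have hsle : ∀ c, |s c| ≤ 1 := by
    intro c
    simp only [hs, prepSign]
    push_cast
    rw [Finset.abs_prod]
    refine Finset.prod_le_one (fun _ _ => abs_nonneg _) fun j _ => ?_
    have : |localSign ((probe c).1 j) ((probe c).2 j)| ≤ 1 := by
      cases (probe c).1 j <;> cases (probe c).2 j <;> decide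
    exact_mod_cast this
  have hxle : ∀ c, |x c| ≤ 1 / (K * 4 ^ q) := by
    intro c
    have h := hacc c
    rw [Finset.sum_sub_distrib, Finset.sum_const, Finset.card_univ, Fintype.card_fin,
      nsmul_eq_mul] at h
    simp only [hx]
    rw [abs_mul]
    refine (mul_le_of_le_one_left (abs_nonneg _) (hsle c)).trans ?_
    rw [show (∑ i, if acc i c then (1 : ℝ) else 0) / N - f c =
      ((∑ i, if acc i c then (1 : ℝ) else 0) - N * f c) / N by field_simp, abs_div,
      abs_of_pos hN', div_le_iff₀ hN', mul_comm _ (N : ℝ)]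
    exact h
  -- The ideal term scaled by `K / (K + 2)`, plus a padding `1 / (K + 2)`, minus the statistical
  -- error. The padding exactly covers the largest possible error, so the term never becomes
  -- negative.
  have hterm : termOp basis (estimateTerm one el σ K acc) =
      (K / (K + 2) : ℝ) • (1 - A) + (1 / (K + 2) : ℝ) • 1 -
        (K / ((K + 2) * 2 ^ q) : ℝ) • ∑ c, x c • G (probe c).1 := by
    rw [termOp_estimateTerm basis one el σ K hone hN, hA', smul_sub, smul_smul]
    have h1 : ((K + 1 : ℝ) / (K + 2)) • (1 : Op (Fin n)) =
        (K / (K + 2) : ℝ) • 1 + (1 / (K + 2) : ℝ) • 1 := by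
      rw [← add_smul]; congr 1; ring
    have h2 : ∑ c, x c • G (probe c).1 = (∑ c, (s c *
        ((∑ i, if acc i c then (1 : ℝ) else 0) / N)) • G (probe c).1) -
        ∑ c, (s c * f c) • G (probe c).1 := by
      rw [← Finset.sum_sub_distrib]
      refine Finset.sum_congr rfl fun c _ => ?_
      rw [← sub_smul, ← mul_sub]
    rw [h1, h2, smul_sub, show (K / (K + 2) : ℝ) * (1 / 2 ^ q) = K / ((K + 2) * 2 ^ q) by
      field_simp]
    abel
  -- There are `8 ^ q = 2 ^ q * 4 ^ q` probes; this is where the accuracy `1 / (K 4 ^ q)` demanded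
  -- of each frequency comes from.
  have hconst : (K / ((K + 2) * 2 ^ q) : ℝ) * (numProbes q * (1 / (K * 4 ^ q))) =
      1 / (K + 2) := by
    rw [numProbes_eq]
    push_cast
    rw [show (8 : ℝ) ^ q = 2 ^ q * 4 ^ q by rw [← mul_pow]; norm_num]
    field_simp
  have hc0 : (0 : ℝ) ≤ K / ((K + 2) * 2 ^ q) := by positivity
  have hup := smul_le_smul_matrix (sum_smul_le_of_abs_le (fun c => G (probe c).1)
    (fun c => hG1 _) (fun c => hG2 _) x hxle) hc0
  have hlo := smul_le_smul_matrix (sum_smul_le_of_abs_le (fun c => G (probe c).1)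
    (fun c => hG1 _) (fun c => hG2 _) (fun c => -x c) (fun c => (abs_neg _).trans_le (hxle c))) hc0
  rw [Fintype.card_fin, smul_smul, hconst] at hup hlo
  simp only [neg_smul, Finset.sum_neg_distrib, smul_neg] at hlo
  have h2 : (2 / (K + 2) : ℝ) • (1 : Op (Fin n)) =
      (1 / (K + 2) : ℝ) • 1 + (1 / (K + 2) : ℝ) • 1 := by
    rw [← add_smul]; congr 1; ring
  rw [hterm]
  constructor
  · rw [add_sub_assoc]
    exact le_add_of_nonneg_right (sub_nonneg.2 hup)
  · rw [h2, ← add_assoc, sub_eq_add_neg]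
    exact add_le_add_right hlo _

end Term

section Ham

variable {n m : ℕ} {B : Type} {basis : B → Op (Fin n)}

theorem hamOp_map_finRange (T : Fin m → List (Coeff × B)) :
    hamOp basis ((List.finRange m).map T) = (1 / m : ℝ) • ∑ i, termOp basis (T i) := by
  rw [hamOp, List.map_map, sum_map_finRange, List.length_map, List.length_finRange,
    ← Complex.coe_smul]
  simp

variable {K : ℕ} {A : Fin m → Op (Fin n)} {T : Fin m → List (Coeff × B)}

/-- The scaling leaves just enough room: since `A i` lies between `0` and `1`, the lower bound is
nonnegative and the upper one is at most `K / (K + 2) + 2 / (K + 2) = 1`. -/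
theorem boundedTerms_of_bounds (hm : 0 < m) (hA0 : ∀ i, 0 ≤ A i) (hA1 : ∀ i, A i ≤ 1)
    (hT : ∀ i, (K / (K + 2) : ℝ) • (1 - A i) ≤ termOp basis (T i) ∧
      termOp basis (T i) ≤ (K / (K + 2) : ℝ) • (1 - A i) + (2 / (K + 2) : ℝ) • 1) :
    BoundedTerms basis 1 ((List.finRange m).map T) := by
  constructor
  · intro h
    have := congrArg List.length h
    simp at this
    omega
  · intro T' hT'
    rw [List.mem_map] at hT'
    obtain ⟨i, _, rfl⟩ := hT'
    have hc : (0 : ℝ) ≤ K / (K + 2) := by positivity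
    have h0 : 0 ≤ termOp basis (T i) :=
      (smul_nonneg_matrix (sub_nonneg.2 (hA1 i)) hc).trans (hT i).1
    have h1 : termOp basis (T i) ≤ 1 := by
      refine (hT i).2.trans ?_
      have h := smul_le_smul_matrix (sub_le_self (1 : Op (Fin n)) (hA0 i)) hc
      refine (add_le_add_left h _).trans (le_of_eq ?_)
      rw [← add_smul, ← add_div, div_self (by positivity), one_smul]
    exact ⟨Matrix.nonneg_iff_posSemidef.1 h0,
      (CStarAlgebra.norm_le_one_iff_of_nonneg (termOp basis (T i)) h0).2 h1⟩

theorem hamOp_isHermitian (hA1 : ∀ i, A i ≤ 1)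
    (hT : ∀ i, (K / (K + 2) : ℝ) • (1 - A i) ≤ termOp basis (T i)) :
    (hamOp basis ((List.finRange m).map T)).IsHermitian := by
  rw [hamOp_map_finRange]
  refine (Matrix.nonneg_iff_posSemidef.1 (smul_nonneg_matrix (Finset.sum_nonneg fun i _ => ?_)
    (by positivity))).isHermitian
  exact (smul_nonneg_matrix (sub_nonneg.2 (hA1 i)) (by positivity)).trans (hT i)

/-- The good proof is a trial state for the variational principle. One `ε` is lost to sampling and
one to estimation. -/
theorem lowestEnergy_le_of_bounds (hm : 0 < m) (hK : 0 < K) (hA1 : ∀ i, A i ≤ 1)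
    (hT : ∀ i, (K / (K + 2) : ℝ) • (1 - A i) ≤ termOp basis (T i) ∧
      termOp basis (T i) ≤ (K / (K + 2) : ℝ) • (1 - A i) + (2 / (K + 2) : ℝ) • 1)
    {ρ : Op (Fin n)} (hρ : IsDensity ρ) {ε : ℝ} (hε : 2 / K ≤ ε)
    (h : m * (2 / 3 - ε) ≤ ∑ i, expect ρ (A i)) :
    lowestEnergy (hamOp basis ((List.finRange m).map T)) ≤ 1 / 3 + 2 * ε := by
  have hm' : (0 : ℝ) < m := by positivity
  have hK' : (0 : ℝ) < K := by positivity
  refine (lowestEnergy_le_expect (hamOp_isHermitian hA1 fun i => (hT i).1) hρ).trans ?_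
  rw [hamOp_map_finRange, expect_smul, expect_sum, one_div, inv_mul_le_iff₀ hm']
  have h1 : ∀ i, expect ρ (termOp basis (T i)) ≤ (1 - expect ρ (A i)) + ε := by
    intro i
    refine (expect_mono hρ (hT i).2).trans ?_
    rw [expect_add, expect_smul, expect_smul, expect_sub, expect_one hρ]
    have h0 : 0 ≤ 1 - expect ρ (A i) := by
      have := expect_mono hρ (hA1 i); rw [expect_one hρ] at this; linarith
    have h2 : (K / (K + 2) : ℝ) * (1 - expect ρ (A i)) ≤ 1 - expect ρ (A i) :=
      mul_le_of_le_one_left h0 (by rw [div_le_one (by positivity)]; linarith)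
    have h3 : (2 / (K + 2) : ℝ) ≤ 2 / K :=
      div_le_div_of_nonneg_left (by norm_num) hK' (by linarith)
    linarith
  refine (Finset.sum_le_sum fun i _ => h1 i).trans ?_
  rw [Finset.sum_add_distrib, Finset.sum_sub_distrib]
  simp
  linarith

/-- The ground state depends on the sample, so the bound on the sampled effects has to be an
operator inequality. Again one `ε` pays for sampling and one for the factor `K / (K + 2)`. -/
theorem le_lowestEnergy_of_bounds (hm : 0 < m) (hK : 0 < K) (hA1 : ∀ i, A i ≤ 1)
    (hT : ∀ i, (K / (K + 2) : ℝ) • (1 - A i) ≤ termOp basis (T i))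
    {ε : ℝ} (hε : 2 / K ≤ ε)
    (h : ∑ i, A i ≤ algebraMap ℝ _ (m * (1 / 3 + ε))) :
    2 / 3 - 2 * ε ≤ lowestEnergy (hamOp basis ((List.finRange m).map T)) := by
  have hm' : (0 : ℝ) < m := by positivity
  have hK' : (0 : ℝ) < K := by positivity
  refine le_lowestEnergy (hamOp_isHermitian hA1 hT) ?_
  rw [hamOp_map_finRange]
  have h1 : (K / (K + 2) : ℝ) • ((m : ℝ) • (1 : Op (Fin n)) - ∑ i, A i) ≤
      ∑ i, termOp basis (T i) := by
    refine le_trans (le_of_eq ?_) (Finset.sum_le_sum fun i _ => hT i)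
    rw [← Finset.smul_sum, Finset.sum_sub_distrib]
    simp [Nat.cast_smul_eq_nsmul]
  rw [Algebra.algebraMap_eq_smul_one] at h ⊢
  have h2 := (smul_le_smul_matrix (sub_le_sub_left h ((m : ℝ) • (1 : Op (Fin n))))
    (c := (K / (K + 2) : ℝ)) (by positivity)).trans h1
  have h3 := smul_le_smul_matrix h2 (c := (1 / m : ℝ)) (by positivity)
  refine le_trans ?_ h3
  rw [← sub_smul, smul_smul, smul_smul]
  refine smul_one_le_smul_one ?_
  have hid : 1 / (m : ℝ) * (K / (K + 2)) * (m - m * (1 / 3 + ε)) =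
      (2 / 3 - ε) - 2 / (K + 2) * (2 / 3 - ε) := by
    field_simp; ring
  rw [hid]
  have h4 : (2 / (K + 2) : ℝ) ≤ 2 / K :=
    div_le_div_of_nonneg_left (by norm_num) hK' (by linarith)
  have h5 : (0 : ℝ) < 2 / (K + 2) := by positivity
  nlinarith

end Ham

section Prob

open Classical in
/-- If most coins are good, and for good coins most outcomes are good, then the run is good with
probability at least `2/3`. -/
theorem two_thirds_le_runProb {R : ℕ} (C : (Fin R → Bool) → Σ a, List (Gate (Fin a)))
    (good : (w : Fin R → Bool) → (Fin (C w).1 → Bool) → Prop)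
    (badCoins : Finset (Fin R → Bool)) (hbad : (badCoins.card : ℝ) ≤ 2 ^ R / 6)
    (bad : (w : Fin R → Bool) → (Fin (C w).1 → Bool) → Prop)
    (h : ∀ w y, w ∉ badCoins → ¬ bad w y → good w y)
    (hw : ∀ w, (∑ y, if bad w y then ‖circuitOp (C w).2 y (fun _ => false)‖ ^ 2 else 0) ≤ 1 / 6) :
    2 / 3 ≤ runProb C good := by
  have h1 : ∀ w ∉ badCoins, (5 / 6 : ℝ) ≤ ∑ y : Fin (C w).1 → Bool,
      if good w y then ‖circuitOp (C w).2 y (fun _ => false)‖ ^ 2 else 0 := by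
    intro w hwg
    have hsum := sum_norm_sq_eq_one (circuitOp_conjTranspose_mul_self (C w).2) (fun _ => false)
    have hle : ∑ y : Fin (C w).1 → Bool, ‖circuitOp (C w).2 y (fun _ => false)‖ ^ 2 ≤
        (∑ y, if good w y then ‖circuitOp (C w).2 y (fun _ => false)‖ ^ 2 else 0) +
        ∑ y, if bad w y then ‖circuitOp (C w).2 y (fun _ => false)‖ ^ 2 else 0 := by
      rw [← Finset.sum_add_distrib]
      refine Finset.sum_le_sum fun y _ => ?_
      by_cases hb : bad w y
      · rw [if_pos hb]
        split_ifs
        · linarith [sq_nonneg ‖circuitOp (C w).2 y (fun _ => false)‖]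
        · linarith
      · rw [if_pos (h w y hwg hb), if_neg hb, add_zero]
    have := hw w
    linarith
  have hcard : (5 / 6 : ℝ) * 2 ^ R ≤ (badCoinsᶜ.card : ℝ) := by
    rw [Finset.card_compl, Nat.cast_sub (Finset.card_le_univ _)]
    simp only [Fintype.card_fun, Fintype.card_bool, Fintype.card_fin]
    push_cast
    linarith
  have h2 : (badCoinsᶜ.card : ℝ) * (5 / 6) ≤ ∑ w : Fin R → Bool, ∑ y : Fin (C w).1 → Bool,
      if good w y then ‖circuitOp (C w).2 y (fun _ => false)‖ ^ 2 else 0 := by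
    rw [← nsmul_eq_mul]
    refine (Finset.card_nsmul_le_sum badCoinsᶜ _ (5 / 6) fun w hw' =>
      h1 w (Finset.mem_compl.1 hw')).trans ?_
    refine Finset.sum_le_sum_of_subset_of_nonneg (Finset.subset_univ _) fun w _ _ => ?_
    exact Finset.sum_nonneg fun y _ => by split_ifs <;> positivity
  -- Both coins and outcomes are good with probability at least `5/6`, and `25/36` exceeds `2/3`.
  rw [runProb, one_div, le_inv_mul_iff₀ (by positivity)]
  linarith

end Prob

end

end QHard

/-! ### The random Hamiltonian, for qubits and fermions alike. -/

namespace QHard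

open Enc (enc)
open scoped ComplexOrder MatrixOrder
open scoped Matrix.Norms.L2Operator

noncomputable section

set_option linter.unusedSectionVars false

/-! ## The random Hamiltonian of a verifier -/

/-- A family of basis operators in which the checks on `q` selected sites can be expressed. -/
structure OperatorModel (q : ℕ) (W : ℕ → Type) where
  basis : ∀ {n : ℕ}, W n → Op (Fin n)
  one : ∀ n : ℕ, W n
  basis_one : ∀ n, basis (one n) = 1
  /-- The operator that a Pauli string on the selected sites stands for, up to a sign. -/
  el : ∀ {n : ℕ}, (Fin q ↪o Fin n) → (Fin q → Pauli) → W n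
  -- The value `0` is allowed: in the fermionic model it discards the odd strings.
  sign : (Fin q → Pauli) → ℤ
  neg_one_le : ∀ {n : ℕ} (S : Fin q ↪o Fin n) w, -1 ≤ (sign w : ℝ) • basis (el S w)
  le_one : ∀ {n : ℕ} (S : Fin q ↪o Fin n) w, (sign w : ℝ) • basis (el S w) ≤ 1

namespace OperatorModel

variable {q : ℕ} {W : ℕ → Type} (D : OperatorModel q W)

/-- The operator on all sites that is given by an operator on the selected sites. -/
def observable {n : ℕ} (S : Fin q ↪o Fin n) (M : Op (Fin q)) : Op (Fin n) :=
  ∑ w, ((1 / 2 ^ q : ℂ) * (M * pauliString w).trace) • ((D.sign w : ℝ) • D.basis (D.el S w))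

/-- The acceptance operator of a check. -/
def effect {n : ℕ} (V : QubitCheck n q) : Op (Fin n) := D.observable V.1 (acceptEffect V.2.2)

variable {n R₀ R m N A : ℕ} (e : (Fin R → Bool) ≃ (Fin m → Fin R₀ → Bool))
  (V : (Fin R₀ → Bool) → QubitCheck n q) (hA : ∀ r, (V r).2.1 ≤ A) (K : ℕ)

/-- The circuit that runs all checks on all probes. -/
def sampleCircuit (N : ℕ) (w : Fin R → Bool) : Σ a, List (Gate (Fin a)) :=
  ⟨m * N * numProbes q * blockSize q A,
    registerCircuit fun b => blockCircuit (hA (e w b.1.1)) (V (e w b.1.1)).2.2 (probe b.2)⟩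

/-- The Hamiltonian that is computed from the outcomes. -/
def sampleTerms (w : Fin R → Bool)
    (y : Fin (m * N * numProbes q * blockSize q A) → Bool) : List (List (Coeff × W n)) :=
  (List.finRange m).map fun i => estimateTerm (D.one n) (D.el (V (e w i)).1) D.sign K
    fun j c => y (registerEquiv m N (numProbes q) (blockSize q A) (((i, j), c), acceptPos q A))

/-- The acceptance probability of a check on a probe. -/
def probeProb {n : ℕ} (V : QubitCheck n q) (c : Fin (numProbes q)) : ℝ :=
  (prepExpect (acceptEffect V.2.2) (probe c).1 (probe c).2).re

omit D in
theorem sum_accept_blockCircuit_eq (r : Fin R₀ → Bool) (c : Fin (numProbes q)) :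
    (∑ y, if y (acceptPos q A) then
      ‖circuitOp (blockCircuit (hA r) (V r).2.2 (probe c)) y (fun _ => false)‖ ^ 2 else 0) =
      probeProb (V r) c := by
  have h := sum_accept_blockCircuit (hA r) (V r).2.2 (probe c)
  rw [probeProb, ← h, Complex.ofReal_re]

omit D in
include hA in
theorem ofReal_probeProb (r : Fin R₀ → Bool) (c : Fin (numProbes q)) :
    (probeProb (V r) c : ℂ) = prepExpect (acceptEffect (V r).2.2) (probe c).1 (probe c).2 := by
  rw [← sum_accept_blockCircuit (hA r) (V r).2.2 (probe c), ← sum_accept_blockCircuit_eq V hA]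

/-- Some acceptance frequency is far from the acceptance probability. -/
def BadOutcome (w : Fin R → Bool)
    (y : Fin (m * N * numProbes q * blockSize q A) → Bool) : Prop :=
  ∃ i c, N * (1 / (K * 4 ^ q) : ℝ) <
    |∑ j, ((if y (registerEquiv m N (numProbes q) (blockSize q A) (((i, j), c), acceptPos q A))
      then (1 : ℝ) else 0) - probeProb (V (e w i)) c)|

omit D in
open Classical in
theorem sum_badOutcome_le (hK : 0 < K) (hm : 0 < m) (hN : N = 6 * (8 ^ q * (K ^ 2 * 16 ^ q)) * m)
    (w : Fin R → Bool) :
    (∑ y, if BadOutcome (A := A) e V K w y then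
      ‖circuitOp (sampleCircuit e V hA N w).2 y (fun _ => false)‖ ^ 2 else 0) ≤ 1 / 6 := by
  have hK' : (0 : ℝ) < K := by positivity
  have hη : (0 : ℝ) < 1 / (K * 4 ^ q) := by positivity
  have hN0 : 0 < N := by rw [hN]; positivity
  -- Equality holds: `N` is chosen as the number of repetitions for which the union bound gives
  -- `1/6`.
  have hN1 : 6 * ((m : ℝ) * numProbes q) ≤ N * (1 / (K * 4 ^ q)) ^ 2 := by
    rw [hN, numProbes_eq, show (16 : ℕ) = 4 * 4 from rfl, mul_pow]
    push_cast
    refine le_of_eq ?_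
    field_simp
  clear hN
  have key := sum_bad_registerCircuit_le (fun b : (Fin m × Fin N) × Fin (numProbes q) =>
    blockCircuit (hA (e w b.1.1)) (V (e w b.1.1)).2.2 (probe b.2)) (acceptPos q A)
    (fun i c => probeProb (V (e w i)) c)
    (fun i n c => sum_accept_blockCircuit_eq V hA _ c) hη hN1 hN0
  refine key.trans' (le_of_eq ?_)
  exact Finset.sum_congr rfl fun y _ => if_congr Iff.rfl rfl rfl

theorem sampleTerms_bounds (hK : 0 < K) (hN : 0 < N) (w : Fin R → Bool)
    (y : Fin (m * N * numProbes q * blockSize q A) → Bool) (hy : ¬ BadOutcome e V K w y) (i : Fin m)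
    (hA : ∀ r, (V r).2.1 ≤ A) :
    (K / (K + 2) : ℝ) • (1 - D.effect (V (e w i))) ≤
      termOp D.basis (estimateTerm (D.one n) (D.el (V (e w i)).1) D.sign K fun j c =>
        y (registerEquiv m N (numProbes q) (blockSize q A) (((i, j), c), acceptPos q A))) ∧
    termOp D.basis (estimateTerm (D.one n) (D.el (V (e w i)).1) D.sign K fun j c =>
        y (registerEquiv m N (numProbes q) (blockSize q A) (((i, j), c), acceptPos q A))) ≤
      (K / (K + 2) : ℝ) • (1 - D.effect (V (e w i))) + (2 / (K + 2) : ℝ) • 1 := by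
  refine estimateTerm_bounds D.basis (D.one n) _ D.sign K (D.basis_one n) hN hK
    (D.neg_one_le _) (D.le_one _) (acceptEffect (V (e w i)).2.2) _ rfl _
    (probeProb (V (e w i))) (fun c => ofReal_probeProb V hA _ c) fun c => ?_
  simp only [BadOutcome, not_exists, not_lt] at hy
  exact hy i c

omit D in
theorem card_map_symm (P : (Fin m → Fin R₀ → Bool) → Prop) [DecidablePred P] :
    ((Finset.univ.filter P).map e.symm.toEmbedding).card =
      (Finset.univ.filter P).card := Finset.card_map _

omit D in
include e in
theorem card_coins_eq : ((2 : ℝ) ^ R₀) ^ m = 2 ^ R := by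
  have := Fintype.card_congr e
  simp only [Fintype.card_fun, Fintype.card_bool, Fintype.card_fin] at this
  exact_mod_cast this.symm

variable (h0 : ∀ r, 0 ≤ D.effect (V r)) (h1 : ∀ r, D.effect (V r) ≤ 1)
  {K} (hK : 0 < K) (hm : 0 < m) (hN : N = 6 * (8 ^ q * (K ^ 2 * 16 ^ q)) * m)
  {ε : ℝ} (hε : 2 / K ≤ ε) (hm6 : 6 ≤ m * ε ^ 2)

include h0 h1 hK hm hN hε hm6

-- Bad coins are those for which the fixed proof `ρ` scores too low on the sampled checks. As `ρ`
-- does not depend on the coins, the scalar bound `card_lt_sum_le` applies.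
open Classical in
theorem runProb_yes {ρ : Op (Fin n)} (hρ : IsDensity ρ)
    (h : 2 / 3 ≤ 1 / 2 ^ R₀ * ∑ r, expect ρ (D.effect (V r))) :
    2 / 3 ≤ runProb (sampleCircuit e V hA N) fun w y =>
      BoundedTerms D.basis 1 (D.sampleTerms e V K w y) ∧
        lowestEnergy (hamOp D.basis (D.sampleTerms e V K w y)) ≤ 1 / 3 + 2 * ε := by
  have hK' : (0 : ℝ) < K := by positivity
  have hε0 : 0 < ε := lt_of_lt_of_le (by positivity) hε
  have hNpos : 0 < N := by rw [hN]; positivity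
  have hΩ : (Fintype.card (Fin R₀ → Bool) : ℝ) = 2 ^ R₀ := by simp
  have hcard := card_lt_sum_le (m := m) (fun r => expect ρ (D.effect (V r)))
    (fun r => by simpa [expect] using expect_mono hρ (h0 r))
    (fun r => (expect_mono hρ (h1 r)).trans_eq (expect_one hρ)) (θ := 2 / 3) hε0
    (by
      rw [one_div, le_inv_mul_iff₀ (by positivity)] at h
      rw [hΩ]; exact h) hm6
  refine two_thirds_le_runProb _ _ ((Finset.univ.filter fun r : Fin m → Fin R₀ → Bool =>
    ∑ i, expect ρ (D.effect (V (r i))) < m * (2 / 3 - ε)).map e.symm.toEmbedding) ?_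
    (BadOutcome e V K) ?_ fun w => sum_badOutcome_le e V hA K hK hm hN w
  · rw [card_map_symm, ← card_coins_eq e, ← hΩ]
    exact hcard
  · intro w y hw hy
    have hb := D.sampleTerms_bounds e V K hK hNpos w y hy (hA := hA)
    refine ⟨boundedTerms_of_bounds hm (fun i => h0 _) (fun i => h1 _) hb,
      lowestEnergy_le_of_bounds hm hK (fun i => h1 _) hb hρ hε ?_⟩
    by_contra hlt
    refine hw (Finset.mem_map.2 ⟨e w, ?_, e.symm_apply_apply w⟩)
    simpa using hlt

-- Bad coins are those for which the sampled sum exceeds its threshold as an operator. Their number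
-- is controlled by the `k`-th moment, and `hk` says that this moment beats the dimension `2 ^ n`.
open Classical in
theorem runProb_no (h : ∀ ρ : Op (Fin n), IsDensity ρ →
      1 / 2 ^ R₀ * ∑ r, expect ρ (D.effect (V r)) ≤ 1 / 3) {k : ℕ}
    (hk : 2 ^ n * (m * (1 / 3 : ℝ) + k / (1 / 3 : ℝ)) ^ k ≤ (m * (1 / 3 + ε)) ^ k / 6) :
    2 / 3 ≤ runProb (sampleCircuit e V hA N) fun w y =>
      BoundedTerms D.basis 1 (D.sampleTerms e V K w y) ∧
        2 / 3 - 2 * ε ≤ lowestEnergy (hamOp D.basis (D.sampleTerms e V K w y)) := by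
  have hK' : (0 : ℝ) < K := by positivity
  have hm' : (0 : ℝ) < m := by positivity
  have hε0 : 0 < ε := lt_of_lt_of_le (by positivity) hε
  have hNpos : 0 < N := by rw [hN]; positivity
  have hΩ : (Fintype.card (Fin R₀ → Bool) : ℝ) = 2 ^ R₀ := by simp
  have hκ : (Fintype.card (Fin n → Bool) : ℝ) = 2 ^ n := by simp
  have hcard := card_not_le_mul_le (m := m) (fun r => D.effect (V r)) h0 h1
    (θ := 1 / 3) (by norm_num) (by norm_num)
    (by
      refine le_algebraMap_of_expect_le ?_ fun ρ hρ => ?_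
      · exact (Matrix.nonneg_iff_posSemidef.1 (Finset.sum_nonneg fun r _ => h0 r)).isHermitian
      · have := h ρ hρ
        rw [one_div, inv_mul_le_iff₀ (by positivity)] at this
        rw [expect_sum, hΩ]
        exact this) (t := m * (1 / 3 + ε)) (by positivity) k
  rw [hκ, hΩ] at hcard
  refine two_thirds_le_runProb _ _ ((Finset.univ.filter fun r : Fin m → Fin R₀ → Bool =>
    ¬ ∑ i, D.effect (V (r i)) ≤ algebraMap ℝ _ (m * (1 / 3 + ε))).map e.symm.toEmbedding) ?_
    (BadOutcome e V K) ?_ fun w => sum_badOutcome_le e V hA K hK hm hN w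
  · rw [card_map_symm, ← card_coins_eq e]
    have ht : (0 : ℝ) < (m * (1 / 3 + ε)) ^ k := by positivity
    refine le_of_mul_le_mul_right (hcard.trans ?_) ht
    calc _ = (2 ^ R₀) ^ m * (2 ^ n * (m * (1 / 3 : ℝ) + k / (1 / 3 : ℝ)) ^ k) := by ring
      _ ≤ (2 ^ R₀) ^ m * ((m * (1 / 3 + ε)) ^ k / 6) :=
        mul_le_mul_of_nonneg_left hk (by positivity)
      _ = _ := by ring
  · intro w y hw hy
    have hb := D.sampleTerms_bounds e V K hK hNpos w y hy (hA := hA)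
    refine ⟨boundedTerms_of_bounds hm (fun i => h0 _) (fun i => h1 _) hb,
      le_lowestEnergy_of_bounds hm hK (fun i => h1 _) (fun i => (hb i).1) hε ?_⟩
    by_contra hlt
    refine hw (Finset.mem_map.2 ⟨e w, ?_, e.symm_apply_apply w⟩)
    simpa using hlt

end OperatorModel

end

end QHard

/-! ### The measurement circuit is computable in polynomial time. -/

namespace QHard

open Enc (enc)
open scoped ComplexOrder MatrixOrder

noncomputable section

set_option linter.unusedSectionVars false

/-! ## The programs of the reduction -/

/-- The entries of a tree that is read as a list of trees. -/
def Data.toList : Data → List Data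
  | .nil => []
  | .cons d e => d :: e.toList

@[simp] theorem dlist_toList (d : Data) : dlist d.toList = d := by
  induction d with
  | nil => rfl
  | cons d e _ ih => simp [Data.toList, ih]

@[simp] theorem toList_dlist (l : List Data) : (dlist l).toList = l := by
  induction l with
  | nil => rfl
  | cons d l ih => simp [Data.toList, ih]

namespace PolyComp

variable {ι : Type} {n : ι → ℕ} {u v w c : ι → Data}

theorem map_list {β : ι → Type} (e : ∀ a, β a → Data) {l : ∀ a, List (β a)}
    (f : ∀ a, β a → Data)
    (hl : PolyComp n u fun a => dlist ((l a).map (e a)))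
    (hf : PolyComp (fun t : Σ a, {b // b ∈ l a} => n t.1)
      (fun t => .cons (u t.1) (e t.1 t.2)) fun t => f t.1 t.2) :
    PolyComp n u fun a => dlist ((l a).map (f a)) :=
  (flatMap_list e (fun a b => [f a b]) hl (hf.cons (nil hf.1))).congr fun a => by
    rw [← List.map_eq_flatMap]

theorem appendData (hv : PolyComp n u v) (hw : PolyComp n u w) :
    PolyComp n u fun a => dlist ((v a).toList ++ (w a).toList) :=
  append (hv.congr fun _ => (dlist_toList _).symm) (hw.congr fun _ => (dlist_toList _).symm)

/-- What is known before a loop is known inside. -/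
theorem inLoop (hv : PolyComp n u v) {k : ι → ℕ} (hk : PolyComp n u fun a => enc (k a)) :
    PolyComp (fun t : Σ a, Fin (k a) => n t.1) (fun t => .cons (u t.1) (enc t.2))
      fun t => v t.1 := (hv.reindex Sigma.fst).weaken (bdd_fin hk.bdd)

theorem loopVar {k : ι → ℕ} (hk : PolyComp n u fun a => enc (k a)) :
    PolyComp (fun t : Σ a, Fin (k a) => n t.1) (fun t => .cons (u t.1) (enc t.2))
      fun t => enc t.2 := snd (hk.1.reindex Sigma.fst) (bdd_fin hk.bdd)

theorem const_list {β : Type} (l : List β) {f : ι → β → Data}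
    (hu : PolyBdd n fun a => (u a).size) (hf : ∀ b, PolyComp n u fun a => f a b) :
    PolyComp n u fun a => dlist (l.map (f a)) := by
  induction l with
  | nil => exact nil hu
  | cons b l ih => exact (hf b).cons ih

/-- Finitely many cases. -/
theorem fin_cases {k : ℕ} {f : ι → Fin k → Data} (hf : ∀ i, PolyComp n u fun a => f a i)
    {j : ι → Fin k} (hj : PolyComp n u fun a => enc (j a)) : PolyComp n u fun a => f a (j a) := by
  simp only [enc_fin] at hj
  refine (((const_list (List.finRange k) hj.1 hf).drop hj).hd).congr fun a => ?_
  rw [List.drop_eq_getElem_cons (by simp)]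
  simp

open Classical in
/-- The label of a qubit of a check is replaced by its position in the register. -/
def placeLabel (q off : ℕ) (d : Data) : Data :=
  dlist ((enc (if d.hd = .nil then off else off + q)).toList ++ d.tl.toList)

theorem placeLabel_inl (q off a : ℕ) (j : Fin q) :
    placeLabel q off (enc (Sum.inl j : Fin q ⊕ Fin a)) = enc (off + j) := by
  simp [placeLabel, enc_inl, enc_fin, enc_nat]

theorem placeLabel_inr (q off a : ℕ) (z : Fin a) :
    placeLabel q off (enc (Sum.inr z : Fin q ⊕ Fin a)) = enc (off + q + z) := by
  simp [placeLabel, enc_inr, enc_fin, enc_nat]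

theorem comp_placeLabel (q : ℕ) {off : ι → ℕ} (ho : PolyComp n u fun a => enc (off a))
    (hv : PolyComp n u v) : PolyComp n u fun a => placeLabel q (off a) (v a) := by
  classical
  refine appendData ((hv.hd.ite ho (ho.natAdd (natConst ho.1 q))).congr fun a => ?_) hv.tl
  split_ifs <;> rfl

open Classical in
/-- The encoding of a gate after `φ` has been applied to the encodings of its labels. -/
def mapGate (φ : Data → Data) (d : Data) : Data :=
  .cons d.hd (if d.hd.tl = .nil then φ d.tl else .cons (φ d.tl.hd) (φ d.tl.tl))

theorem comp_mapGate {φ : ι → Data → Data}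
    (hφ : ∀ {v : ι → Data}, PolyComp n u v → PolyComp n u fun a => φ a (v a))
    (hv : PolyComp n u v) : PolyComp n u fun a => mapGate (φ a) (v a) := by
  classical
  refine hv.hd.cons ((hv.hd.tl.ite (hφ hv.tl) ((hφ hv.tl.hd).cons (hφ hv.tl.tl))).congr
    fun a => ?_)
  split_ifs <;> rfl

theorem enc_relabel {α β : Type} [Enc α] [Enc β] {φ : Data → Data} {f : α ↪ β}
    (hf : ∀ i, enc (f i) = φ (enc i)) (g : Gate α) : enc (g.relabel f) = mapGate φ (enc g) := by
  cases g with
  | hadamard i =>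
    refine (congrArg (Data.cons (enc 0)) (hf i)).trans ?_
    exact congrArg (Data.cons _) (if_pos rfl).symm
  | tGate i =>
    refine (congrArg (Data.cons (enc 1)) (hf i)).trans ?_
    exact congrArg (Data.cons _) (if_pos rfl).symm
  | cnot i j h =>
    refine (congrArg₂ (fun d e => Data.cons (enc 2) (Data.cons d e)) (hf i) (hf j)).trans ?_
    exact congrArg (Data.cons _) (if_neg Data.noConfusion).symm

theorem bdd_mem {β : ι → Type} [∀ a, Enc (β a)] {l : ∀ a, List (β a)}
    (hl : PolyComp n u fun a => enc (l a)) :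
    PolyBdd (fun t : Σ a, {b // b ∈ l a} => n t.1) fun t => (enc t.2.1).size := by
  refine (hl.bdd.reindex Sigma.fst).mono fun t => ?_
  obtain ⟨a, g, h⟩ := t
  obtain ⟨i, hi, rfl⟩ := List.getElem_of_mem h
  simp only [enc_list]
  have := size_dlist_drop_le ((l a).map enc) i
  rw [List.drop_eq_getElem_cons (by simpa using hi), dlist_cons, Data.size_cons] at this
  simp only [List.getElem_map] at this
  omega

/-- The gates of a circuit can be relabelled. -/
theorem relabelGates {α β : ι → Type} [∀ a, Enc (α a)] [∀ a, Enc (β a)]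
    {gs : ∀ a, List (Gate (α a))} {f : ∀ a, α a ↪ β a} {φ : ι → Data → Data}
    (hf : ∀ a i, enc (f a i) = φ a (enc i))
    (hφ : ∀ {w v : (Σ a, {g // g ∈ gs a}) → Data}, PolyBdd (fun t => n t.1) (fun t => (w t).size) →
      PolyComp (fun t => n t.1) (fun t => .cons (u t.1) (w t)) v →
        PolyComp (fun t => n t.1) (fun t => .cons (u t.1) (w t)) fun t => φ t.1 (v t))
    (hg : PolyComp n u fun a => enc (gs a)) :
    PolyComp n u fun a => enc ((gs a).map (Gate.relabel (f a))) := by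
  have hb := bdd_mem hg
  simp only [enc_list] at hg
  refine (map_list (fun _ => enc) (fun a g => mapGate (φ a) (enc g)) hg
    (comp_mapGate (hφ hb) (snd (hg.1.reindex Sigma.fst) hb))).congr fun a => ?_
  rw [enc_list, List.map_map]
  congr 2
  funext g
  exact (enc_relabel (hf a) g).symm

/-- `f` moves the qubits of a check to the positions from `off` on. -/
def IsPlacement {q a L : ℕ} (off : ℕ) (f : Fin q ⊕ Fin a ↪ Fin L) : Prop :=
  (∀ j, (f (Sum.inl j) : ℕ) = off + j) ∧ ∀ z, (f (Sum.inr z) : ℕ) = off + q + z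

theorem IsPlacement.enc_apply {q a L off : ℕ} {f : Fin q ⊕ Fin a ↪ Fin L}
    (hf : IsPlacement off f) (i : Fin q ⊕ Fin a) : enc (f i) = placeLabel q off (enc i) := by
  rcases i with j | z
  · rw [placeLabel_inl, enc_fin, hf.1]
  · rw [placeLabel_inr, enc_fin, hf.2]

theorem placeGates {q : ℕ} {anc L off : ι → ℕ} {gs : ∀ a, List (Gate (Fin q ⊕ Fin (anc a)))}
    {f : ∀ a, Fin q ⊕ Fin (anc a) ↪ Fin (L a)} (hf : ∀ a, IsPlacement (off a) (f a))
    (hg : PolyComp n u fun a => enc (gs a)) (ho : PolyComp n u fun a => enc (off a)) :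
    PolyComp n u fun a => enc ((gs a).map (Gate.relabel (f a))) :=
  relabelGates (fun a => (hf a).enc_apply)
    (fun hw hv => comp_placeLabel q ((ho.reindex Sigma.fst).weaken hw) hv) hg

/-- The code of a left label does not mention the number of ancillas. A preparation circuit can
therefore be stored once and for all, although the checks have varying numbers of ancillas. -/
theorem enc_relabel_inl {q : ℕ} (a b : ℕ) (g : Gate (Fin q)) :
    enc (g.relabel (Function.Embedding.inl : Fin q ↪ Fin q ⊕ Fin a)) =
      enc (g.relabel (Function.Embedding.inl : Fin q ↪ Fin q ⊕ Fin b)) := by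
  cases g <;> rfl

theorem probeGates {q : ℕ} {anc : ι → ℕ} {gs : ∀ a, List (Gate (Fin q ⊕ Fin (anc a + 1)))}
    {c : ι → Fin (numProbes q)} (hg : PolyComp n u fun a => enc (gs a))
    (hc : PolyComp n u fun a => enc (c a)) :
    PolyComp n u fun a => enc (probeCircuit (gs a) (probe (c a))) := by
  have h := hc.table fun c => enc ((prepCircuit (probe c).1 (probe c).2).map
    (Gate.relabel (Function.Embedding.inl : Fin q ↪ Fin q ⊕ Fin 1)))
  simp only [enc_list] at h hg
  refine (h.append hg).congr fun a => ?_
  rw [probeCircuit, enc_list, List.map_append, List.map_map, List.map_map]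
  congr 3
  funext g
  exact enc_relabel_inl _ _ g

end PolyComp

open PolyComp

theorem size_enc_bool_list (l : List Bool) : (enc l).size ≤ 4 * l.length + 1 := by
  rw [enc_list]
  refine (size_dlist_le (b := 3) fun d hd => ?_).trans (by simp; omega)
  rw [List.mem_map] at hd
  obtain ⟨b, -, rfl⟩ := hd
  cases b <;> simp [enc_true, enc_false]

theorem bdd_bits {ι : Type} {n k : ι → ℕ} {x : ι → List Bool} (hk : PolyBdd n k)
    (hx : ∀ a, (x a).length ≤ k a) : PolyBdd n fun a => (enc (x a)).size :=
  (((PolyBdd.const 4).mul hk).add (PolyBdd.const 1)).mono fun a =>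
    (size_enc_bool_list _).trans (by have := hx a; omega)

theorem bdd_coins {ι : Type} {n k : ι → ℕ} {w : ∀ a, Fin (k a) → Bool} (hk : PolyBdd n k) :
    PolyBdd n fun a => (enc (w a)).size :=
  bdd_bits (x := fun a => List.ofFn (w a)) hk fun a => by simp

/-- The coins of the reduction as a table of the coins of the verifier. -/
def coinsEquiv {R m R₀ : ℕ} (h : m * R₀ = R) : (Fin R → Bool) ≃ (Fin m → Fin R₀ → Bool) :=
  (Equiv.arrowCongr ((finCongr h).symm.trans finProdFinEquiv.symm) (Equiv.refl Bool)).trans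
    (Equiv.curry _ _ _)

theorem isPlacement_block {q a A m N Q : ℕ} (h : a ≤ A) (i : Fin m) (k : Fin N) (c : Fin Q) :
    IsPlacement (((i * N + k) * Q + c) * blockSize q A)
      ((checkEmb h : Fin q ⊕ Fin (a + 1) ↪ _).trans
        (blockEmb (registerEquiv m N Q (blockSize q A)) ((i, k), c))) := by
  constructor
  · intro j
    exact (registerEquiv_val _ _ _ _).trans (congrArg _ (checkEmb_inl h j))
  · intro z
    refine (registerEquiv_val _ _ _ _).trans ?_
    rw [checkEmb_inr, add_assoc]

theorem Gate.relabel_relabel {α β γ : Type} (f : α ↪ β) (f' : β ↪ γ) (g : Gate α) :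
    (g.relabel f).relabel f' = g.relabel (f.trans f') := by
  cases g <;> rfl

section Programs

variable {q : ℕ} {p R m N A : Polynomial ℕ}
  (V : (x : List Bool) → (Fin (R.eval x.length) → Bool) → QubitCheck (p.eval x.length) q)
  (hV : PolyComp (fun t : Σ x : List Bool, (Fin (R.eval x.length) → Bool) => t.1.length)
    (fun t => enc (t.1, t.2)) fun t => enc (V t.1 t.2))
  (hA : ∀ x r, (V x r).2.1 ≤ A.eval x.length)

/-- The number of coins of the reduction. -/
theorem eval_coins (m R : Polynomial ℕ) (x : List Bool) :
    m.eval x.length * R.eval x.length = (m * R).eval x.length := (Polynomial.eval_mul).symm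

/-- The coins of the reduction on input `x`. -/
abbrev coinsOf (m R : Polynomial ℕ) (x : List Bool) :
    (Fin ((m * R).eval x.length) → Bool) ≃
      (Fin (m.eval x.length) → Fin (R.eval x.length) → Bool) := coinsEquiv (eval_coins m R x)

include hV in
/-- The checks for all rounds can be computed. -/
theorem polyComp_check {ι : Type} {u : ι → Data} {x : ι → List Bool}
    {w : ∀ a, Fin ((m * R).eval (x a).length) → Bool}
    (hx : PolyComp (fun a => (x a).length) u fun a => enc (x a))
    (hlen : PolyComp (fun a => (x a).length) u fun a => enc (x a).length)
    (hw : PolyComp (fun a => (x a).length) u fun a => enc (w a))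
    {i : ∀ a, Fin (m.eval (x a).length)}
    (hi : PolyComp (fun a => (x a).length) u fun a => enc (i a)) :
    PolyComp (fun a => (x a).length) u fun a => enc (V (x a) (coinsOf m R (x a) (w a) (i a))) := by
  refine (hx.cons ?_).comp (hV.reindex fun a =>
    (⟨x a, coinsOf m R (x a) (w a) (i a)⟩ :
      Σ x : List Bool, (Fin (R.eval x.length) → Bool)))
  simp only [enc_fun]
  have hR := natPoly R hlen
  have hb := bdd_fin hR.bdd
  refine hR.mapFin ((nth (j := fun t : Σ a, Fin (R.eval (x a).length) =>
    finCongr (eval_coins m R (x t.1)) (finProdFinEquiv (i t.1, t.2)))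
    ((hw.reindex Sigma.fst).weaken hb) ?_).congr fun t => ?_)
  -- The coins of round `i` form row `i` of the table, so coin `j` is found at position `j + R * i`.
  · simp only [enc_fin] at hi hb ⊢
    exact ((snd (hx.1.reindex Sigma.fst) hb).natAdd
      (((hR.natMul hi).reindex Sigma.fst).weaken hb)).congr fun t => rfl
  · rfl

theorem enc_registerCircuit {m N Q L : ℕ}
    (gs : (Fin m × Fin N) × Fin Q → List (Gate (Fin L))) :
    enc (registerCircuit gs) = dlist ((List.finRange m).flatMap fun i =>
      (List.finRange N).flatMap fun k => (List.finRange Q).flatMap fun c =>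
        ((gs ((i, k), c)).map
          (Gate.relabel (blockEmb (registerEquiv m N Q L) ((i, k), c)))).map enc) := by
  rw [enc_list, registerCircuit, blockList]
  congr 1
  simp only [List.flatMap_assoc, List.map_flatMap, List.flatMap_map]

theorem polyComp_length {ι : Type} {n : ι → ℕ} {u : ι → Data} {x : ι → List Bool}
    (hx : PolyComp n u fun a => enc (x a)) : PolyComp n u fun a => enc (x a).length := by
  simp only [enc_list] at hx
  have hb : PolyBdd (fun t : Σ a, {b // b ∈ x a} => n t.1) fun t => (enc t.2.1).size :=
    (PolyBdd.const 3).mono fun t => by cases t.2.1 <;> simp [enc_true, enc_false]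
  refine (map_list (fun _ => enc) (fun _ _ => Data.nil) hx
    (nil (bdd_cons (hx.1.reindex Sigma.fst) hb))).congr fun a => ?_
  rw [enc_nat, List.map_const']

-- Three nested loops over rounds, repetitions and probes write the circuit. The check of a round is
-- computed in the outer loop and carried into the inner ones.
include hV in
theorem polyComp_prep : PolyComp
    (fun t : Σ x : List Bool, (Fin ((m * R).eval x.length) → Bool) => t.1.length)
    (fun t => enc (t.1, t.2)) fun t => enc (OperatorModel.sampleCircuit (coinsOf m R t.1) (V t.1)
      (hA t.1) (N.eval t.1.length) t.2) := by
  have hw : PolyBdd (fun t : Σ x : List Bool, (Fin ((m * R).eval x.length) → Bool) => t.1.length)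
      fun t => (enc (t.1, t.2)).size :=
    bdd_cons (bdd_bits PolyBdd.self fun t => le_rfl) (bdd_coins (PolyBdd.eval (m * R)))
  have h0 := PolyComp.id hw
  have hx : PolyComp (fun t : Σ x : List Bool, (Fin ((m * R).eval x.length) → Bool) => t.1.length)
    (fun t => enc (t.1, t.2)) fun t => enc t.1 := h0.hd
  have hwt : PolyComp
    (fun t : Σ x : List Bool, (Fin ((m * R).eval x.length) → Bool) => t.1.length)
    (fun t => enc (t.1, t.2)) fun t => enc t.2 := h0.tl
  have hl := polyComp_length hx
  have hm := natPoly m hl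
  have hN := natPoly N hl
  have hQ := natConst hw (numProbes q)
  have hL := natConst hw q |>.natAdd ((natPoly A hl).natAdd (natConst hw 1))
  refine PolyComp.cons (((hm.natMul hN).natMul hQ).natMul hL) ?_
  simp only [OperatorModel.sampleCircuit]
  refine PolyComp.congr ?_ fun t => (enc_registerCircuit _).symm
  refine hm.flatMapFin ?_
  have hV1 := polyComp_check V hV (hx.inLoop hm) (hl.inLoop hm) (hwt.inLoop hm) (loopVar hm)
  have hN1 := hN.inLoop hm
  refine hN1.flatMapFin ?_
  have hQ2 := (hQ.inLoop hm).inLoop hN1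
  refine hQ2.flatMapFin ?_
  have hV3 := (hV1.inLoop hN1).inLoop hQ2
  -- The offset of the block in mixed radix, as in `registerEquiv_val`.
  have ho := ((((((loopVar hm).inLoop hN1).inLoop hQ2).natMul ((hN1.inLoop hN1).inLoop hQ2)).natAdd
    ((loopVar hN1).inLoop hQ2)).natMul (hQ2.inLoop hQ2)).natAdd (loopVar hQ2) |>.natMul
      (((hL.inLoop hm).inLoop hN1).inLoop hQ2)
  refine (placeGates (fun t => isPlacement_block (hA _ _) _ _ _)
    (probeGates (c := fun t => t.2) hV3.tl.tl (loopVar hQ2)) ho).congr fun t => ?_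
  rw [enc_list, blockCircuit, List.map_map (g := Gate.relabel _)]
  exact congrArg dlist (congrArg (List.map enc) (List.map_congr_left fun g _ =>
    (Gate.relabel_relabel _ _ g).symm))

end Programs

end

end QHard

/-! ### The Hamiltonian is computable from the outcomes in polynomial time. -/

namespace QHard

open Enc (enc)
open scoped ComplexOrder MatrixOrder

noncomputable section

set_option linter.unusedSectionVars false

open PolyComp

namespace OperatorModel

variable {q : ℕ} {W : ℕ → Type} [∀ n, Enc (W n)] (D : OperatorModel q W)

/-- The names of the basis operators can be computed in polynomial time. -/
structure Computable : Prop where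
  one : ∀ {ι : Type} {n : ι → ℕ} {u : ι → Data} {k : ι → ℕ},
    PolyComp n u (fun a => enc (k a)) → PolyComp n u fun a => enc (D.one (k a))
  el : ∀ {ι : Type} {n : ι → ℕ} {u : ι → Data} {k : ι → ℕ} {S : ∀ a, Fin q ↪o Fin (k a)},
    PolyComp n u (fun a => enc (k a)) → PolyComp n u (fun a => enc (S a)) →
    ∀ w, PolyComp n u fun a => enc (D.el (S a) w)

variable {D}

theorem Computable.estimateTerm (hD : D.Computable) {ι : Type} {n : ι → ℕ} {u : ι → Data}
    {k N : ι → ℕ} {S : ∀ a, Fin q ↪o Fin (k a)} (hk : PolyComp n u fun a => enc (k a))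
    (hS : PolyComp n u fun a => enc (S a)) (hN : PolyComp n u fun a => enc (N a)) (K : ℕ)
    {acc : ∀ a, Fin (N a) → Fin (numProbes q) → Bool}
    (hacc : PolyComp (fun t : Σ _ : Σ a, Fin (N a), Fin (numProbes q) => n t.1.1)
      (fun t => .cons (.cons (u t.1.1) (enc t.1.2)) (enc t.2)) fun t => enc (acc t.1.1 t.1.2 t.2)) :
    PolyComp n u fun a => enc (estimateTerm (D.one (k a)) (D.el (S a)) D.sign K (acc a)) := by
  have hQ := natConst hk.1 (numProbes q)
  have hQ1 := hQ.inLoop hN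
  have hden := (((natConst hk.1 (K + 2)).natMul hN).natMul (natConst hk.1 (2 ^ q))).natSub
    (natConst hk.1 1)
  have hc := loopVar hQ1
  have h1 : PolyComp n u fun a => dlist ((List.finRange (N a)).flatMap fun i =>
      (List.finRange (numProbes q)).map fun c => enc (((if acc a i c then
        -(K * (prepSign (probe c).1 (probe c).2 * D.sign (probe c).1)) else 0,
        (K + 2) * N a * 2 ^ q - 1), D.el (S a) (probe c).1) : Coeff × W (k a))) := by
    refine hN.flatMapFin (hQ1.mapFin ?_)
    refine PolyComp.cons (PolyComp.cons ?_ ((hden.inLoop hN).inLoop hQ1)) ?_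
    · refine (hacc.bool_ite (hc.table fun c => enc
        (-(K * (prepSign (probe c).1 (probe c).2 * D.sign (probe c).1)) : ℤ))
        (const hacc.1 (enc (0 : ℤ)))).congr fun t => ?_
      split_ifs <;> rfl
    -- The operator name depends on the selection as well as on the probe, so it is not a table
    -- entry. Each of the constantly many probes has a program of its own, and the right result is
    -- selected.
    · exact fin_cases (f := fun (t : Σ _ : Σ a, Fin (N a), Fin (numProbes q)) c =>
        enc (D.el (S t.1.1) (probe c).1))
        (fun c => hD.el ((hk.inLoop hN).inLoop hQ1) ((hS.inLoop hN).inLoop hQ1) _) hc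
  refine ((((const hk.1 (enc ((K + 1 : ℕ) : ℤ))).cons (natConst hk.1 (K + 1))).cons
    (hD.one hk)).cons h1).congr fun a => ?_
  rw [QHard.estimateTerm, enc_list, List.map_cons, List.map_flatMap]
  simp only [List.map_map]
  rfl

variable {p R m N A : Polynomial ℕ}
  (V : (x : List Bool) → (Fin (R.eval x.length) → Bool) → QubitCheck (p.eval x.length) q)
  (hV : PolyComp (fun t : Σ x : List Bool, (Fin (R.eval x.length) → Bool) => t.1.length)
    (fun t => enc (t.1, t.2)) fun t => enc (V t.1 t.2)) (K : ℕ)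

include hV in
theorem Computable.post (hD : D.Computable) : PolyComp
    (fun t : Σ t : Σ x : List Bool, (Fin ((m * R).eval x.length) → Bool),
      (Fin (m.eval t.1.length * N.eval t.1.length * numProbes q *
        blockSize q (A.eval t.1.length)) → Bool) => t.1.1.length)
    (fun t => enc (t.1.1, t.1.2, t.2)) fun t => enc (⟨p.eval t.1.1.length,
      D.sampleTerms (coinsOf m R t.1.1) (V t.1.1) K t.1.2 t.2⟩ : Hamiltonian W) := by
  have h0 := PolyComp.id (n := fun t : Σ t : Σ x : List Bool, (Fin ((m * R).eval x.length) → Bool),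
      (Fin (m.eval t.1.length * N.eval t.1.length * numProbes q *
        blockSize q (A.eval t.1.length)) → Bool) => t.1.1.length)
      (u := fun t => enc (t.1.1, t.1.2, t.2))
    (bdd_cons (bdd_bits PolyBdd.self fun _ => le_rfl) (bdd_cons (bdd_coins (PolyBdd.eval (m * R)))
      (bdd_coins ((((PolyBdd.eval m).mul (PolyBdd.eval N)).mul (PolyBdd.const _)).mul
        ((PolyBdd.const _).add ((PolyBdd.eval A).add (PolyBdd.const 1)))))))
  have hx := h0.hd.congr (w := fun t => enc t.1.1) fun _ => rfl
  have hw := h0.tl.hd.congr (w := fun t => enc t.1.2) fun _ => rfl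
  have hy := h0.tl.tl.congr (w := fun t => enc t.2) fun _ => rfl
  have hl := polyComp_length hx
  have hm := natPoly m hl
  have hN := natPoly N hl
  have hp := natPoly p hl
  have hQ := natConst hx.1 (numProbes q)
  have hL := natConst hx.1 q |>.natAdd ((natPoly A hl).natAdd (natConst hx.1 1))
  refine hp.cons ?_
  have hV1 := polyComp_check V hV (hx.inLoop hm) (hl.inLoop hm) (hw.inLoop hm) (loopVar hm)
  have hN1 := hN.inLoop hm
  have hQ2 := (hQ.inLoop hm).inLoop hN1
  -- The offset of the block plus `q`: the first ancilla comes right after the `q` proof qubits.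
  have ho := (((((((loopVar hm).inLoop hN1).inLoop hQ2).natMul ((hN1.inLoop hN1).inLoop hQ2)).natAdd
    ((loopVar hN1).inLoop hQ2)).natMul (hQ2.inLoop hQ2)).natAdd (loopVar hQ2) |>.natMul
      (((hL.inLoop hm).inLoop hN1).inLoop hQ2)).natAdd
      (natConst ((loopVar hQ2).1) q)
  have hj := ho.congr (w := fun t => enc (registerEquiv (m.eval t.1.1.1.1.1.length)
    (N.eval t.1.1.1.1.1.length) (numProbes q) (blockSize q (A.eval t.1.1.1.1.1.length))
      (((t.1.1.2, t.1.2), t.2), acceptPos q _))) fun t => by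
    rw [enc_fin, registerEquiv_val]
    rfl
  have hT := hD.estimateTerm (hp.inLoop hm) hV1.hd hN1 K
    (acc := fun t j c => t.1.2 (registerEquiv _ _ (numProbes q) (blockSize q _)
      (((t.2, j), c), acceptPos q _)))
    (nth (f := fun t => t.1.1.1.2) (((hy.inLoop hm).inLoop hN1).inLoop hQ2) hj)
  refine (hm.mapFin (f := fun t i => enc (QHard.estimateTerm (D.one _)
    (D.el (V t.1.1 (coinsOf m R t.1.1 t.1.2 i)).1) D.sign K fun j c => t.2 (registerEquiv _ _
      (numProbes q) (blockSize q _) (((i, j), c), acceptPos q _)))) hT).congr fun t => ?_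
  rw [sampleTerms, enc_list, List.map_map]
  rfl

end OperatorModel

end

end QHard

/-! ### Choice of parameters, and the reduction. -/

namespace QHard

open Enc (enc)
open scoped ComplexOrder MatrixOrder

noncomputable section

set_option linter.unusedSectionVars false

open PolyComp

theorem Prog.ComputesWithin.mono {P : Prog} {d d' : Data} {t t' : ℕ} (h : P.ComputesWithin d d' t)
    (ht : t ≤ t') : P.ComputesWithin d d' t' := by
  obtain ⟨k, hk, h⟩ := h
  exact ⟨k, hk.trans ht, h⟩

theorem runProb_mono {R : ℕ} (C : (Fin R → Bool) → Σ a, List (Gate (Fin a)))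
    {good good' : (w : Fin R → Bool) → (Fin (C w).1 → Bool) → Prop}
    (h : ∀ w y, good w y → good' w y) : runProb C good ≤ runProb C good' := by
  classical
  refine mul_le_mul_of_nonneg_left (Finset.sum_le_sum fun w _ => Finset.sum_le_sum fun y _ => ?_)
    (by positivity)
  by_cases hg : good w y
  · rw [if_pos hg, if_pos (h w y hg)]
  · rw [if_neg hg]
    split_ifs <;> positivity

namespace OperatorModel

variable {q : ℕ} {W : ℕ → Type} [∀ n, Enc (W n)] {D : OperatorModel q W}

/-- A verifier whose checks are expressed in an operator model yields a quantum reduction. -/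
theorem quantumPolyReduces (hD : D.Computable) {L : PromiseProblem (List Bool)}
    {P : PromiseProblem (Hamiltonian W)} {p R : Polynomial ℕ}
    (V : (x : List Bool) → (Fin (R.eval x.length) → Bool) → QubitCheck (p.eval x.length) q)
    (hV : PolyComp (fun t : Σ x : List Bool, (Fin (R.eval x.length) → Bool) => t.1.length)
      (fun t => enc (t.1, t.2)) fun t => enc (V t.1 t.2))
    (h0 : ∀ x r, 0 ≤ D.effect (V x r)) (h1 : ∀ x r, D.effect (V x r) ≤ 1)
    (hyes : ∀ x ∈ L.yes, ∃ ρ : Op (Fin (p.eval x.length)), IsDensity ρ ∧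
      2 / 3 ≤ 1 / 2 ^ (R.eval x.length) * ∑ r, expect ρ (D.effect (V x r)))
    (hno : ∀ x ∈ L.no, ∀ ρ : Op (Fin (p.eval x.length)), IsDensity ρ →
      1 / 2 ^ (R.eval x.length) * ∑ r, expect ρ (D.effect (V x r)) ≤ 1 / 3)
    {a b : ℝ} (ha : 1 / 3 < a) (hb : b < 2 / 3)
    (loc : ∀ {n : ℕ}, List (List (Coeff × W n)) → Prop)
    (hloc : ∀ {n : ℕ} (H : List (List (Coeff × W n))), (∀ T ∈ H, ∃ S : Fin q ↪o Fin n,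
      ∀ u ∈ T, u.2 = D.one n ∨ ∃ w, u.2 = D.el S w) → loc H)
    (hPyes : ∀ H : Hamiltonian W, loc H.2 → BoundedTerms D.basis 1 H.2 →
      lowestEnergy (hamOp D.basis H.2) ≤ a → H ∈ P.yes)
    (hPno : ∀ H : Hamiltonian W, loc H.2 → BoundedTerms D.basis 1 H.2 →
      b ≤ lowestEnergy (hamOp D.basis H.2) → H ∈ P.no) :
    QuantumPolyReduces L P := by
  -- Half of the smaller of the two gaps, because sampling and estimation each cost one `ε`.
  obtain ⟨ε, hε0, hεa, hεb⟩ : ∃ ε : ℝ, 0 < ε ∧ 1 / 3 + 2 * ε ≤ a ∧ b ≤ 2 / 3 - 2 * ε := by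
    refine ⟨min (a - 1 / 3) (2 / 3 - b) / 2, ?_, ?_, ?_⟩
    · have : 0 < min (a - 1 / 3) (2 / 3 - b) := lt_min (by linarith) (by linarith)
      linarith
    · have := min_le_left (a - 1 / 3) (2 / 3 - b); linarith
    · have := min_le_right (a - 1 / 3) (2 / 3 - b); linarith
  obtain ⟨κ, C, hκ, hC, hsample⟩ := exists_sampling_constants hε0
  obtain ⟨K, hK⟩ := exists_nat_gt (2 / ε)
  have hK' : (0 : ℝ) < K := lt_trans (by positivity) hK
  have hKpos : 0 < K := by exact_mod_cast hK'
  have hKε : 2 / K ≤ ε := by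
    rw [div_lt_iff₀ hε0] at hK
    rw [div_le_iff₀ hK']
    linarith
  obtain ⟨A, hA⟩ := hV.bdd
  -- The verifier writes the number of ancillas in unary, so the size of her output bounds it.
  have hA' : ∀ x r, (V x r).2.1 ≤ A.eval x.length := by
    intro x r
    refine le_trans ?_ (hA ⟨x, r⟩)
    have : (enc (V x r)).size = 1 + (enc (V x r).1).size + (1 + (enc (V x r).2.1).size +
      (enc (V x r).2.2).size) := rfl
    rw [size_enc_nat] at this
    simp only [this]
    omega
  obtain ⟨m, hm⟩ : ∃ m : Polynomial ℕ, ∀ k, m.eval k = C * (κ * (p.eval k + 3)) :=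
    ⟨.C C * (.C κ * (p + .C 3)), fun k => by simp⟩
  obtain ⟨N, hN⟩ : ∃ N : Polynomial ℕ, ∀ k,
      N.eval k = 6 * (8 ^ q * (K ^ 2 * 16 ^ q)) * m.eval k :=
    ⟨.C (6 * (8 ^ q * (K ^ 2 * 16 ^ q))) * m, fun k => by
      rw [Polynomial.eval_mul, Polynomial.eval_C]⟩
  have hmpos : ∀ k, 0 < m.eval k := fun k => by rw [hm]; positivity
  have hprep := polyComp_prep (m := m) (N := N) V hV hA'
  have hpost := hD.post (m := m) (N := N) (A := A) V hV K
  obtain ⟨prep, T₁, hprep⟩ := hprep.computesWithin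
  obtain ⟨post, T₂, hpost⟩ := hpost.computesWithin
  have hL : ∀ x w y, loc (D.sampleTerms (A := A.eval x.length) (N := N.eval x.length)
      (coinsOf m R x) (V x) K w y) := by
    intro x w y
    refine hloc _ fun T hT => ?_
    rw [sampleTerms, List.mem_map] at hT
    obtain ⟨i, -, rfl⟩ := hT
    refine ⟨(V x (coinsOf m R x w i)).1, fun u hu => ?_⟩
    rw [estimateTerm, List.mem_cons] at hu
    rcases hu with rfl | hu
    · exact Or.inl rfl
    · simp only [List.mem_flatMap, List.mem_map] at hu
      obtain ⟨j, -, c, -, rfl⟩ := hu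
      exact Or.inr ⟨_, rfl⟩
  -- The coins of the reduction are `m` independent strings of `R` verifier coins.
  refine ⟨m * R, T₁ + T₂, prep, post,
    fun x => sampleCircuit (coinsOf m R x) (V x) (hA' x) (N.eval x.length),
    fun x w y => ⟨p.eval x.length, D.sampleTerms (coinsOf m R x) (V x) K w y⟩, ?_, ?_, ?_, ?_⟩
  · intro x w
    exact (hprep ⟨x, w⟩).mono (by rw [Polynomial.eval_add]; exact Nat.le_add_right _ _)
  · intro x w y
    exact (hpost ⟨⟨x, w⟩, y⟩).mono (by rw [Polynomial.eval_add]; exact Nat.le_add_left _ _)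
  · intro x hx
    obtain ⟨ρ, hρ, h⟩ := hyes x hx
    refine (D.runProb_yes (coinsOf m R x) (V x) (hA' x) (h0 x) (h1 x) hKpos (hmpos _) (hN _) hKε
      (by rw [hm]; exact (hsample _).1) hρ h).trans (runProb_mono _ fun w y hg => ?_)
    exact hPyes _ (hL x w y) hg.1 (hg.2.trans hεa)
  · intro x hx
    refine (D.runProb_no (coinsOf m R x) (V x) (hA' x) (h0 x) (h1 x) hKpos (hmpos _) (hN _) hKε
      (by rw [hm]; exact (hsample _).1) (hno x hx) (k := κ * (p.eval x.length + 3))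
      (by rw [hm]; exact (hsample _).2)).trans (runProb_mono _ fun w y hg => ?_)
    exact hPno _ (hL x w y) hg.1 (hεb.trans hg.2)

end OperatorModel

end

end QHard

/-! ### The qubit case. -/

namespace QHard

open Enc (enc)
open scoped ComplexOrder MatrixOrder

noncomputable section

set_option linter.unusedSectionVars false

open PolyComp

/-! ## The qubit case -/

/-- For a Hermitian involution, `1 - A` equals half of `(1 - A)* (1 - A)`. -/
theorem le_one_of_involution {κ : Type} [Fintype κ] [DecidableEq κ] {A : Matrix κ κ ℂ}
    (h : A.conjTranspose = A) (h2 : A * A = 1) : A ≤ 1 := by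
  have h1 : 0 ≤ (1 / 2 : ℝ) • ((1 - A).conjTranspose * (1 - A)) :=
    smul_nonneg_matrix (Matrix.nonneg_iff_posSemidef.2
      (Matrix.posSemidef_conjTranspose_mul_self _)) (by norm_num)
  have h3 : (1 / 2 : ℝ) • ((1 - A).conjTranspose * (1 - A)) = 1 - A := by
    rw [Matrix.conjTranspose_sub, Matrix.conjTranspose_one, h, mul_sub, sub_mul, sub_mul, h2,
      one_mul, one_mul, mul_one, show (1 : Matrix κ κ ℂ) - A - (A - 1) = (2 : ℝ) • (1 - A) by
        rw [two_smul]; abel, smul_smul]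
    norm_num
  rwa [h3, sub_nonneg] at h1

theorem neg_one_le_of_involution {κ : Type} [Fintype κ] [DecidableEq κ] {A : Matrix κ κ ℂ}
    (h : A.conjTranspose = A) (h2 : A * A = 1) : -1 ≤ A :=
  neg_le.1 (le_one_of_involution (A := -A) (by rw [Matrix.conjTranspose_neg, h])
    (by rw [neg_mul_neg, h2]))

theorem Pauli.matrix_conjTranspose (P : Pauli) : P.matrix.conjTranspose = P.matrix := by
  ext s t
  cases P <;> cases s <;> cases t <;> simp [Pauli.matrix, Matrix.conjTranspose_apply]

theorem Pauli.matrix_mul_self (P : Pauli) : P.matrix * P.matrix = 1 := by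
  ext s t
  cases P <;> cases s <;> cases t <;> simp [Pauli.matrix, Matrix.mul_apply]

theorem pauliString_conjTranspose {n : ℕ} (w : Fin n → Pauli) :
    (pauliString w).conjTranspose = pauliString w := by
  simp only [pauliString, tensorOp_eq_piOp, piOp_conjTranspose, Pauli.matrix_conjTranspose]

theorem pauliString_mul_self {n : ℕ} (w : Fin n → Pauli) :
    pauliString w * pauliString w = 1 := by
  simp only [pauliString, tensorOp_eq_piOp, piOp_mul, Pauli.matrix_mul_self, piOp_one]

theorem pauliString_I (n : ℕ) : pauliString (fun _ : Fin n => Pauli.I) = 1 :=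
  piOp_one

/-- The Pauli string that acts on the selected qubits as `w` and on the others as the identity. -/
def extendPauli {q n : ℕ} (S : Fin q ↪o Fin n) (w : Fin q → Pauli) : Fin n → Pauli :=
  Function.extend S w fun _ => Pauli.I

theorem embedOp_pauliString {q n : ℕ} (S : Fin q ↪o Fin n) (w : Fin q → Pauli) :
    embedOp S.toEmbedding (pauliString w) = pauliString (extendPauli S w) := by
  have h : ∀ j, extendPauli S w (S j) = w j := fun j => S.injective.extend_apply _ _ _
  rw [pauliString, pauliString, ← embedOp_tensorOp S.toEmbedding]
  · congr 2
    ext j : 1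
    exact congrArg Pauli.matrix (h j).symm
  · intro k hk
    rw [extendPauli, Function.extend_apply' _ _ _ (by simpa using hk)]
    rfl

namespace PolyComp

/-- Look up an element in a selection. -/
theorem lookup {ι : Type} {n : ι → ℕ} {u : ι → Data} {q : ℕ} {k : ι → ℕ}
    {S : ∀ a, Fin q ↪o Fin (k a)} {i : ∀ a, Fin (k a)} (d : Fin q → Data) (d₀ : Data)
    (hS : PolyComp n u fun a => enc (S a)) (hi : PolyComp n u fun a => enc (i a)) :
    PolyComp n u fun a => Function.extend (S a) d (fun _ => d₀) (i a) := by
  classical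
  have key : ∀ l : List (Fin q), PolyComp n u fun a =>
      if ∃ j ∈ l, S a j = i a then Function.extend (S a) d (fun _ => d₀) (i a) else d₀ := by
    intro l
    induction l with
    | nil => exact (const hS.1 d₀).congr fun a => by simp
    | cons j l ih =>
      have hj : PolyComp n u fun a => enc (S a j : ℕ) :=
        nth (k := fun _ => q) (f := fun a j => (S a j : ℕ)) (j := fun _ => j)
          (hS.congr fun a => by rw [enc_orderEmbedding, enc_fun, enc_fun]; rfl)
          (natConst hS.1 j)
      simp only [enc_fin] at hi
      refine ((hj.natEq hi).bool_ite (const hS.1 (d j)) ih).congr fun a => ?_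
      by_cases h : S a j = i a
      · rw [if_pos (by simp [h]), if_pos ⟨j, by simp, h⟩, ← h, (S a).injective.extend_apply]
      · rw [if_neg (by simpa [Fin.ext_iff] using h)]
        congr 1
        simp [h]
  refine (key (List.finRange q)).congr fun a => ?_
  split_ifs with h
  · rfl
  · rw [Function.extend_apply']
    rintro ⟨j, hj⟩
    exact h ⟨j, List.mem_finRange j, hj⟩

end PolyComp

/-- Checks of qubits are expressed by Pauli strings. -/
def qubitModel (q : ℕ) : OperatorModel q fun n => Fin n → Pauli where
  basis := pauliString
  one _ _ := Pauli.I
  basis_one := pauliString_I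
  el := extendPauli
  sign _ := 1
  neg_one_le S w := by
    rw [Int.cast_one, one_smul]
    exact neg_one_le_of_involution (pauliString_conjTranspose _) (pauliString_mul_self _)
  le_one S w := by
    rw [Int.cast_one, one_smul]
    exact le_one_of_involution (pauliString_conjTranspose _) (pauliString_mul_self _)

theorem qubitModel_computable (q : ℕ) : (qubitModel q).Computable where
  one hk := (hk.mapFin (const (loopVar hk).1 (enc Pauli.I))).congr fun a => (enc_fun _).symm
  el {ι n u k S} hk hS w := by
    refine (hk.mapFin (f := fun a i => Function.extend (S a) (fun j => enc (w j))
      (fun _ => enc Pauli.I) i) (lookup (fun j => enc (w j)) (enc Pauli.I) (hS.inLoop hk)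
      (loopVar hk))).congr fun a => ?_
    rw [enc_fun]
    refine congrArg dlist (List.map_congr_left fun i _ => ?_)
    change _ = enc (Function.extend (S a) w (fun _ => Pauli.I) i)
    exact (Function.apply_extend enc (S a) _ i).symm

/-- The Pauli expansion on `q` qubits is carried through the embedding, which sends Pauli strings to
Pauli strings. Estimated coefficients of the small effect are thus coefficients of the large one. -/
theorem qubitModel_effect {n q : ℕ} (V : QubitCheck n q) :
    (qubitModel q).effect V = embedOp V.1.toEmbedding (acceptEffect V.2.2) := by
  conv_rhs => rw [pauli_expansion (acceptEffect V.2.2), map_sum]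
  refine Finset.sum_congr rfl fun w _ => ?_
  rw [map_smul, embedOp_pauliString]
  simp [qubitModel]

theorem quantumPolyReduces_qubit (q : ℕ) {a b : ℝ} (ha : 1 / 3 < a) (hab : a < b) (hb : b < 2 / 3)
    {L : PromiseProblem (List Bool)} (hL : L ∈ QPCP q) :
    QuantumPolyReduces L (qubitLHD q 1 a b hab) := by
  obtain ⟨p, R, time, verifier, V, hV, hyes, hno⟩ := hL
  have heff : ∀ x r (ρ : Op (Fin (p.eval x.length))),
      expect ρ ((qubitModel q).effect (V x r)) = qubitAccept ρ (V x r) := by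
    intro x r ρ
    rw [qubitAccept_eq, qubitModel_effect]
    rfl
  refine OperatorModel.quantumPolyReduces (qubitModel_computable q) V
    (of_computesWithin verifier time (bdd_cons (bdd_bits PolyBdd.self fun _ => le_rfl)
      (bdd_coins (PolyBdd.eval R))) fun t => hV t.1 t.2) ?_ ?_ ?_ ?_ ha hb (QubitLocal q) ?_
    (fun H hl hH hE => ⟨hl, hH, hE⟩) (fun H hl hH hE => ⟨hl, hH, hE⟩)
  · intro x r
    rw [qubitModel_effect]
    exact (posSemidef_map_starAlgHom _ (acceptEffect_posSemidef _)).nonneg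
  · intro x r
    have h := (posSemidef_map_starAlgHom (embedOp (V x r).1.toEmbedding)
      (one_sub_acceptEffect_posSemidef (V x r).2.2)).nonneg
    rw [map_sub, map_one, sub_nonneg] at h
    rw [qubitModel_effect]
    exact h
  · simpa only [heff] using hyes
  · simpa only [heff] using hno
  · intro n H h T hT
    obtain ⟨S, hS⟩ := h T hT
    refine ⟨Finset.univ.map S.toEmbedding, by simp, fun u hu j hj => ?_⟩
    by_contra hjS
    apply hj
    rcases hS u hu with h | ⟨w, h⟩
    · rw [h]; rfl
    · rw [h]
      exact Function.extend_apply' w (fun _ => Pauli.I) j (by simpa using hjS)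

end

end QHard

/-! ### Majorana monomials, Pauli strings and parity. -/

namespace QHard

open Enc (enc)
open scoped ComplexOrder MatrixOrder

noncomputable section

set_option linter.unusedSectionVars false

/-! ## Majorana operators -/

/-- The Pauli matrix that is proportional to a product of two Pauli matrices. -/
def Pauli.mul : Pauli → Pauli → Pauli
  | .I, P => P
  | P, .I => P
  | .X, .X => .I
  | .Y, .Y => .I
  | .Z, .Z => .I
  | .X, .Y => .Z
  | .Y, .X => .Z
  | .Y, .Z => .X
  | .Z, .Y => .X
  | .Z, .X => .Y
  | .X, .Z => .Y

def Pauli.phase : Pauli → Pauli → ℂ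
  | .X, .Y => Complex.I
  | .Y, .X => -Complex.I
  | .Y, .Z => Complex.I
  | .Z, .Y => -Complex.I
  | .Z, .X => Complex.I
  | .X, .Z => -Complex.I
  | _, _ => 1

theorem Pauli.matrix_mul_matrix (P Q : Pauli) :
    P.matrix * Q.matrix = Pauli.phase P Q • (Pauli.mul P Q).matrix := by
  ext s t
  cases P <;> cases Q <;> cases s <;> cases t <;>
    simp [Pauli.matrix, Pauli.phase, Pauli.mul, Matrix.mul_apply]

section PiOp

variable {B X : Type} [Fintype B] [DecidableEq B] [Fintype X]

theorem piOp_smul (c : B → ℂ) (A : B → Matrix X X ℂ) :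
    piOp (fun b => c b • A b) = (∏ b, c b) • piOp A := by
  ext s t
  simp [piOp_apply, Finset.prod_mul_distrib]

theorem piOp_anticommute (A A' : B → Matrix X X ℂ) (i : B) (hi : A i * A' i = -(A' i * A i))
    (h : ∀ j ≠ i, A j * A' j = A' j * A j) : piOp A * piOp A' = -(piOp A' * piOp A) := by
  rw [piOp_mul, piOp_mul]
  have : (fun b => A b * A' b) = fun b => (if b = i then (-1 : ℂ) else 1) • (A' b * A b) := by
    funext b
    by_cases hb : b = i
    · subst hb; simp [hi]
    · simp [hb, h b hb]
  rw [this, piOp_smul]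
  simp

end PiOp

theorem pauliString_mul_pauliString {n : ℕ} (w w' : Fin n → Pauli) :
    pauliString w * pauliString w' =
      (∏ j, Pauli.phase (w j) (w' j)) • pauliString fun j => Pauli.mul (w j) (w' j) := by
  simp only [pauliString, tensorOp_eq_piOp, piOp_mul, Pauli.matrix_mul_matrix, piOp_smul]

section Clifford

variable {κ : Type} [Fintype κ] [DecidableEq κ]

/-- Hermitian operators that square to one and anticommute with each other. -/
structure IsClifford {N : ℕ} (c : Fin N → Matrix κ κ ℂ) : Prop where
  herm : ∀ i, (c i).conjTranspose = c i
  sq : ∀ i, c i * c i = 1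
  anti : ∀ i j, i ≠ j → c i * c j = -(c j * c i)

theorem mul_prod_anticommute (Q : Matrix κ κ ℂ) (l : List (Matrix κ κ ℂ))
    (h : ∀ A ∈ l, Q * A = -(A * Q)) : Q * l.prod = (-1 : ℂ) ^ l.length • (l.prod * Q) := by
  induction l with
  | nil => simp
  | cons A l ih =>
    rw [List.prod_cons, ← mul_assoc, h A (by simp), neg_mul, mul_assoc,
      ih fun A' hA' => h A' (by simp [hA']), List.length_cons, pow_succ]
    simp [mul_assoc]

/-- The adjoint reverses the product. Restoring the order of `l.length` anticommuting factors takes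
`l.length * (l.length - 1) / 2` transpositions; the power of `i` in `C_K` compensates this sign. -/
theorem prod_conjTranspose_of_anticommute (l : List (Matrix κ κ ℂ))
    (hh : ∀ A ∈ l, A.conjTranspose = A) (h : l.Pairwise fun A A' => A * A' = -(A' * A)) :
    l.prod.conjTranspose = (-1 : ℂ) ^ (l.length * (l.length - 1) / 2) • l.prod := by
  induction l with
  | nil => simp
  | cons A l ih =>
    rw [List.pairwise_cons] at h
    rw [List.prod_cons, Matrix.conjTranspose_mul, ih (fun A' hA' => hh A' (by simp [hA'])) h.2,
      hh A (by simp), mul_prod_anticommute A l h.1, smul_mul_assoc, smul_smul, List.length_cons]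
    have e : (l.length + 1) * (l.length + 1 - 1) / 2 =
        l.length * (l.length - 1) / 2 + l.length := by
      rw [← Finset.sum_range_id, ← Finset.sum_range_id, Finset.sum_range_succ]
    rw [e, pow_add, mul_assoc, ← mul_pow]
    simp

theorem prod_conjTranspose_mul_prod (l : List (Matrix κ κ ℂ))
    (h : ∀ A ∈ l, A.conjTranspose * A = 1) : l.prod.conjTranspose * l.prod = 1 := by
  induction l with
  | nil => simp
  | cons A l ih =>
    rw [List.prod_cons, Matrix.conjTranspose_mul, mul_assoc, ← mul_assoc _ A, h A (by simp),
      one_mul, ih fun A' hA' => h A' (by simp [hA'])]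

theorem prod_map_ite_mem {N : ℕ} (c : Fin N → Matrix κ κ ℂ) (K : Finset (Fin N))
    (l : List (Fin N)) : (l.map fun j => if j ∈ K then c j else 1).prod =
      ((l.filter (· ∈ K)).map c).prod := by
  induction l with
  | nil => simp
  | cons j l ih => by_cases h : j ∈ K <;> simp [h, ih]

theorem length_filter_finRange {N : ℕ} (K : Finset (Fin N)) :
    ((List.finRange N).filter (· ∈ K)).length = K.card := by
  have h : ((List.finRange N).filter (· ∈ K)).toFinset = K := by ext; simp
  rw [← h, List.toFinset_card_of_nodup ((List.nodup_finRange N).filter _), h]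

end Clifford

section Monomial

variable {n N : ℕ} {c : Fin N → Op (Fin n)}

theorem majoranaMonomial_eq (K : Finset (Fin N)) : majoranaMonomial c K =
    Complex.I ^ (K.card * (K.card - 1) / 2) •
      (((List.finRange N).filter (· ∈ K)).map c).prod := by
  rw [majoranaMonomial, prod_map_ite_mem]

theorem majoranaMonomial_empty : majoranaMonomial c ∅ = 1 := by
  simp [majoranaMonomial_eq]

theorem IsClifford.monomial_conjTranspose (hc : IsClifford c) (K : Finset (Fin N)) :
    (majoranaMonomial c K).conjTranspose = majoranaMonomial c K := by
  rw [majoranaMonomial_eq, Matrix.conjTranspose_smul, prod_conjTranspose_of_anticommute,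
    List.length_map, length_filter_finRange, smul_smul]
  · congr 1
    rw [star_pow, ← mul_pow]
    simp
  · intro A hA
    rw [List.mem_map] at hA
    obtain ⟨i, -, rfl⟩ := hA
    exact hc.herm i
  · rw [List.pairwise_map]
    exact ((List.nodup_finRange N).filter _).imp fun h => hc.anti _ _ h

theorem IsClifford.monomial_mul_self (hc : IsClifford c) (K : Finset (Fin N)) :
    majoranaMonomial c K * majoranaMonomial c K = 1 := by
  nth_rw 1 [← hc.monomial_conjTranspose K]
  rw [majoranaMonomial_eq, Matrix.conjTranspose_smul, smul_mul_smul_comm,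
    prod_conjTranspose_mul_prod, star_pow, ← mul_pow]
  · simp
  · intro A hA
    rw [List.mem_map] at hA
    obtain ⟨i, -, rfl⟩ := hA
    rw [hc.herm, hc.sq]

theorem IsClifford.commute_monomial {Q : Op (Fin n)} (hQ : ∀ i, Q * c i = -(c i * Q))
    (K : Finset (Fin N)) : Q * majoranaMonomial c K =
      (-1 : ℂ) ^ K.card • (majoranaMonomial c K * Q) := by
  rw [majoranaMonomial_eq, mul_smul_comm, mul_prod_anticommute, List.length_map,
    length_filter_finRange, smul_mul_assoc, smul_comm]
  intro A hA
  rw [List.mem_map] at hA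
  obtain ⟨i, -, rfl⟩ := hA
  exact hQ i

/-- Multiplication by a generator changes a monomial into a monomial, up to a sign. -/
theorem IsClifford.mul_prod_ite (hc : IsClifford c) (K : Finset (Fin N)) (i : Fin N)
    (l : List (Fin N)) (hl : l.Nodup) (hi : i ∈ l) : ∃ z : ℂ,
    c i * (l.map fun j => if j ∈ K then c j else 1).prod =
      z • (l.map fun j => if j ∈ symmDiff K {i} then c j else 1).prod := by
  induction l with
  | nil => simp at hi
  | cons a l ih =>
    rw [List.nodup_cons] at hl
    rw [List.map_cons, List.prod_cons, List.map_cons, List.prod_cons]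
    by_cases hai : a = i
    · subst hai
      refine ⟨1, ?_⟩
      have h1 : (l.map fun j => if j ∈ symmDiff K {a} then c j else 1) =
          l.map fun j => if j ∈ K then c j else 1 := by
        refine List.map_congr_left fun j hj => ?_
        have : j ≠ a := fun h => hl.1 (h ▸ hj)
        simp [Finset.mem_symmDiff, this]
      rw [h1, one_smul, ← mul_assoc]
      congr 1
      by_cases ha : a ∈ K <;> simp [Finset.mem_symmDiff, ha, hc.sq]
    · obtain ⟨z, hz⟩ := ih hl.2 (by simpa [Ne.symm hai] using hi)
      have h1 : (a ∈ symmDiff K {i}) = (a ∈ K) := by simp [Finset.mem_symmDiff, hai]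
      simp only [h1]
      by_cases ha : a ∈ K
      · refine ⟨-z, ?_⟩
        rw [if_pos ha, ← mul_assoc, hc.anti _ _ (Ne.symm hai), neg_mul, mul_assoc, hz,
          mul_smul_comm, neg_smul]
      · exact ⟨z, by rw [if_neg ha, one_mul, one_mul, hz]⟩

theorem IsClifford.mul_monomial (hc : IsClifford c) (K : Finset (Fin N)) (i : Fin N) :
    ∃ (K' : Finset (Fin N)) (z : ℂ), c i * majoranaMonomial c K = z • majoranaMonomial c K' := by
  obtain ⟨z, hz⟩ := hc.mul_prod_ite K i (List.finRange N) (List.nodup_finRange N)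
    (List.mem_finRange i)
  refine ⟨symmDiff K {i}, Complex.I ^ (K.card * (K.card - 1) / 2) * z *
    (Complex.I ^ ((symmDiff K {i}).card * ((symmDiff K {i}).card - 1) / 2))⁻¹, ?_⟩
  rw [majoranaMonomial, mul_smul_comm, hz, majoranaMonomial, smul_smul, smul_smul,
    inv_mul_cancel_right₀ (pow_ne_zero _ Complex.I_ne_zero)]

end Monomial

section Majorana

variable {n : ℕ}

/-- The Pauli matrices of a Majorana operator. -/
def majoranaLetters (j : Fin n) (b : Fin 2) : Fin n → Pauli := fun l =>
  if l < j then .Z else if l = j then (if b = 0 then .X else .Y) else .I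

theorem modeMajorana_eq (j : Fin n) (b : Fin 2) :
    modeMajorana j b = pauliString (majoranaLetters j b) := by
  rw [modeMajorana, pauliString]
  congr 1
  funext l
  rw [majoranaLetters]
  split_ifs <;> rfl

/-- Exactly one tensor factor anticommutes, the one at the smaller mode: there `X` or `Y` meets the
string letter `Z`, or, if the modes agree, `X` meets `Y`. -/
theorem modeMajorana_anticommute {j j' : Fin n} {b b' : Fin 2} (h : (j, b) ≠ (j', b')) :
    modeMajorana j b * modeMajorana j' b' = -(modeMajorana j' b' * modeMajorana j b) := by
  wlog hle : j ≤ j' generalizing j j' b b'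
  · rw [this h.symm (le_of_not_ge hle), neg_neg]
  rw [modeMajorana_eq, modeMajorana_eq]
  refine piOp_anticommute _ _ j ?_ fun l hl => ?_
  · rcases hle.lt_or_eq with hlt | rfl
    · simp only [majoranaLetters, lt_irrefl, if_false, if_true, hlt]
      split_ifs <;> simp [Pauli.matrix_mul_matrix, Pauli.phase, Pauli.mul]
    · have hb : b ≠ b' := fun hb => h (by rw [hb])
      simp only [majoranaLetters, lt_irrefl, if_false, if_true]
      fin_cases b <;> fin_cases b' <;>
        first
          | exact absurd rfl hb
          | simp [Pauli.matrix_mul_matrix, Pauli.phase, Pauli.mul]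
  · simp only [majoranaLetters, hl, if_false]
    by_cases h1 : l < j
    · simp [h1, h1.trans_le hle]
    · simp [h1, Pauli.matrix]

theorem majorana_isClifford (n : ℕ) : IsClifford (majorana n) where
  herm i := by rw [majorana, modeMajorana_eq, pauliString_conjTranspose]
  sq i := by rw [majorana, modeMajorana_eq, pauliString_mul_self]
  anti i j h := modeMajorana_anticommute fun e => h (finProdFinEquiv.symm.injective e)

/-- The parity operator. -/
def parityOp (n : ℕ) : Op (Fin n) := pauliString fun _ => Pauli.Z

theorem parityOp_mul_self (n : ℕ) : parityOp n * parityOp n = 1 := pauliString_mul_self _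

theorem parityOp_conjTranspose (n : ℕ) : (parityOp n).conjTranspose = parityOp n :=
  pauliString_conjTranspose _

theorem parityOp_mul_majorana (i : Fin (n * 2)) :
    parityOp n * majorana n i = -(majorana n i * parityOp n) := by
  rw [majorana, modeMajorana_eq]
  refine piOp_anticommute _ _ i.divNat ?_ fun l hl => ?_
  · simp only [majoranaLetters, lt_irrefl, if_false, if_true]
    split_ifs <;> simp [Pauli.matrix_mul_matrix, Pauli.phase, Pauli.mul]
  · simp only [majoranaLetters, hl, if_false]
    split_ifs <;> simp [Pauli.matrix]

theorem parityOp_mul_monomial (K : Finset (Fin (n * 2))) :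
    parityOp n * majoranaMonomial (majorana n) K =
      (-1 : ℂ) ^ K.card • (majoranaMonomial (majorana n) K * parityOp n) :=
  IsClifford.commute_monomial parityOp_mul_majorana K

theorem majorana_finProdFinEquiv (j : Fin n) (b : Fin 2) :
    majorana n (finProdFinEquiv (j, b)) = modeMajorana j b := by
  have h := finProdFinEquiv.symm_apply_apply (j, b)
  exact congrArg₂ modeMajorana (congrArg Prod.fst h) (congrArg Prod.snd h)

/-- Letters are peeled off from the last mode downwards. Multiplication by a Majorana operator of
that mode removes an `X` or a `Y`, and its string only alters earlier letters. A `Z` takes both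
operators of the mode. -/
theorem exists_smul_monomial_aux (k : ℕ) (w : Fin n → Pauli) (hw : ∀ j, k ≤ j.val → w j = .I) :
    ∃ (K : Finset (Fin (n * 2))) (z : ℂ), pauliString w = z • majoranaMonomial (majorana n) K := by
  induction k generalizing w with
  | zero =>
    refine ⟨∅, 1, ?_⟩
    rw [majoranaMonomial_empty, one_smul, ← pauliString_I]
    congr 1
    funext j
    exact hw j (Nat.zero_le _)
  | succ k ih =>
    by_cases hk : k < n
    swap
    · exact ih w fun j hj => absurd j.2 (by omega)
    set j : Fin n := ⟨k, hk⟩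
    have step : ∀ (b : Fin 2) (w : Fin n → Pauli), (∃ (K : Finset (Fin (n * 2))) (z : ℂ),
        pauliString (fun l => Pauli.mul (majoranaLetters j b l) (w l)) =
          z • majoranaMonomial (majorana n) K) → ∃ (K : Finset (Fin (n * 2))) (z : ℂ),
        pauliString w = z • majoranaMonomial (majorana n) K := by
      rintro b w ⟨K, z, h⟩
      obtain ⟨K', z', h'⟩ := (majorana_isClifford n).mul_monomial K (finProdFinEquiv (j, b))
      rw [majorana_finProdFinEquiv] at h'
      have h1 := pauliString_mul_pauliString (majoranaLetters j b) w
      rw [h, ← modeMajorana_eq] at h1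
      have h2 : pauliString w = modeMajorana j b * (modeMajorana j b * pauliString w) := by
        rw [← mul_assoc, modeMajorana_eq, pauliString_mul_self, one_mul]
      rw [h1, mul_smul_comm, mul_smul_comm, h', smul_smul, smul_smul] at h2
      exact ⟨K', _, h2⟩
    have hgt : ∀ (b : Fin 2) (l : Fin n), k + 1 ≤ l.val → majoranaLetters j b l = .I := by
      intro b l hl
      rw [majoranaLetters, if_neg, if_neg]
      · intro h; rw [h] at hl; simp [j] at hl
      · intro h; have : l.val < k := h; omega
    have hX : ∀ w : Fin n → Pauli, (∀ j, k + 1 ≤ j.val → w j = .I) → w j = .I →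
        ∃ (K : Finset (Fin (n * 2))) (z : ℂ),
          pauliString w = z • majoranaMonomial (majorana n) K := by
      intro w hw h
      refine ih w fun l hl => ?_
      rcases hl.lt_or_eq with hl | hl
      · exact hw l hl
      · rw [← h]; congr 1; exact Fin.ext hl.symm
    have single : ∀ (b : Fin 2) (w : Fin n → Pauli), (∀ j, k + 1 ≤ j.val → w j = .I) →
        w j = (if b = 0 then .X else .Y) → ∃ (K : Finset (Fin (n * 2))) (z : ℂ),
          pauliString w = z • majoranaMonomial (majorana n) K := by
      intro b w hw h
      refine step b w (hX _ (fun l hl => ?_) ?_)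
      · rw [hgt b l hl, hw l hl]; rfl
      · simp only [majoranaLetters, lt_irrefl, if_false, if_true, h]
        split_ifs <;> rfl
    cases h : w j with
    | I => exact hX w hw h
    | X => exact single 0 w hw h
    | Y => exact single 1 w hw h
    | Z =>
      refine step 0 w (single 1 _ (fun l hl => ?_) ?_)
      · rw [hgt 0 l hl, hw l hl]; rfl
      · simp only [majoranaLetters, lt_irrefl, if_false, if_true, h]; rfl

/-- Comparing squares gives `z² = 1`. This removes the need to track phases in the translation
between strings and monomials. -/
theorem eq_or_eq_neg_of_involution {κ : Type} [Fintype κ] [DecidableEq κ] [Nonempty κ]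
    {A A' : Matrix κ κ ℂ} (hA : A * A = 1) (hA' : A' * A' = 1) {z : ℂ} (h : A = z • A') :
    A = A' ∨ A = -A' := by
  rw [h, smul_mul_smul_comm, hA'] at hA
  have hz : z * z = 1 := by
    have := congrFun (congrFun hA (Classical.arbitrary κ)) (Classical.arbitrary κ)
    simpa using this
  rcases mul_self_eq_one_iff.1 hz with rfl | rfl
  · exact Or.inl (by rw [h, one_smul])
  · exact Or.inr (by rw [h, neg_one_smul])

/-- Every Pauli string is a monomial of Majorana operators, up to the sign. -/
theorem exists_monomial_eq (w : Fin n → Pauli) : ∃ K : Finset (Fin (n * 2)),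
    pauliString w = majoranaMonomial (majorana n) K ∨
      pauliString w = -majoranaMonomial (majorana n) K := by
  obtain ⟨K, z, h⟩ := exists_smul_monomial_aux n w fun j hj => absurd j.2 (by omega)
  exact ⟨K, eq_or_eq_neg_of_involution (pauliString_mul_self w)
    ((majorana_isClifford n).monomial_mul_self K) h⟩

theorem exists_smul_pauliString (l : List (Fin (n * 2))) : ∃ (w : Fin n → Pauli) (z : ℂ),
    (l.map (majorana n)).prod = z • pauliString w := by
  induction l with
  | nil => exact ⟨fun _ => .I, 1, by rw [pauliString_I]; simp⟩
  | cons i l ih =>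
    obtain ⟨w, z, h⟩ := ih
    refine ⟨fun j => Pauli.mul (majoranaLetters i.divNat i.modNat j) (w j),
      z * ∏ j, Pauli.phase (majoranaLetters i.divNat i.modNat j) (w j), ?_⟩
    rw [List.map_cons, List.prod_cons, h, majorana, modeMajorana_eq, mul_smul_comm,
      pauliString_mul_pauliString, smul_smul]

theorem exists_pauliString_eq (K : Finset (Fin (n * 2))) : ∃ w : Fin n → Pauli,
    majoranaMonomial (majorana n) K = pauliString w ∨
      majoranaMonomial (majorana n) K = -pauliString w := by
  obtain ⟨w, z, h⟩ := exists_smul_pauliString ((List.finRange (n * 2)).filter (· ∈ K))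
  refine ⟨w, eq_or_eq_neg_of_involution ((majorana_isClifford n).monomial_mul_self K)
    (pauliString_mul_self w)
    (z := Complex.I ^ (K.card * (K.card - 1) / 2) * z) ?_⟩
  rw [majoranaMonomial_eq, h, smul_smul]

/-- Operators that commute with the parity have no odd components. -/
theorem trace_mul_monomial_eq_zero {A : Op (Fin n)} (hA : parityOp n * A = A * parityOp n)
    {K : Finset (Fin (n * 2))} (hK : ¬ Even K.card) :
    (A * majoranaMonomial (majorana n) K).trace = 0 := by
  set C := majoranaMonomial (majorana n) K
  have h := parityOp_mul_monomial K
  rw [(Nat.not_even_iff_odd.1 hK).neg_one_pow, neg_one_smul] at h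
  have h1 : (A * C).trace = -(A * C).trace := by
    calc (A * C).trace = (A * C * (parityOp n * parityOp n)).trace := by
          rw [parityOp_mul_self, mul_one]
      _ = (parityOp n * (A * C * parityOp n)).trace := by
          rw [Matrix.trace_mul_comm (parityOp n), mul_assoc, mul_assoc, mul_assoc]
      _ = (A * (parityOp n * C) * parityOp n).trace := by
          rw [mul_assoc A C, ← mul_assoc, hA]; simp only [mul_assoc]
      _ = -(A * C).trace := by
          rw [h, mul_neg, neg_mul, Matrix.trace_neg, ← mul_assoc, mul_assoc, parityOp_mul_self,
            mul_one]
  exact self_eq_neg.1 h1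

/-- Operators that commute with the parity are even polynomials in the Majorana operators. -/
theorem mem_span_even {A : Op (Fin n)} (hA : parityOp n * A = A * parityOp n) :
    A ∈ Submodule.span ℂ {A | ∃ K : Finset (Fin (n * 2)), Even K.card ∧
      A = majoranaMonomial (majorana n) K} := by
  rw [pauli_expansion A]
  refine Submodule.sum_mem _ fun w _ => ?_
  obtain ⟨K, hK⟩ := exists_monomial_eq w
  by_cases he : Even K.card
  · refine Submodule.smul_mem _ _ ?_
    rcases hK with h | h
    · exact Submodule.subset_span ⟨K, he, h⟩
    · rw [h]
      exact Submodule.neg_mem _ (Submodule.subset_span ⟨K, he, rfl⟩)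
  · have h0 : (A * pauliString w).trace = 0 := by
      rcases hK with h | h
      · rw [h, trace_mul_monomial_eq_zero hA he]
      · rw [h, mul_neg, Matrix.trace_neg, trace_mul_monomial_eq_zero hA he, neg_zero]
    rw [h0, mul_zero, zero_smul]
    exact Submodule.zero_mem _

end Majorana

end

end QHard

/-! ### Compiling fermionic gates into qubit gates. -/

namespace QHard

open Enc (enc)
open scoped ComplexOrder MatrixOrder

noncomputable section

set_option linter.unusedSectionVars false

/-! ## Circuits for the fermionic gates -/

section Embed

variable {ι κ μ : Type} [Fintype ι] [DecidableEq ι] [Fintype κ] [DecidableEq κ] [Fintype μ]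
  [DecidableEq μ]

theorem embedOp_embedOp (f : ι ↪ κ) (g : κ ↪ μ) (A : Op ι) :
    embedOp g (embedOp f A) = embedOp (f.trans g) A := by
  ext s t
  rw [embedOp_apply, embedOp_apply, embedOp_apply, mul_assoc, ite_zero_mul_ite_zero, one_mul]
  congr 1
  refine if_congr ⟨?_, ?_⟩ rfl rfl
  · rintro ⟨h1, h2⟩ l hl
    by_cases hg : l ∈ Set.range g
    · obtain ⟨k, rfl⟩ := hg
      exact h1 k fun ⟨i, hi⟩ => hl ⟨i, congrArg g hi⟩
    · exact h2 l hg
  · intro h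
    refine ⟨fun k hk => h (g k) ?_, fun l hl => h l ?_⟩
    · rintro ⟨i, hi⟩
      exact hk ⟨i, g.injective hi⟩
    · rintro ⟨i, hi⟩
      exact hl ⟨f i, hi⟩

theorem onQubit_apply (A : Matrix Bool Bool ℂ) (i : ι) (s t : ι → Bool) :
    onQubit A i s t = A (s i) (t i) * if ∀ j ≠ i, s j = t j then 1 else 0 := by
  rw [onQubit, tensorOp_eq_piOp, piOp_apply, Fintype.prod_eq_mul_prod_compl i,
    Function.update_self]
  congr 1
  rw [Finset.prod_congr rfl (g := fun j => if s j = t j then (1 : ℂ) else 0) fun j hj => by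
    rw [Function.update_of_ne (by simpa using hj), Matrix.one_apply], Finset.prod_ite_zero]
  simp

theorem onQubit_mul_tensorOp_mul (U U' : Matrix Bool Bool ℂ) (i : ι)
    (A : ι → Matrix Bool Bool ℂ) : onQubit U i * tensorOp A * onQubit U' i =
      if U * U' = 1 then tensorOp (Function.update A i (U * A i * U')) else
        onQubit U i * tensorOp A * onQubit U' i := by
  split_ifs with h
  · simp only [onQubit, tensorOp_eq_piOp, piOp_mul]
    congr 1
    funext j
    by_cases hj : j = i
    · subst hj; simp
    · simp [hj]
  · rfl

theorem circuitOp_hadamard (i : ι) :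
    circuitOp [Gate.hadamard i] = onQubit hadamardMatrix i := by
  rw [circuitOp, circuitOp, one_mul]
  rfl

theorem circuitOp_tGates (i : ι) (k : ℕ) :
    circuitOp (List.replicate k (Gate.tGate i)) = onQubit (tMatrix ^ k) i := by
  induction k with
  | zero => simp [circuitOp, onQubit_one]
  | succ k ih =>
    rw [List.replicate_succ, circuitOp, ih, pow_succ, ← onQubit_mul]
    rfl

/-- A rotation by the angle `π / 4` that is generated by an involution. -/
def rotOp (A : Op ι) : Op ι :=
  (Real.cos (Real.pi / 8) : ℂ) • 1 + (Complex.I * Real.sin (Real.pi / 8)) • A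

/-- The rotation generated by `A` is given by a circuit, up to a phase. -/
def Implementable (A : Op ι) : Prop :=
  ∃ (L : List (Gate ι)) (c : ℂ), star c * c = 1 ∧ circuitOp L = c • rotOp A

/-- A conjugated rotation is the rotation generated by the conjugated operator, since both terms of
`rotOp` transform by conjugation. -/
theorem Implementable.conj {A : Op ι} (hA : Implementable A) {L L' : List (Gate ι)}
    (h : circuitOp L * circuitOp L' = 1) :
    Implementable (circuitOp L * A * circuitOp L') := by
  obtain ⟨M, c, hc, hM⟩ := hA
  refine ⟨L' ++ M ++ L, c, hc, ?_⟩
  rw [circuitOp_append, circuitOp_append, hM, rotOp, rotOp]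
  simp only [mul_add, add_mul, smul_add, mul_smul_comm, smul_mul_assoc, one_mul, h, mul_assoc]

theorem Implementable.local_conj {A : ι → Matrix Bool Bool ℂ} (hA : Implementable (tensorOp A))
    {L L' : List (Gate ι)} {U U' B : Matrix Bool Bool ℂ} {i : ι} (hL : circuitOp L = onQubit U i)
    (hL' : circuitOp L' = onQubit U' i) (hU : U * U' = 1) (hB : U * A i * U' = B) :
    Implementable (tensorOp (Function.update A i B)) := by
  have h := hA.conj (L := L) (L' := L') (by rw [hL, hL', onQubit_mul, hU, onQubit_one])
  rwa [hL, hL', onQubit_mul_tensorOp_mul, if_pos hU, hB] at h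

theorem circuitOp_pauliX (i : ι) : circuitOp ([Gate.hadamard i] ++
    (List.replicate 4 (Gate.tGate i) ++ [Gate.hadamard i])) = onQubit Pauli.X.matrix i := by
  rw [circuitOp_append, circuitOp_append, circuitOp_hadamard, circuitOp_tGates, onQubit_mul,
    onQubit_mul, show tMatrix ^ 4 = tMatrix * tMatrix * (tMatrix * tMatrix) by
      simp only [pow_succ, pow_zero, one_mul, mul_assoc], tMatrix_pow_four, hadamard_conj_Z]

/-- Conjugation by `X` on qubit `i` reverses the sign of the factor `Z`. -/
theorem Implementable.neg {A : ι → Matrix Bool Bool ℂ} {i : ι} (hi : A i = Pauli.Z.matrix) {z : ℂ}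
    (hA : Implementable (z • tensorOp A)) : Implementable (-(z • tensorOp A)) := by
  have hX := Pauli.matrix_mul_self .X
  have h := hA.conj (L := [Gate.hadamard i] ++
    (List.replicate 4 (Gate.tGate i) ++ [Gate.hadamard i])) (L' := [Gate.hadamard i] ++
    (List.replicate 4 (Gate.tGate i) ++ [Gate.hadamard i]))
    (by rw [circuitOp_pauliX, onQubit_mul, hX, onQubit_one])
  rw [circuitOp_pauliX, mul_smul_comm, smul_mul_assoc, onQubit_mul_tensorOp_mul, if_pos hX, hi]
    at h
  convert h using 1
  rw [← smul_neg]
  congr 1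
  have h1 : Pauli.X.matrix * Pauli.Z.matrix * Pauli.X.matrix = (-1 : ℂ) • Pauli.Z.matrix := by
    ext s t
    cases s <;> cases t <;> simp [Pauli.matrix, Matrix.mul_apply]
  have h2 : Function.update A i ((-1 : ℂ) • Pauli.Z.matrix) =
      fun j => (if j = i then (-1 : ℂ) else 1) • A j := by
    funext j
    by_cases hj : j = i
    · subst hj; simp [hi]
    · simp [hj]
  rw [h1, h2, tensorOp_eq_piOp, tensorOp_eq_piOp, piOp_smul]
  simp

/-- The gate `T` equals `exp (i π / 8)` times this rotation; it is the only source of the angle. -/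
theorem implementable_neg_Z (i : ι) : Implementable (-onQubit Pauli.Z.matrix i) := by
  have e1 : Complex.exp (Complex.I * Real.pi / 4) =
      Complex.exp (Complex.I * (Real.pi / 8 : ℝ)) * Complex.exp (Complex.I * (Real.pi / 8 : ℝ)) := by
    rw [← Complex.exp_add]
    congr 1
    push_cast
    ring
  have e2 : Complex.exp (Complex.I * (Real.pi / 8 : ℝ)) =
      Real.cos (Real.pi / 8) + Complex.I * Real.sin (Real.pi / 8) := by
    rw [mul_comm, Complex.exp_mul_I, Complex.ofReal_cos, Complex.ofReal_sin, mul_comm Complex.I]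
  have hxy := Real.cos_sq_add_sin_sq (Real.pi / 8)
  simp only [Implementable, rotOp]
  generalize Real.cos (Real.pi / 8) = x at *
  generalize Real.sin (Real.pi / 8) = y at *
  have hcd : (x : ℂ) * x + y * y = 1 := by
    rw [← pow_two, ← pow_two]
    exact_mod_cast hxy
  have hI : Complex.I * Complex.I = -1 := Complex.I_mul_I
  refine ⟨[Gate.tGate i], x + Complex.I * y, ?_, ?_⟩
  · have : star (x + Complex.I * y : ℂ) = x - Complex.I * y := by
      simp [sub_eq_add_neg]
    rw [this]
    linear_combination hcd - (y : ℂ) * y * hI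
  · ext s t
    have h := circuitOp_tGates i 1
    rw [List.replicate_one, pow_one] at h
    rw [h, onQubit_apply]
    simp only [Matrix.smul_apply, Matrix.add_apply, Matrix.neg_apply, onQubit_apply, smul_eq_mul,
      Matrix.one_apply, tMatrix, Pauli.matrix, Matrix.diagonal_apply]
    rw [e1, e2]
    by_cases hst : s = t
    · subst hst
      cases s i
      · simp
        linear_combination (-1 : ℂ) * hcd + (y : ℂ) * y * hI
      · simp
    · have : ¬(s i = t i ∧ ∀ j ≠ i, s j = t j) := by
        rintro ⟨h1, h2⟩
        refine hst (funext fun j => ?_)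
        by_cases hj : j = i
        · rw [hj, h1]
        · exact h2 j hj
      by_cases h1 : s i = t i
      · rw [if_neg fun h2 => this ⟨h1, h2⟩]
        simp [hst]
      · simp [hst, h1]

/-- Conjugation by a CNOT spreads a `Z` on the target to the control. -/
theorem cnot_conj_tensorOp (j z : ι) (h : j ≠ z) (A : ι → Matrix Bool Bool ℂ) (hj : A j = 1)
    (hz : A z = Pauli.Z.matrix) : (Gate.cnot j z h).op * tensorOp A * (Gate.cnot j z h).op =
      tensorOp (Function.update A j Pauli.Z.matrix) := by
  set f : (ι → Bool) → ι → Bool := fun u => Function.update u z (xor (u z) (u j))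
  have hff : ∀ u, f (f u) = u := by
    intro u
    simp [f, h]
  have hl : ∀ M : Op ι, ∀ s t, ((Gate.cnot j z h).op * M) s t = M (f s) t := by
    intro M s t
    rw [Matrix.mul_apply, Finset.sum_eq_single (f s)]
    · simp only [Gate.op, Matrix.of_apply]
      rw [if_pos (hff s).symm, one_mul]
    · intro u _ hu
      simp only [Gate.op, Matrix.of_apply]
      rw [if_neg, zero_mul]
      intro e
      exact hu (by rw [e]; exact (hff u).symm)
    · simp
  have hr : ∀ M : Op ι, ∀ s t, (M * (Gate.cnot j z h).op) s t = M s (f t) := by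
    intro M s t
    rw [Matrix.mul_apply, Finset.sum_eq_single (f t)]
    · simp only [Gate.op, Matrix.of_apply]
      rw [if_pos rfl, mul_one]
    · intro u _ hu
      simp only [Gate.op, Matrix.of_apply]
      rw [if_neg hu, mul_zero]
    · simp
  ext s t
  rw [hr, hl, tensorOp_eq_piOp, tensorOp_eq_piOp, piOp_apply, piOp_apply,
    ← Finset.mul_prod_erase _ _ (Finset.mem_univ j), ← Finset.mul_prod_erase _ _
      (show z ∈ Finset.univ.erase j by simp [Ne.symm h]),
    ← Finset.mul_prod_erase Finset.univ _ (Finset.mem_univ j), ← Finset.mul_prod_erase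
      (Finset.univ.erase j) _ (show z ∈ Finset.univ.erase j by simp [Ne.symm h]),
    ← mul_assoc, ← mul_assoc]
  congr 1
  · simp only [f, hj, hz, Function.update_self, Function.update_of_ne h,
      Function.update_of_ne (Ne.symm h)]
    cases s j <;> cases s z <;> cases t j <;> cases t z <;> simp [Pauli.matrix]
  · refine Finset.prod_congr rfl fun l hl => ?_
    simp only [Finset.mem_erase, Finset.mem_univ, and_true] at hl
    simp only [f, Function.update_of_ne hl.1, Function.update_of_ne hl.2]

end Embed

section Rotations

variable {q : ℕ}

/-- The factors of a Pauli string on `q` qubits together with `Z` on one ancilla. -/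
def withZ (w : Fin q → Pauli) : Fin q ⊕ Fin 1 → Matrix Bool Bool ℂ :=
  Sum.elim (fun j => (w j).matrix) fun _ => Pauli.Z.matrix

theorem update_withZ (w : Fin q → Pauli) (j : Fin q) (P : Pauli) :
    Function.update (withZ w) (Sum.inl j) P.matrix = withZ (Function.update w j P) := by
  funext l
  rcases l with l | l
  · by_cases h : l = j
    · subst h; simp [withZ]
    · simp [withZ, h]
  · simp [withZ]

/-- All these generators are Clifford conjugates of `Z` on the ancilla. The support grows by one
qubit at a time: a CNOT adds the letter `Z`, a Hadamard gate turns it into `X`, and `T²` turns that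
into `Y`. -/
theorem implementable_withZ (w : Fin q → Pauli) : Implementable (tensorOp (withZ w)) := by
  suffices H : ∀ (s : Finset (Fin q)) (w : Fin q → Pauli), (∀ j ∉ s, w j = .I) →
      Implementable (tensorOp (withZ w)) from H Finset.univ w (by simp)
  intro s
  induction s using Finset.induction_on with
  | empty =>
    intro w hw
    have h := implementable_neg_Z (Sum.inr 0 : Fin q ⊕ Fin 1)
    have e : onQubit Pauli.Z.matrix (Sum.inr 0 : Fin q ⊕ Fin 1) = tensorOp (withZ w) := by
      rw [onQubit]
      congr 1
      funext l
      rcases l with l | l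
      · simp [withZ, hw l, Pauli.matrix]
      · rw [Subsingleton.elim l 0]; simp [withZ]
    rw [e, ← neg_one_smul ℂ] at h
    have := h.neg (A := withZ w) (i := Sum.inr 0) rfl
    simpa using this
  | insert j s hj ih =>
    intro w hw
    have hI : Implementable (tensorOp (withZ (Function.update w j .I))) := by
      refine ih _ fun l hl => ?_
      by_cases h : l = j
      · subst h; simp
      · rw [Function.update_of_ne h]
        exact hw l (by simp [h, hl])
    have hZ : Implementable (tensorOp (withZ (Function.update w j .Z))) := by
      have hne : (Sum.inl j : Fin q ⊕ Fin 1) ≠ Sum.inr 0 := Sum.inl_ne_inr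
      have hc : circuitOp [Gate.cnot _ _ hne] = (Gate.cnot _ _ hne).op := by
        rw [circuitOp, circuitOp, one_mul]
      have hsq : (Gate.cnot _ _ hne).op * (Gate.cnot _ _ hne).op = 1 := by
        have h1 := Gate.op_conjTranspose_mul_self (Gate.cnot _ _ hne)
        have h2 : (Gate.cnot _ _ hne).op.conjTranspose = (Gate.cnot _ _ hne).op := by
          ext s t
          simp only [Gate.op, Matrix.conjTranspose_apply, Matrix.of_apply]
          have : (t = Function.update s (Sum.inr 0) (xor (s (Sum.inr 0)) (s (Sum.inl j)))) ↔
              s = Function.update t (Sum.inr 0) (xor (t (Sum.inr 0)) (t (Sum.inl j))) := by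
            constructor <;> rintro rfl <;> simp [hne]
          simp only [this]
          split_ifs <;> simp
        rwa [h2] at h1
      have h := hI.conj (L := [Gate.cnot _ _ hne]) (L' := [Gate.cnot _ _ hne]) (by rw [hc, hsq])
      rw [hc, cnot_conj_tensorOp _ _ _ (withZ (Function.update w j .I)) (by simp [withZ, Pauli.matrix]) rfl, update_withZ,
        Function.update_idem] at h
      exact h
    have hX : Implementable (tensorOp (withZ (Function.update w j .X))) := by
      have h := hZ.local_conj (i := Sum.inl j) (circuitOp_hadamard _) (circuitOp_hadamard _)
        hadamardMatrix_mul_self (B := Pauli.X.matrix) (by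
          simp only [withZ, Sum.elim_inl, Function.update_self]
          exact hadamard_conj_Z)
      rwa [update_withZ, Function.update_idem] at h
    have hY : Implementable (tensorOp (withZ (Function.update w j .Y))) := by
      have e2 : tMatrix ^ 2 = Matrix.diagonal fun s => if s then Complex.I else 1 := by
        rw [pow_two, tMatrix_sq]
      -- The inverse of `T²`; the gate set contains no inverse of `T`.
      have e6 : tMatrix ^ 6 = Matrix.diagonal fun s => if s then -Complex.I else 1 := by
        rw [show 6 = 2 + 2 + 2 from rfl, pow_add, pow_add, e2, Matrix.diagonal_mul_diagonal,
          Matrix.diagonal_mul_diagonal]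
        congr 1
        funext s
        cases s <;> simp
      have h := hX.local_conj (i := Sum.inl j) (circuitOp_tGates _ 2) (circuitOp_tGates _ 6)
        (by
          rw [e2, e6, Matrix.diagonal_mul_diagonal, ← Matrix.diagonal_one]
          congr 1
          funext s
          cases s <;> simp) (B := Pauli.Y.matrix) (by
          rw [e2, e6]
          ext s t
          cases s <;> cases t <;>
            simp [withZ, Pauli.matrix, Matrix.diagonal_mul, Matrix.mul_diagonal])
      rwa [update_withZ, Function.update_idem] at h
    rw [← Function.update_eq_self j w]
    cases w j <;> assumption

theorem tensorOp_withZ (w : Fin q → Pauli) :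
    tensorOp (withZ w) = embedOp Function.Embedding.inl (pauliString w) *
      onQubit Pauli.Z.matrix (Sum.inr 0) := by
  have h : embedOp (Function.Embedding.inl : Fin q ↪ Fin q ⊕ Fin 1) (pauliString w) =
      tensorOp (Sum.elim (fun j => (w j).matrix) fun _ => 1) := by
    rw [← embedOp_tensorOp Function.Embedding.inl]
    · rfl
    · rintro (k | k) hk
      · exact absurd ⟨k, rfl⟩ hk
      · rfl
  rw [h, onQubit, tensorOp_eq_piOp, tensorOp_eq_piOp, tensorOp_eq_piOp, piOp_mul]
  congr 1
  funext l
  rcases l with l | l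
  · simp [withZ]
  · rw [Subsingleton.elim l 0]; simp [withZ]

theorem implementable_monomial (K : Finset (Fin (q * 2))) :
    Implementable (embedOp (Function.Embedding.inl : Fin q ↪ Fin q ⊕ Fin 1)
      (majoranaMonomial (majorana q) K) * onQubit Pauli.Z.matrix (Sum.inr 0)) := by
  obtain ⟨w, h | h⟩ := exists_pauliString_eq K
  · rw [h, ← tensorOp_withZ]
    exact implementable_withZ w
  · rw [h, map_neg, neg_mul, ← tensorOp_withZ]
    have h1 := implementable_withZ w
    rw [← one_smul ℂ (tensorOp (withZ w))] at h1 ⊢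
    exact h1.neg (i := Sum.inr 0) rfl

/-- A circuit for a fermionic gate, on the qubits that represent the modes and one ancilla. -/
def rotCircuit (K : Finset (Fin (q * 2))) : List (Gate (Fin q ⊕ Fin 1)) :=
  (implementable_monomial K).choose

/-- The ancilla of a fermionic gate is the ancilla `z`. -/
def rotEmb (q : ℕ) {a : ℕ} (z : Fin a) : Fin q ⊕ Fin 1 ↪ Fin q ⊕ Fin a :=
  (Function.Embedding.refl _).sumMap ⟨fun _ => z, fun _ _ _ => Subsingleton.elim _ _⟩

/-- The circuit that replaces a fermionic gate. -/
def FermiGate.compile {q a : ℕ} : FermiGate q a → List (Gate (Fin q ⊕ Fin a))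
  | .qubit g => [g.relabel Function.Embedding.inr]
  | .rot K _ z => (rotCircuit K).map (Gate.relabel (rotEmb q z))

/-- The operator of a fermionic gate, with qubits instead of modes. -/
def FermiGate.qubitOp {q a : ℕ} : FermiGate q a → Op (Fin q ⊕ Fin a)
  | .qubit g => embedOp Function.Embedding.inr g.op
  | .rot K _ z => rotOp (embedOp Function.Embedding.inl (majoranaMonomial (majorana q) K) *
      onQubit Pauli.Z.matrix (Sum.inr z))

theorem FermiGate.circuitOp_compile {a : ℕ} (g : FermiGate q a) : ∃ c : ℂ, star c * c = 1 ∧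
    circuitOp g.compile = c • g.qubitOp := by
  cases g with
  | qubit g =>
    refine ⟨1, by simp, ?_⟩
    rw [FermiGate.compile, FermiGate.qubitOp, circuitOp, circuitOp, Gate.op_relabel, one_mul,
      one_smul]
  | rot K hK z =>
    obtain ⟨c, hc, h⟩ := (implementable_monomial K).choose_spec
    refine ⟨c, hc, ?_⟩
    rw [FermiGate.compile, FermiGate.qubitOp, circuitOp_relabel, rotCircuit, h, rotOp, rotOp,
      map_smul, map_add, map_smul, map_smul, map_one, map_mul, embedOp_embedOp, embedOp_onQubit]
    rfl

/-- The phases of the single gates collect into one, which acceptance probabilities do not see. The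
reversal reflects that the head of a circuit is applied first. -/
theorem circuitOp_flatMap_compile {a : ℕ} (gs : List (FermiGate q a)) : ∃ c : ℂ,
    star c * c = 1 ∧ circuitOp (gs.flatMap FermiGate.compile) =
      c • (gs.map FermiGate.qubitOp).reverse.prod := by
  induction gs with
  | nil => exact ⟨1, by simp, by simp [circuitOp]⟩
  | cons g gs ih =>
    obtain ⟨c, hc, h⟩ := ih
    obtain ⟨d, hd, h'⟩ := g.circuitOp_compile
    refine ⟨c * d, ?_, ?_⟩
    · rw [star_mul, show star d * star c * (c * d) = (star c * c) * (star d * d) by ring, hc, hd,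
        one_mul]
    · rw [List.flatMap_cons, circuitOp_append, h, h', smul_mul_smul_comm]
      simp

end Rotations

end

end QHard

/-! ### Jordan–Wigner strings of the selected modes. -/

namespace QHard

open Enc (enc)
open scoped ComplexOrder MatrixOrder

noncomputable section

set_option linter.unusedSectionVars false

/-! ## Fermionic checks as qubit checks -/

/-- Conjugation by a Hermitian involution. -/
def conjInvolution {κ : Type} [Fintype κ] [DecidableEq κ] (J : Matrix κ κ ℂ) (hJ : J * J = 1)
    (hJ' : J.conjTranspose = J) : Matrix κ κ ℂ →⋆ₐ[ℂ] Matrix κ κ ℂ where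
  toFun A := J * A * J
  map_one' := by rw [mul_one, hJ]
  map_mul' A B := by
    rw [show J * A * J * (J * B * J) = J * A * (J * J) * B * J by simp only [mul_assoc], hJ,
      mul_one, mul_assoc J A B]
  map_zero' := by simp
  map_add' A B := by rw [mul_add, add_mul]
  commutes' c := by
    rw [Algebra.algebraMap_eq_smul_one, mul_smul_comm, smul_mul_assoc, mul_one, hJ]
  map_star' A := by
    simp only [Matrix.star_eq_conjTranspose, Matrix.conjTranspose_mul, hJ', mul_assoc]

section JordanWigner

variable {p q : ℕ} (S : Fin q ↪o Fin p)

/-- The sign from the modes before `k` that are not selected. -/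
def stringSign (k : Fin p) (s : Fin p → Bool) : ℂ :=
  ∏ l, if l ∉ Set.range S ∧ l < k ∧ s l then -1 else 1

open Classical in
/-- The sign that corrects the Jordan–Wigner strings of the selected modes. -/
def jwSign (s : Fin p → Bool) : ℂ :=
  ∏ k, if k ∈ Set.range S ∧ s k then stringSign S k s else 1

theorem prod_sign_mul_self {β : Type} [Fintype β] (P : β → Prop) [DecidablePred P] :
    (∏ b, if P b then (-1 : ℂ) else 1) * ∏ b, (if P b then (-1 : ℂ) else 1) = 1 := by
  rw [← Finset.prod_mul_distrib]
  exact Finset.prod_eq_one fun b _ => by split_ifs <;> simp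

theorem stringSign_mul_self (k : Fin p) (s : Fin p → Bool) :
    stringSign S k s * stringSign S k s = 1 := by
  classical
  exact prod_sign_mul_self _

theorem jwSign_mul_self (s : Fin p → Bool) : jwSign S s * jwSign S s = 1 := by
  rw [jwSign, ← Finset.prod_mul_distrib]
  exact Finset.prod_eq_one fun b _ => by
    split_ifs
    · exact stringSign_mul_self S b s
    · simp

theorem star_stringSign (k : Fin p) (s : Fin p → Bool) :
    star (stringSign S k s) = stringSign S k s := by
  rw [stringSign, star_prod]
  exact Finset.prod_congr rfl fun l _ => by split_ifs <;> simp

theorem star_jwSign (s : Fin p → Bool) : star (jwSign S s) = jwSign S s := by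
  rw [jwSign, star_prod]
  exact Finset.prod_congr rfl fun l _ => by split_ifs <;> simp [star_stringSign]

/-- The operator that corrects the Jordan–Wigner strings of the selected modes. -/
def jwOp : Op (Fin p) := Matrix.diagonal (jwSign S)

theorem jwOp_mul_self : jwOp S * jwOp S = 1 := by
  rw [jwOp, Matrix.diagonal_mul_diagonal, ← Matrix.diagonal_one]
  congr 1
  funext s
  exact jwSign_mul_self S s

theorem jwOp_conjTranspose : (jwOp S).conjTranspose = jwOp S := by
  rw [jwOp, Matrix.diagonal_conjTranspose]
  congr 1
  funext s
  exact star_jwSign S s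

theorem stringSign_update (k : Fin p) (j : Fin q) (s : Fin p → Bool) (b : Bool) :
    stringSign S k (Function.update s (S j) b) = stringSign S k s := by
  refine Finset.prod_congr rfl fun l _ => ?_
  by_cases hl : l = S j
  · subst hl; simp
  · rw [Function.update_of_ne hl]

/-- A string sign counts unselected modes only, so flipping a selected mode changes none of them.
The string sign of `S j` enters exactly one of the two products, and all other factors are squared.
-/
theorem jwSign_mul_update (j : Fin q) (s : Fin p → Bool) :
    jwSign S s * jwSign S (Function.update s (S j) (!s (S j))) = stringSign S (S j) s := by
  rw [jwSign, jwSign, ← Finset.prod_mul_distrib, Finset.prod_eq_single (S j)]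
  · rw [stringSign_update, Function.update_self]
    cases s (S j) <;> simp
  · intro k _ hk
    rw [stringSign_update, Function.update_of_ne hk]
    split_ifs
    · exact stringSign_mul_self S k s
    · simp
  · simp

/-- The operators of the selected modes in the algebra of all modes. -/
def fermiEmbed : Op (Fin q) →⋆ₐ[ℂ] Op (Fin p) :=
  (conjInvolution (jwOp S) (jwOp_mul_self S) (jwOp_conjTranspose S)).comp (embedOp S.toEmbedding)

theorem fermiEmbed_apply (A : Op (Fin q)) :
    fermiEmbed S A = jwOp S * embedOp S.toEmbedding A * jwOp S := rfl

/-- After plain embedding, the string of a Majorana operator runs only through the selected modes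
before `S j`, whereas the true one also passes the unselected modes. The operator flips mode `S j`,
so conjugation by the diagonal signs multiplies its entries by just the missing string sign. -/
theorem fermiEmbed_modeMajorana (j : Fin q) (b : Fin 2) :
    fermiEmbed S (modeMajorana j b) = modeMajorana (S j) b := by
  classical
  rw [fermiEmbed_apply, modeMajorana_eq, modeMajorana_eq, embedOp_pauliString]
  ext s t
  rw [jwOp, Matrix.mul_diagonal, Matrix.diagonal_mul, pauliString, pauliString, tensorOp_eq_piOp,
    tensorOp_eq_piOp, piOp_apply, piOp_apply]
  have hj : extendPauli S (majoranaLetters j b) (S j) = (if b = 0 then .X else .Y) := by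
    rw [extendPauli, S.injective.extend_apply]
    simp [majoranaLetters]
  have hj' : majoranaLetters (S j) b (S j) = (if b = 0 then .X else .Y) := by
    simp [majoranaLetters]
  have hin : ∀ l ≠ S j, ¬(l ∉ Set.range S ∧ l < S j) →
      extendPauli S (majoranaLetters j b) l = majoranaLetters (S j) b l := by
    intro l hl h
    by_cases hr : l ∈ Set.range S
    · obtain ⟨i, rfl⟩ := hr
      rw [extendPauli, S.injective.extend_apply]
      simp [majoranaLetters]
    · have h1 : ¬ l < S j := fun h' => h ⟨hr, h'⟩
      rw [extendPauli, Function.extend_apply' _ _ _ hr]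
      simp [majoranaLetters, h1, hl]
  have hout : ∀ l ≠ S j, (l ∉ Set.range S ∧ l < S j) →
      extendPauli S (majoranaLetters j b) l = .I ∧ majoranaLetters (S j) b l = .Z := by
    intro l hl h
    rw [extendPauli, Function.extend_apply' _ _ _ h.1]
    exact ⟨rfl, by simp [majoranaLetters, h.2]⟩
  have hdiag : ∀ P : Pauli, P = .I ∨ P = .Z → ∀ x y, x ≠ y → P.matrix x y = 0 := by
    rintro P (rfl | rfl) x y h
    · exact Matrix.one_apply_ne h
    · exact Matrix.diagonal_apply_ne _ h
  have hIZ : ∀ l ≠ S j, majoranaLetters (S j) b l = .I ∨ majoranaLetters (S j) b l = .Z := by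
    intro l hl
    rw [majoranaLetters, if_neg hl]
    split_ifs
    · exact Or.inr rfl
    · exact Or.inl rfl
  have hIZ' : ∀ l ≠ S j, extendPauli S (majoranaLetters j b) l = .I ∨
      extendPauli S (majoranaLetters j b) l = .Z := by
    intro l hl
    by_cases h : l ∉ Set.range S ∧ l < S j
    · exact Or.inl (hout l hl h).1
    · rw [hin l hl h]
      exact hIZ l hl
  -- Both sides vanish unless `s` and `t` differ exactly at `S j`.
  by_cases hst : ∃ l ≠ S j, s l ≠ t l
  · obtain ⟨l, hl, hne⟩ := hst
    rw [Finset.prod_eq_zero (Finset.mem_univ l) (hdiag _ (hIZ' l hl) _ _ hne),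
      Finset.prod_eq_zero (Finset.mem_univ l) (hdiag _ (hIZ l hl) _ _ hne)]
    simp
  · push Not at hst
    by_cases hjj : s (S j) = t (S j)
    · have h0 : ∀ x, (if b = 0 then Pauli.X else Pauli.Y).matrix x x = 0 := by
        intro x
        split_ifs <;> simp [Pauli.matrix]
      rw [Finset.prod_eq_zero (Finset.mem_univ (S j)) (by rw [hj, hjj, h0]),
        Finset.prod_eq_zero (Finset.mem_univ (S j)) (by rw [hj', hjj, h0])]
      simp
    · have ht : t = Function.update s (S j) (!s (S j)) := by
        funext l
        by_cases hl : l = S j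
        · subst hl
          rw [Function.update_self]
          cases h1 : s (S j) <;> cases h2 : t (S j) <;> simp_all
        · rw [Function.update_of_ne hl, hst l hl]
      rw [mul_right_comm]
      nth_rw 1 [ht]
      rw [jwSign_mul_update, stringSign, ← Finset.prod_mul_distrib]
      refine Finset.prod_congr rfl fun l _ => ?_
      by_cases hl : l = S j
      · subst hl
        rw [if_neg (by simp), one_mul, hj, hj']
      · by_cases h : l ∉ Set.range S ∧ l < S j
        · rw [(hout l hl h).1, (hout l hl h).2, ← hst l hl]
          simp only [h.1, h.2]
          cases s l <;> simp [Pauli.matrix]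
        · rw [if_neg (fun h' => h ⟨h'.1, h'.2.1⟩), one_mul, hin l hl h]

theorem fermiEmbed_monomial (K : Finset (Fin (q * 2))) :
    fermiEmbed S (majoranaMonomial (majorana q) K) = majoranaMonomial (selectedMajorana S) K := by
  rw [majoranaMonomial, majoranaMonomial, map_smul, map_list_prod, List.map_map]
  congr 3
  funext i
  simp only [Function.comp, apply_ite (fermiEmbed S), map_one, majorana, fermiEmbed_modeMajorana,
    selectedMajorana]

end JordanWigner

section Ancillas

variable {α β : Type} [Fintype α] [DecidableEq α] [Fintype β] [DecidableEq β]

theorem embedOp_inl_eq (A : Op α) : embedOp (Function.Embedding.inl : α ↪ α ⊕ β) A =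
    (Matrix.kronecker A 1).submatrix (Equiv.sumArrowEquivProdArrow _ _ _)
      (Equiv.sumArrowEquivProdArrow _ _ _) := by
  ext s t
  rw [embedOp_apply, Matrix.submatrix_apply, Matrix.kronecker, Matrix.kroneckerMap_apply,
    Matrix.one_apply]
  congr 1
  refine if_congr ⟨fun h => funext fun b => h (Sum.inr b) (by rintro ⟨a, ha⟩; cases ha), ?_⟩ rfl rfl
  rintro h (a | b) hk
  · exact absurd ⟨a, rfl⟩ hk
  · exact congrFun h b

theorem embedOp_inr_eq (A : Op β) : embedOp (Function.Embedding.inr : β ↪ α ⊕ β) A =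
    (Matrix.kronecker 1 A).submatrix (Equiv.sumArrowEquivProdArrow _ _ _)
      (Equiv.sumArrowEquivProdArrow _ _ _) := by
  ext s t
  rw [embedOp_apply, Matrix.submatrix_apply, Matrix.kronecker, Matrix.kroneckerMap_apply,
    Matrix.one_apply, mul_comm]
  congr 1
  refine if_congr ⟨fun h => funext fun b => h (Sum.inl b) (by rintro ⟨a, ha⟩; cases ha), ?_⟩ rfl rfl
  rintro h (a | b) hk
  · exact congrFun h a
  · exact absurd ⟨b, rfl⟩ hk

theorem embedOp_inl_mul_inr (A : Op α) (B : Op β) :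
    embedOp (Function.Embedding.inl : α ↪ α ⊕ β) A * embedOp Function.Embedding.inr B =
      (Matrix.kronecker A B).submatrix (Equiv.sumArrowEquivProdArrow _ _ _)
        (Equiv.sumArrowEquivProdArrow _ _ _) := by
  rw [embedOp_inl_eq, embedOp_inr_eq, Matrix.submatrix_mul_equiv]
  simp only [Matrix.kronecker, ← Matrix.mul_kronecker_mul, one_mul, mul_one]

theorem embedOp_inl_inr_comm (A : Op α) (B : Op β) :
    embedOp (Function.Embedding.inl : α ↪ α ⊕ β) A * embedOp Function.Embedding.inr B =
      embedOp Function.Embedding.inr B * embedOp Function.Embedding.inl A := by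
  rw [embedOp_inl_mul_inr, embedOp_inl_eq, embedOp_inr_eq, Matrix.submatrix_mul_equiv]
  simp only [Matrix.kronecker, ← Matrix.mul_kronecker_mul, one_mul, mul_one]

theorem embedOp_inl_apply_withZeros (A : Op α) (s t : α → Bool) (u : β → Bool) :
    embedOp (Function.Embedding.inl : α ↪ α ⊕ β) A (Sum.elim s u) (withZeros t) =
      if u = fun _ => false then A s t else 0 := by
  rw [embedOp_inl_eq, Matrix.submatrix_apply, Matrix.kronecker, Matrix.kroneckerMap_apply,
    Matrix.one_apply, mul_ite, mul_one, mul_zero]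
  rfl

theorem submatrix_mul_embedOp_inl (A : Op α) (Y : Op (α ⊕ β)) :
    (Y * embedOp Function.Embedding.inl A).submatrix withZeros withZeros =
      Y.submatrix withZeros withZeros * A := by
  ext s t
  rw [Matrix.submatrix_apply, Matrix.mul_apply, sum_sum_elim, Matrix.mul_apply]
  simp only [embedOp_inl_apply_withZeros, mul_ite, mul_zero, Finset.sum_ite_eq', Finset.mem_univ,
    if_true]
  rfl

theorem submatrix_embedOp_inl_mul (A : Op α) (Y : Op (α ⊕ β)) :
    (embedOp Function.Embedding.inl A * Y).submatrix withZeros withZeros =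
      A * Y.submatrix withZeros withZeros := by
  have h := congrArg Matrix.conjTranspose (submatrix_mul_embedOp_inl A.conjTranspose Y.conjTranspose)
  rwa [Matrix.conjTranspose_submatrix, Matrix.conjTranspose_mul, Matrix.conjTranspose_mul,
    Matrix.conjTranspose_submatrix, embedOp_conjTranspose, Matrix.conjTranspose_conjTranspose,
    Matrix.conjTranspose_conjTranspose, Matrix.conjTranspose_conjTranspose] at h

theorem embedOp_inl_mul_projOne (A : Op α) (b : β) :
    embedOp Function.Embedding.inl A * projOne (Sum.inr b) =
      projOne (Sum.inr b) * embedOp Function.Embedding.inl A := by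
  have h : (projOne (Sum.inr b) : Op (α ⊕ β)) = embedOp Function.Embedding.inr (projOne b) :=
    (embedOp_projOne (Function.Embedding.inr : β ↪ α ⊕ β) b).symm
  rw [h, embedOp_inl_inr_comm]

end Ancillas

section Checks

variable {p q a : ℕ} (S : Fin q ↪o Fin p)

theorem embedOp_jwOp_mul_self : embedOp (Function.Embedding.inl : Fin p ↪ Fin p ⊕ Fin a) (jwOp S) *
    embedOp Function.Embedding.inl (jwOp S) = 1 := by
  rw [← map_mul, jwOp_mul_self, map_one]

/-- The operators of the selected modes and the ancillas in the algebra of all modes and the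
ancillas. -/
def fermiAncillaEmbed (a : ℕ) : Op (Fin q ⊕ Fin a) →⋆ₐ[ℂ] Op (Fin p ⊕ Fin a) :=
  (conjInvolution (embedOp Function.Embedding.inl (jwOp S)) (embedOp_jwOp_mul_self S)
    (by rw [← embedOp_conjTranspose, jwOp_conjTranspose])).comp
    (embedOp (S.toEmbedding.sumMap (Function.Embedding.refl (Fin a))))

theorem fermiAncillaEmbed_apply (X : Op (Fin q ⊕ Fin a)) : fermiAncillaEmbed S a X =
    embedOp Function.Embedding.inl (jwOp S) *
      embedOp (S.toEmbedding.sumMap (Function.Embedding.refl (Fin a))) X *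
        embedOp Function.Embedding.inl (jwOp S) := rfl

theorem fermiAncillaEmbed_inl (A : Op (Fin q)) :
    fermiAncillaEmbed S a (embedOp Function.Embedding.inl A) =
      embedOp Function.Embedding.inl (fermiEmbed S A) := by
  rw [fermiAncillaEmbed_apply, embedOp_embedOp, fermiEmbed_apply, map_mul, map_mul,
    embedOp_embedOp]
  rfl

theorem fermiAncillaEmbed_inr (B : Op (Fin a)) :
    fermiAncillaEmbed S a (embedOp Function.Embedding.inr B) =
      embedOp Function.Embedding.inr B := by
  rw [fermiAncillaEmbed_apply, embedOp_embedOp]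
  change _ * embedOp Function.Embedding.inr B * _ = _
  rw [embedOp_inl_inr_comm, mul_assoc, embedOp_jwOp_mul_self, mul_one]

theorem FermiGate.op_submatrix (g : FermiGate q a) :
    (g.op S).submatrix (Equiv.sumArrowEquivProdArrow _ _ _) (Equiv.sumArrowEquivProdArrow _ _ _) =
      fermiAncillaEmbed S a g.qubitOp := by
  cases g with
  | qubit g =>
    rw [FermiGate.qubitOp, fermiAncillaEmbed_inr, embedOp_inr_eq]
    rfl
  | rot K hK z =>
    have hz : onQubit Pauli.Z.matrix (Sum.inr z : Fin q ⊕ Fin a) =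
        embedOp Function.Embedding.inr (onQubit Pauli.Z.matrix z) :=
      (embedOp_onQubit (Function.Embedding.inr : Fin a ↪ Fin q ⊕ Fin a) _ z).symm
    rw [FermiGate.qubitOp, rotOp, hz, map_add, map_smul, map_smul, map_one, map_mul,
      fermiAncillaEmbed_inl, fermiAncillaEmbed_inr, fermiEmbed_monomial, embedOp_inl_mul_inr]
    simp only [FermiGate.op, Matrix.submatrix_add, Matrix.submatrix_smul, Pi.add_apply,
      Pi.smul_apply, Matrix.submatrix_one_equiv]

theorem fermiCircuitOp_submatrix (gs : List (FermiGate q a)) :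
    (fermiCircuitOp S gs).submatrix (Equiv.sumArrowEquivProdArrow _ _ _)
      (Equiv.sumArrowEquivProdArrow _ _ _) =
      fermiAncillaEmbed S a (gs.map FermiGate.qubitOp).reverse.prod := by
  induction gs with
  | nil => simp [fermiCircuitOp]
  | cons g gs ih =>
    rw [fermiCircuitOp, ← Matrix.submatrix_mul_equiv _ _ _ (Equiv.sumArrowEquivProdArrow _ _ _) _,
      ih, FermiGate.op_submatrix, ← map_mul]
    simp

/-- The qubit check that replaces a fermionic check. -/
def FermiCheck.toQubit {p q : ℕ} (V : FermiCheck p q) : QubitCheck p q :=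
  ⟨V.1, V.2.1, V.2.2.flatMap FermiGate.compile⟩

theorem pullOne_smul {κ : Type} [Fintype κ] [DecidableEq κ] {c : ℂ} (hc : star c * c = 1)
    (U : Op κ) (k : κ) : pullOne (c • U) k = pullOne U k := by
  rw [pullOne, pullOne, Matrix.conjTranspose_smul, smul_mul_assoc, smul_mul_smul_comm, hc, one_smul]

theorem pullOne_fermiAncillaEmbed (X : Op (Fin q ⊕ Fin a)) (z : Fin a) :
    pullOne (fermiAncillaEmbed S a X) (Sum.inr z) =
      fermiAncillaEmbed S a (pullOne X (Sum.inr z)) := by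
  have h : (projOne (Sum.inr z) : Op (Fin p ⊕ Fin a)) =
      fermiAncillaEmbed S a (projOne (Sum.inr z)) := by
    have h1 : ∀ r : ℕ, (projOne (Sum.inr z) : Op (Fin r ⊕ Fin a)) =
      embedOp Function.Embedding.inr (projOne z) := fun r =>
        (embedOp_projOne (Function.Embedding.inr : Fin _ ↪ Fin r ⊕ Fin _) z).symm
    rw [h1, h1, fermiAncillaEmbed_inr]
  rw [pullOne, pullOne, h, map_mul, map_mul]
  congr 2
  exact (map_star (fermiAncillaEmbed S a) X).symm

/-- As in `qubitAccept_eq`, with two additions: the phase of the compiled circuit cancels in the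
effect, and the sign correction acts on the proof alone, so it passes through the compression to
zero ancillas. -/
theorem fermiAccept_eq (ρ : Op (Fin p)) (V : FermiCheck p q) :
    fermiAccept ρ V = (ρ * fermiEmbed V.1 (acceptEffect V.toQubit.2.2)).trace.re := by
  obtain ⟨S, a, gs⟩ := V
  set e := Equiv.sumArrowEquivProdArrow (Fin p) (Fin (a + 1)) Bool with he
  obtain ⟨c, hc, hgs⟩ := circuitOp_flatMap_compile gs
  have hU := fermiCircuitOp_submatrix S gs
  have hM : acceptEffect (gs.flatMap FermiGate.compile) =
      (pullOne (gs.map FermiGate.qubitOp).reverse.prod (Sum.inr 0)).submatrix withZeros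
        withZeros := by
    rw [acceptEffect, hgs, pullOne_smul hc]
  set X := (gs.map FermiGate.qubitOp).reverse.prod
  simp only [fermiAccept]
  set U := fermiCircuitOp S gs
  set P : Matrix ((Fin p → Bool) × (Fin (a + 1) → Bool)) ((Fin p → Bool) × (Fin (a + 1) → Bool)) ℂ :=
    Matrix.diagonal fun s => if s.2 0 then 1 else 0
  have hP : P.submatrix e e = projOne (Sum.inr 0) := Matrix.submatrix_diagonal_equiv _ _
  have h1 : (P * (U * Matrix.kronecker ρ (zeroState (Fin (a + 1))) * U.conjTranspose)).trace =
      (Matrix.kronecker ρ (zeroState (Fin (a + 1))) * (U.conjTranspose * P * U)).trace := by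
    rw [Matrix.trace_mul_comm, mul_assoc, mul_assoc, Matrix.trace_mul_comm, mul_assoc, mul_assoc,
      ← mul_assoc U.conjTranspose]
  rw [h1, ← trace_submatrix_equiv e, ← Matrix.submatrix_mul_equiv _ _ _ e _,
    trace_submatrix_kronecker_zeroState_mul, ← Matrix.submatrix_mul_equiv _ _ _ e _,
    ← Matrix.submatrix_mul_equiv _ _ _ e _, hP, ← Matrix.conjTranspose_submatrix, hU]
  change (ρ * (pullOne (fermiAncillaEmbed S (a + 1) X) (Sum.inr 0)).submatrix _ _).trace.re = _
  rw [pullOne_fermiAncillaEmbed, fermiAncillaEmbed_apply, submatrix_mul_embedOp_inl,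
    submatrix_embedOp_inl_mul, submatrix_withZeros_embedOp]
  simp only [FermiCheck.toQubit]
  rw [hM, fermiEmbed_apply]

theorem FermiGate.qubitOp_parity (g : FermiGate q a) :
    embedOp Function.Embedding.inl (parityOp q) * g.qubitOp =
      g.qubitOp * embedOp Function.Embedding.inl (parityOp q) := by
  cases g with
  | qubit g => exact embedOp_inl_inr_comm _ _
  | rot K hK z =>
    have hz : onQubit Pauli.Z.matrix (Sum.inr z : Fin q ⊕ Fin a) =
        embedOp Function.Embedding.inr (onQubit Pauli.Z.matrix z) :=
      (embedOp_onQubit (Function.Embedding.inr : Fin a ↪ Fin q ⊕ Fin a) _ z).symm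
    have hK' : Even K.card := by rcases hK with h | h <;> rw [h] <;> decide
    have h := parityOp_mul_monomial K
    rw [hK'.neg_one_pow, one_smul] at h
    rw [FermiGate.qubitOp, rotOp, hz, mul_add, add_mul, mul_smul_comm, mul_smul_comm,
      smul_mul_assoc, smul_mul_assoc, mul_one, one_mul, ← mul_assoc, ← map_mul, h, map_mul,
      mul_assoc, embedOp_inl_inr_comm, mul_assoc]

/-- The acceptance operator of a fermionic check preserves the parity. -/
theorem acceptEffect_toQubit_parity (V : FermiCheck p q) :
    parityOp q * acceptEffect V.toQubit.2.2 = acceptEffect V.toQubit.2.2 * parityOp q := by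
  obtain ⟨S, a, gs⟩ := V
  obtain ⟨c, hc, hgs⟩ := circuitOp_flatMap_compile gs
  simp only [FermiCheck.toQubit]
  rw [acceptEffect, hgs, pullOne_smul hc, ← submatrix_embedOp_inl_mul, ← submatrix_mul_embedOp_inl]
  congr 1
  set Q := embedOp (Function.Embedding.inl : Fin q ↪ Fin q ⊕ Fin (a + 1)) (parityOp q)
  have hX : Commute Q (gs.map FermiGate.qubitOp).reverse.prod := by
    refine Commute.list_prod_right _ _ fun A hA => ?_
    rw [List.mem_reverse, List.mem_map] at hA
    obtain ⟨g, -, rfl⟩ := hA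
    exact g.qubitOp_parity
  have hQ : Q.conjTranspose = Q := by rw [← embedOp_conjTranspose, parityOp_conjTranspose]
  have hX' : Commute Q (gs.map FermiGate.qubitOp).reverse.prod.conjTranspose := by
    have h := congrArg Matrix.conjTranspose hX.eq
    rw [Matrix.conjTranspose_mul, Matrix.conjTranspose_mul, hQ] at h
    exact h.symm
  exact ((hX'.mul_right (embedOp_inl_mul_projOne _ _)).mul_right hX).eq

end Checks

end

end QHard

/-! ### Even monomials as the basis for fermionic checks. -/

namespace QHard

open Enc (enc)
open scoped ComplexOrder MatrixOrder

noncomputable section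

set_option linter.unusedSectionVars false

open PolyComp

/-! ## The fermionic case -/

section Selection

variable {p q : ℕ} (S : Fin q ↪o Fin p)

/-- The Majorana operators of the selected modes among all Majorana operators. -/
def selEmb : Fin (q * 2) ↪o Fin (p * 2) :=
  OrderEmbedding.ofStrictMono (fun i => finProdFinEquiv (S i.divNat, i.modNat)) fun i j h => by
    rw [Fin.lt_def, finProdFinEquiv_apply_val, finProdFinEquiv_apply_val, Fin.coe_modNat,
      Fin.coe_modNat]
    rw [Fin.lt_def] at h
    rcases eq_or_ne i.divNat j.divNat with e | e
    · have e' := congrArg Fin.val e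
      rw [Fin.coe_divNat, Fin.coe_divNat] at e'
      rw [e]
      dsimp only
      omega
    · have hS : (S i.divNat : ℕ) < S j.divNat := by
        refine S.strictMono (lt_of_le_of_ne ?_ e)
        rw [Fin.le_def, Fin.coe_divNat, Fin.coe_divNat]
        omega
      dsimp only
      omega

theorem selEmb_apply (i : Fin (q * 2)) :
    selEmb S i = finProdFinEquiv (S i.divNat, i.modNat) := rfl

theorem selEmb_finProdFinEquiv (j : Fin q) (b : Fin 2) :
    selEmb S (finProdFinEquiv (j, b)) = finProdFinEquiv (S j, b) := by
  have h := finProdFinEquiv.symm_apply_apply (j, b)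
  rw [selEmb_apply]
  exact congrArg₂ (fun i c => finProdFinEquiv (S i, c)) (congrArg Prod.fst h) (congrArg Prod.snd h)

/-- Since `selEmb` is increasing, the ordered products on the two sides have their factors in the
same order, and no sign appears. -/
theorem majoranaMonomial_map_selEmb (K : Finset (Fin (q * 2))) :
    majoranaMonomial (majorana p) (K.map (selEmb S).toEmbedding) =
      fermiEmbed S (majoranaMonomial (majorana q) K) := by
  have hl : (List.finRange (p * 2)).filter (· ∈ K.map (selEmb S).toEmbedding) =
      ((List.finRange (q * 2)).filter (· ∈ K)).map (selEmb S) := by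
    refine List.Pairwise.eq_of_mem_iff (r := (· < ·)) ((List.pairwise_lt_finRange _).filter _)
      (List.pairwise_map.2 (((List.pairwise_lt_finRange _).filter _).imp fun h =>
        (selEmb S).strictMono h)) fun i => by simp
  rw [fermiEmbed_monomial, majoranaMonomial_eq, majoranaMonomial_eq, hl, Finset.card_map,
    List.map_map]
  congr 3
  funext i
  exact majorana_finProdFinEquiv _ _

theorem decide_mem_map_selEmb (K : Finset (Fin (q * 2))) (j : Fin p) (b : Fin 2) :
    decide (finProdFinEquiv (j, b) ∈ K.map (selEmb S).toEmbedding) =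
      Function.extend S (fun i => decide (finProdFinEquiv (i, b) ∈ K)) (fun _ => false) j := by
  by_cases hj : ∃ i, S i = j
  · obtain ⟨i, rfl⟩ := hj
    rw [S.injective.extend_apply, ← selEmb_finProdFinEquiv, decide_eq_decide]
    exact Finset.mem_map' _
  · rw [Function.extend_apply' _ _ _ hj, decide_eq_false_iff_not, Finset.mem_map]
    rintro ⟨i, -, h⟩
    exact hj ⟨i.divNat, congrArg Prod.fst (finProdFinEquiv.injective h)⟩

end Selection

/-- The monomial that equals a given Pauli string up to the sign. -/
def monomialOf {q : ℕ} (w : Fin q → Pauli) : Finset (Fin (q * 2)) := (exists_monomial_eq w).choose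

open Classical in
/-- The sign of a Pauli string as an even monomial, zero for the odd ones. -/
def monomialSign {q : ℕ} (w : Fin q → Pauli) : ℤ :=
  if Even (monomialOf w).card then
    if pauliString w = majoranaMonomial (majorana q) (monomialOf w) then 1 else -1
  else 0

/-- The monomial on the selected modes that a Pauli string stands for, trivial for the odd ones. -/
def evenMonomial {p q : ℕ} (S : Fin q ↪o Fin p) (w : Fin q → Pauli) : Finset (Fin (p * 2)) :=
  if Even (monomialOf w).card then (monomialOf w).map (selEmb S).toEmbedding else ∅

theorem even_card_evenMonomial {p q : ℕ} (S : Fin q ↪o Fin p) (w : Fin q → Pauli) :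
    Even (evenMonomial S w).card := by
  rw [evenMonomial]
  split_ifs with h
  · rwa [Finset.card_map]
  · simp

theorem monomialSign_smul {p q : ℕ} (S : Fin q ↪o Fin p) {w : Fin q → Pauli}
    (h : Even (monomialOf w).card) :
    (monomialSign w : ℝ) • majoranaMonomial (majorana p) (evenMonomial S w) =
      fermiEmbed S (pauliString w) := by
  rw [monomialSign, evenMonomial, if_pos h, if_pos h, majoranaMonomial_map_selEmb]
  split_ifs with h1
  · rw [Int.cast_one, one_smul, ← h1]
  · rw [((exists_monomial_eq w).choose_spec.resolve_left h1 :
      pauliString w = -majoranaMonomial (majorana q) (monomialOf w)), map_neg, Int.cast_neg,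
      Int.cast_one, neg_smul, one_smul]
    rfl

theorem monomialSign_of_not_even {q : ℕ} {w : Fin q → Pauli} (h : ¬Even (monomialOf w).card) :
    monomialSign w = 0 := if_neg h

theorem fermiEmbed_pauliString_conjTranspose {p q : ℕ} (S : Fin q ↪o Fin p) (w : Fin q → Pauli) :
    (fermiEmbed S (pauliString w)).conjTranspose = fermiEmbed S (pauliString w) := by
  conv_rhs => rw [← pauliString_conjTranspose]
  exact (map_star (fermiEmbed S) (pauliString w)).symm

theorem fermiEmbed_pauliString_mul_self {p q : ℕ} (S : Fin q ↪o Fin p) (w : Fin q → Pauli) :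
    fermiEmbed S (pauliString w) * fermiEmbed S (pauliString w) = 1 := by
  rw [← map_mul, pauliString_mul_self, map_one]

/-- Checks of fermionic modes are expressed by even monomials. -/
def fermiModel (q : ℕ) : OperatorModel q fun n => Finset (Fin (n * 2)) where
  basis := majoranaMonomial (majorana _)
  one _ := ∅
  basis_one _ := majoranaMonomial_empty
  el := evenMonomial
  sign := monomialSign
  neg_one_le S w := by
    by_cases h : Even (monomialOf w).card
    · rw [monomialSign_smul S h]
      exact neg_one_le_of_involution (fermiEmbed_pauliString_conjTranspose S w)
        (fermiEmbed_pauliString_mul_self S w)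
    · rw [monomialSign_of_not_even h, Int.cast_zero, zero_smul, neg_nonpos]
      exact Matrix.PosSemidef.one.nonneg
  le_one S w := by
    by_cases h : Even (monomialOf w).card
    · rw [monomialSign_smul S h]
      exact le_one_of_involution (fermiEmbed_pauliString_conjTranspose S w)
        (fermiEmbed_pauliString_mul_self S w)
    · rw [monomialSign_of_not_even h, Int.cast_zero, zero_smul]
      exact Matrix.PosSemidef.one.nonneg

/-- The model discards odd Pauli strings. Nothing is lost, since their coefficients vanish for an
effect that commutes with the parity. -/
theorem fermiModel_effect {p q : ℕ} (V : FermiCheck p q) :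
    (fermiModel q).effect V.toQubit = fermiEmbed V.1 (acceptEffect V.toQubit.2.2) := by
  conv_rhs => rw [pauli_expansion (acceptEffect V.toQubit.2.2), map_sum]
  refine Finset.sum_congr rfl fun w _ => ?_
  rw [map_smul]
  by_cases h : Even (monomialOf w).card
  · exact congrArg _ (monomialSign_smul V.1 h)
  · have h0 : (acceptEffect V.toQubit.2.2 * pauliString w).trace = 0 := by
      have hz := trace_mul_monomial_eq_zero (acceptEffect_toQubit_parity V) h
      rcases (exists_monomial_eq w).choose_spec with e | e
      · rw [e]
        exact hz
      · rw [e, mul_neg, Matrix.trace_neg, neg_eq_zero]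
        exact hz
    rw [h0, mul_zero, zero_smul, zero_smul]

theorem parityOp_mul_effect {p q : ℕ} (V : QubitCheck p q) :
    parityOp p * (fermiModel q).effect V = (fermiModel q).effect V * parityOp p := by
  refine Commute.sum_right _ _ _ fun w _ => Commute.smul_right (Commute.smul_right ?_ _) _
  have h := parityOp_mul_monomial (evenMonomial V.1 w)
  rwa [(even_card_evenMonomial V.1 w).neg_one_pow, one_smul] at h

/-- The membership vector is grouped into one pair of bits per mode, so that a loop over modes can
write it. -/
theorem enc_modes {n : ℕ} (K : Finset (Fin (n * 2))) : enc K =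
    dlist ((List.finRange n).flatMap fun j => [enc (decide (finProdFinEquiv (j, (0 : Fin 2)) ∈ K)),
      enc (decide (finProdFinEquiv (j, (1 : Fin 2)) ∈ K))]) := by
  change enc (List.ofFn fun i => decide (i ∈ K)) = _
  rw [enc_list, List.ofFn_mul, List.map_flatten, List.flatMap_def, List.ofFn_eq_map, List.map_map]
  congr 3
  funext j
  have h0 : ∀ h, (⟨j * 2 + 0, h⟩ : Fin (n * 2)) = finProdFinEquiv (j, (0 : Fin 2)) := fun h =>
    Fin.ext (by rw [finProdFinEquiv_apply_val]; simp; omega)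
  have h1 : ∀ h, (⟨j * 2 + 1, h⟩ : Fin (n * 2)) = finProdFinEquiv (j, (1 : Fin 2)) := fun h =>
    Fin.ext (by rw [finProdFinEquiv_apply_val]; simp; omega)
  simp only [Function.comp, List.ofFn_succ, List.ofFn_zero, List.map_cons, List.map_nil]
  rw [← h0, ← h1]
  rfl

theorem fermiModel_computable (q : ℕ) : (fermiModel q).Computable where
  one {ι n u k} hk := by
    refine (hk.flatMapFin (f := fun _ _ => [enc false, enc false])
      (const (loopVar hk).1 (dlist [enc false, enc false]))).congr fun a => ?_
    rw [enc_modes]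
    simp [fermiModel]
  el {ι n u k S} hk hS w := by
    by_cases h : Even (monomialOf w).card
    · have hb : ∀ b : Fin 2, PolyComp (fun t : Σ a, Fin (k a) => n t.1)
          (fun t => .cons (u t.1) (enc t.2)) fun t =>
            enc (decide (finProdFinEquiv (t.2, b) ∈ (monomialOf w).map (selEmb (S t.1)).toEmbedding)) := by
        intro b
        refine (lookup (fun j => enc (decide (finProdFinEquiv (j, b) ∈ monomialOf w))) (enc false)
          (hS.inLoop hk) (loopVar hk)).congr fun t => ?_
        rw [decide_mem_map_selEmb]
        exact (Function.apply_extend enc (S t.1) _ t.2).symm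
      refine (hk.flatMapFin (f := fun a j => [enc (decide (finProdFinEquiv (j, (0 : Fin 2)) ∈
          (monomialOf w).map (selEmb (S a)).toEmbedding)), enc (decide (finProdFinEquiv
            (j, (1 : Fin 2)) ∈ (monomialOf w).map (selEmb (S a)).toEmbedding))])
          ((hb 0).cons ((hb 1).cons (nil (hb 0).1)))).congr fun a => ?_
      rw [← enc_modes]
      exact congrArg enc (if_pos h).symm
    · refine (hk.flatMapFin (f := fun _ _ => [enc false, enc false])
        (const (loopVar hk).1 (dlist [enc false, enc false]))).congr fun a => ?_
      have he : (fermiModel q).el (S a) w = ∅ := if_neg h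
      rw [he, enc_modes]
      simp

end

end QHard

/-! ### Computability of the compiler, parity averaging and the conclusion. -/

namespace QHard

open Enc (enc)
open scoped ComplexOrder MatrixOrder

noncomputable section

set_option linter.unusedSectionVars false

open PolyComp

namespace PolyComp

variable {ι : Type} {n : ι → ℕ} {u : ι → Data}

theorem compileQubit {anc : ι → ℕ} (q : ℕ) {g : ∀ a, Gate (Fin (anc a))}
    (hg : PolyComp n u fun a => enc (g a)) : PolyComp n u fun a =>
      enc ((g a).relabel (Function.Embedding.inr : Fin (anc a) ↪ Fin q ⊕ Fin (anc a))) :=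
  (comp_mapGate (φ := fun _ => Data.cons (enc true)) (fun hv => (const hv.1 (enc true)).cons hv)
    hg).congr fun a => (enc_relabel (fun _ => rfl) (g a)).symm

/-- For fixed `q` there are finitely many sets `K`, so the circuits obtained by choice are stored in
a table. Only the ancilla `z` is inserted at run time. -/
theorem compileRot {anc : ι → ℕ} {q : ℕ} {K : ι → Finset (Fin (q * 2))} {z : ∀ a, Fin (anc a)}
    (hK : PolyComp n u fun a => enc (K a)) (hz : PolyComp n u fun a => enc (z a)) :
    PolyComp n u fun a => enc ((rotCircuit (K a)).map (Gate.relabel (rotEmb q (z a)))) := by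
  classical
  have hc : PolyComp n u fun a => enc (rotCircuit (K a)) := by
    simp only [enc_finset] at hK
    refine (bool_table (fun f => enc (rotCircuit (Finset.univ.filter fun j => f j = true)))
      hK).congr fun a => ?_
    simp
  refine relabelGates (φ := fun a d => if d.hd = .nil then d else .cons (enc true) (enc (z a)))
    (fun a i => ?_) (fun hw hv => ?_) hc
  · rcases i with j | j
    · exact (if_pos rfl).symm
    · exact (if_neg Data.noConfusion).symm
  · refine (hv.hd.ite hv ((const hv.1 (enc true)).cons
      ((hz.reindex Sigma.fst).weaken hw))).congr fun t => ?_
    split_ifs <;> rfl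

/-- Case distinction on the tag of the gate. The parameters of a gate exist only in its own case,
which is why the branches are computed over subtypes. -/
theorem compileGate {anc : ι → ℕ} {q : ℕ} {g : ∀ a, FermiGate q (anc a)}
    (hg : PolyComp n u fun a => enc (g a)) : PolyComp n u fun a => enc (g a).compile := by
  refine hg.hd.ite_subtype ?_ ?_
  · have h : ∀ a : {a // (enc (g a)).hd ≠ .nil}, ∃ K hK z, g a = .rot K hK z := by
      rintro ⟨a, ha⟩
      cases e : g a with
      | qubit g' => exact absurd (by rw [e]; rfl) ha
      | rot K hK z => exact ⟨K, hK, z, rfl⟩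
    choose K hK z h using h
    have hg' := hg.reindex (Subtype.val : {a // (enc (g a)).hd ≠ .nil} → ι)
    refine (compileRot (hg'.tl.hd.congr (w := fun a => enc (K a)) fun a => ?_) (hg'.tl.tl.congr (w := fun a => enc (z a))
      fun a => ?_)).congr fun a => ?_
    all_goals rw [h]; rfl
  · have h : ∀ a : {a // (enc (g a)).hd = .nil}, ∃ g', g a = .qubit g' := by
      rintro ⟨a, ha⟩
      cases e : g a with
      | qubit g' => exact ⟨g', rfl⟩
      | rot K hK z =>
        rw [e] at ha
        exact Data.noConfusion ha
    choose g' h using h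
    have hg' := hg.reindex (Subtype.val : {a // (enc (g a)).hd = .nil} → ι)
    have hq := compileQubit q (hg'.tl.congr (w := fun a => enc (g' a)) fun a => by rw [h]; rfl)
    refine (hq.cons (nil hq.1)).congr fun a => ?_
    rw [h]
    rfl

theorem toQubit {p : ι → ℕ} {q : ℕ} {V : ∀ a, FermiCheck (p a) q}
    (hV : PolyComp n u fun a => enc (V a)) : PolyComp n u fun a => enc (V a).toQubit := by
  have hS : PolyComp n u fun a => enc (V a).1 := hV.hd
  have ha : PolyComp n u fun a => enc (V a).2.1 := hV.tl.hd
  have hg : PolyComp n u fun a => enc (V a).2.2 := hV.tl.tl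
  refine hS.cons (ha.cons ?_)
  have hb := bdd_mem hg
  simp only [enc_list] at hg
  refine (flatMap_list (fun _ => enc) (fun a g => g.compile.map enc) hg ?_).congr fun a => ?_
  · refine (compileGate (g := fun t : Σ a, {g // g ∈ (V a).2.2} => t.2.1)
      (snd (hg.1.reindex Sigma.fst) hb)).congr fun t => enc_list _
  · rw [← List.map_flatMap, ← enc_list]
    rfl

end PolyComp

/-- Removing the odd components of a state. -/
theorem exists_isFermionicState {n : ℕ} {ρ : Op (Fin n)} (hρ : IsDensity ρ) :
    ∃ ρ' : Op (Fin n), IsFermionicState ρ' ∧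
      ∀ A : Op (Fin n), parityOp n * A = A * parityOp n → expect ρ' A = expect ρ A := by
  set Q := parityOp n with hQ
  have hQ2 : Q * Q = 1 := parityOp_mul_self n
  have hps : (Q * ρ * Q).PosSemidef := by
    have h := hρ.1.conjTranspose_mul_mul_same Q
    rwa [parityOp_conjTranspose] at h
  have htr : ∀ A : Op (Fin n), Q * A = A * Q → (Q * ρ * Q * A).trace = (ρ * A).trace := by
    intro A hA
    rw [mul_assoc, hA, Matrix.trace_mul_comm, ← mul_assoc, mul_assoc A, hQ2, mul_one,
      Matrix.trace_mul_comm]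
  -- The average over the parity commutes with the parity, and operators that do so cannot
  -- distinguish it from `ρ`.
  refine ⟨(1 / 2 : ℝ) • (ρ + Q * ρ * Q), ⟨⟨?_, ?_⟩, mem_span_even ?_⟩, fun A hA => ?_⟩
  · exact Matrix.nonneg_iff_posSemidef.1
      (smul_nonneg_matrix (hρ.1.add hps).nonneg (by norm_num))
  · have h := htr 1 (by rw [mul_one, one_mul])
    rw [mul_one, mul_one] at h
    rw [Matrix.trace_smul, Matrix.trace_add, h, hρ.2, Complex.real_smul]
    norm_num
  · rw [mul_smul_comm, smul_mul_assoc, ← hQ]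
    congr 1
    rw [mul_add, add_mul, mul_assoc Q ρ Q, ← mul_assoc Q Q, hQ2, one_mul, mul_assoc Q (ρ * Q),
      mul_assoc ρ, hQ2, mul_one, add_comm]
  · have h := htr A hA
    rw [expect, expect, smul_mul_assoc, add_mul, Matrix.trace_smul, Matrix.trace_add, h,
      Complex.smul_re, Complex.add_re, smul_eq_mul]
    ring

theorem quantumPolyReduces_fermi (q : ℕ) {a b : ℝ} (ha : 1 / 3 < a) (hab : a < b) (hb : b < 2 / 3)
    {L : PromiseProblem (List Bool)} (hL : L ∈ FermPCP q) :
    QuantumPolyReduces L (fermiLHD (2 * q) 1 a b hab) := by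
  obtain ⟨p, R, time, verifier, V, hV, hyes, hno⟩ := hL
  have heff : ∀ x r (ρ : Op (Fin (p.eval x.length))),
      expect ρ ((fermiModel q).effect (V x r).toQubit) = fermiAccept ρ (V x r) := by
    intro x r ρ
    rw [fermiAccept_eq, fermiModel_effect]
    rfl
  refine OperatorModel.quantumPolyReduces (fermiModel_computable q) (fun x r => (V x r).toQubit)
    (of_computesWithin verifier time (bdd_cons (bdd_bits PolyBdd.self fun _ => le_rfl)
      (bdd_coins (PolyBdd.eval R))) fun t => hV t.1 t.2).toQubit ?_ ?_ ?_ ?_ ha hb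
    (FermiLocal (2 * q)) ?_ (fun H hl hH hE => ⟨hl, hH, hE⟩) (fun H hl hH hE => ⟨hl, hH, hE⟩)
  · intro x r
    rw [fermiModel_effect]
    exact (posSemidef_map_starAlgHom _ (acceptEffect_posSemidef _)).nonneg
  · intro x r
    have h := (posSemidef_map_starAlgHom (fermiEmbed (V x r).1)
      (one_sub_acceptEffect_posSemidef (V x r).toQubit.2.2)).nonneg
    rw [map_sub, map_one, sub_nonneg] at h
    rw [fermiModel_effect]
    exact h
  · intro x hx
    obtain ⟨ρ, hρ, h⟩ := hyes x hx
    simp only [heff]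
    exact ⟨ρ, hρ.1, h⟩
  · intro x hx ρ hρ
    -- Soundness holds for fermionic states only, but the lowest energy ranges over all states.
    -- Effects commute with the parity, so `ρ` may be replaced by its even part.
    obtain ⟨ρ', hρ', h⟩ := exists_isFermionicState hρ
    have h' := hno x hx ρ' hρ'
    simp only [← heff, h _ (parityOp_mul_effect _)] at h'
    exact h'
  · intro n H h T hT
    obtain ⟨S, hS⟩ := h T hT
    refine ⟨Finset.univ.map (selEmb S).toEmbedding, by simp [mul_comm], fun u hu => ?_⟩
    rcases hS u hu with h | ⟨w, h⟩
    · rw [h]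
      exact ⟨Finset.empty_subset _, Even.zero⟩
    · rw [h]
      refine ⟨?_, even_card_evenMonomial S w⟩
      change evenMonomial S w ⊆ _
      rw [evenMonomial]
      split_ifs
      · exact Finset.map_subset_map.2 (Finset.subset_univ _)
      · exact Finset.empty_subset _

end

end QHard

theorem mainTheorem4 (q : ℕ) (a b : ℝ) (ha : 1 / 3 < a) (hab : a < b) (hb : b < 2 / 3) :
    QHard.IsQuantumHard (QHard.qubitLHD q 1 a b hab) (QHard.QPCP q) ∧
      QHard.IsQuantumHard (QHard.fermiLHD (2 * q) 1 a b hab) (QHard.FermPCP q) := by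
  refine ⟨fun _ hL => QHard.quantumPolyReduces_qubit q ha hab hb hL,
   fun _ hL => QHard.quantumPolyReduces_fermi q ha hab hb hL⟩
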